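/- **Notation.** Let $\mathcal F$ be the unitary Fourier transformation on $L^2(\mathbb R)$, $(\mathcal Ff)(x)=(2\pi)^{-1/2}\int e^{-ixy}f(y)\,dy$, let $P_+:L^2(\mathbb R)\to L^2(\mathbb R_+)$ be the restriction to $\mathbb R_+=\,]0,\infty[$, and let $P_+^*$ be the extension by zero. $H_+:=\operatorname{ran}(\mathcal F^{-1}P_+^*)\subset L^2(\mathbb R)$ is the Hardy space of the upper half-plane and $P_{H_+}$ the orthogonal projection of $L^2(\mathbb R)$ onto it. For measurable $\kappa:\mathbb R\to\mathbb C$ let $M(\kappa)$ be multiplication by $\kappa$ in $L^2(\mathbb R)$ with domain $\{f:\kappa f\in L^2(\mathbb R)\}$, let $M_+(\kappa):=P_{H_+}M(\kappa)P_{H_+}^*$ in $H_+$, with domain $\{h\in H_+:\kappa h\in L^2(\mathbb R)\}$, and let $W_\kappa:=P_+\mathcal FM(\kappa)\mathcal F^{-1}P_+^*$ in $L^2(\mathbb R_+)$, on its natural domain, be the Wiener–Hopf operator with symbol $\kappa$. For a non-zero complex polynomial $P$ let $P_<,P_\le,P_>,P_\ge$ be the monic polynomials whose zeros, with multiplicities,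 are exactly the zeros of $P$ in the open lower, closed lower, open upper and closed upper half-plane, respectively. Let $\tilde P$ be the polynomial whose coefficients are the complex conjugates of those of $P$; $\tilde P_<$ means $(\tilde P)_<$. Likewise for $Q$. A polynomial of negative degree is the null polynomial. A densely defined closed operator is called Fredholm if its kernel and its cokernel (the quotient by its range) are finite-dimensional and its range is closed. **Theorem.** Let $P\neq0$ and $Q\ne0$ be complex polynomials without common zeros and let $\kappa=P/Q$ on $\mathbb R$ (defined off the real zeros of $Q$). Let $q$ be the monic polynomial whose zeros, with multiplicities, are the real zeros of $Q$, let $c$ be the leading coefficient of $Q$ (so $Q=c\,Q_<\,q\,Q_>$), and put $\varsigma:=\max\{\deg q,\ \deg P-\deg Q+\deg q\}$. Then $M_+(\kappa)$ is densely defined and closed, and (a) $\operatorname{dom}M_+(\kappa)=\frac{q}{(x+i)^\varsigma}H_+$; moreover $\frac{P}{c\,Q_>Q_<(x+i)^\varsigma}H_+\subset L^2(\mathbb R)$ and $\operatorname{ran}M_+(\kappa)=P_{H_+}\Big(\frac{P}{c\,Q_>Q_<(x+i)^\varsigma}H_+\Big)$; (b) $\ker M_+(\kappa)=\Big\{\frac{Q_\le}{P_<}\,r: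 r\text{ a polynomial},\ \deg r<\min\{\deg P_<-\deg Q_\le,\ \deg Q_>-\deg P_\ge\}\Big\}$, which is finite-dimensional; (c) $(\operatorname{ran}M_+(\kappa))^\perp=\Big\{\frac{\tilde Q_<}{\tilde P_<}\,r: r\text{ a polynomial},\ \deg r<\deg P_>-\deg Q_>\Big\}$ (orthogonal complement in $H_+$), which is finite-dimensional; (d) the following are equivalent: (1) $M_+(\kappa)$ is a Fredholm operator; (2) $\operatorname{ran}M_+(\kappa)$ is closed; (3) $\deg Q\le\deg P$ and $P$ has no real zeros; (4) $0\notin\overline{\kappa(\mathbb R)}$, where $\kappa(\mathbb R)=\{\kappa(x):x\in\mathbb R,\ Q(x)\neq0\}$. The map $g\mapsto\mathcal F^{-1}P_+^*g$ is a Hilbert space isomorphism $L^2(\mathbb R_+)\to H_+$ which carries $W_\kappa$ over to $M_+(\kappa)$; hence $W_\kappa$ is densely defined and closed as well, and $\ker W_\kappa$ and $(\operatorname{ran}W_\kappa)^\perp$ are finite-dimensional. -/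

import Mathlib

open MeasureTheory Polynomial
open scoped ENNReal

noncomputable section

namespace WienerHopf

/-! ### Unbounded operators -/

section Operators

variable {E F G : Type*} [NormedAddCommGroup E] [NormedSpace ℂ E]
  [NormedAddCommGroup F] [NormedSpace ℂ F] [NormedAddCommGroup G] [NormedSpace ℂ G]

/-- The operator product `U A V` on its natural domain `{x | V x ∈ dom A}`, where `U` and `V` are
everywhere defined. -/
def sandwich (U : F →ₗ[ℂ] G) (A : E →ₗ.[ℂ] F) (V : G →ₗ[ℂ] E) : G →ₗ.[ℂ] G where
  domain := A.domain.comap V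
  toFun := U ∘ₗ A.toFun ∘ₗ (V.restrict (p := A.domain.comap V) (q := A.domain) fun _ hx => hx)

/-- `ker A`, as a subspace of the ambient space. -/
def kernel (A : E →ₗ.[ℂ] F) : Submodule ℂ E :=
  (LinearMap.ker A.toFun).map A.domain.subtype

/-- `ran A`. -/
def range (A : E →ₗ.[ℂ] F) : Submodule ℂ F :=
  LinearMap.range A.toFun

/-- A Fredholm operator: densely defined, closed, with closed range and with finite dimensional
kernel and cokernel. -/
structure IsFredholmOp (A : E →ₗ.[ℂ] F) : Prop where
  dense_domain : Dense (A.domain : Set E)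
  isClosed : A.IsClosed
  isClosed_range : _root_.IsClosed (range A : Set F)
  finite_kernel : FiniteDimensional ℂ (kernel A)
  finite_cokernel : FiniteDimensional ℂ (F ⧸ range A)

end Operators

/-! ### The spaces `L²(ℝ)` and `L²(ℝ₊)`, and the Fourier transformation -/

/-- `L²(ℝ)`. -/
abbrev L2R : Type := Lp ℂ 2 (volume : Measure ℝ)

/-- `L²(ℝ₊)`, where `ℝ₊ = ]0, ∞[`. -/
abbrev L2Pos : Type := Lp ℂ 2 ((volume : Measure ℝ).restrict (Set.Ioi 0))

/-- The restriction `P₊ : L²(ℝ) → L²(ℝ₊)`. -/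
def restrictPos : L2R →L[ℂ] L2Pos :=
  LpToLpRestrictCLM ℝ ℂ ℂ volume 2 (Set.Ioi 0)

lemma memLp_extend (g : L2Pos) :
    MemLp ((Set.Ioi (0 : ℝ)).indicator (g : ℝ → ℂ)) 2 (volume : Measure ℝ) :=
  (memLp_indicator_iff_restrict measurableSet_Ioi).2 (Lp.memLp g)

lemma extend_coeFn (g : L2Pos) :
    ((memLp_extend g).toLp _ : ℝ → ℂ) =ᵐ[volume] (Set.Ioi (0 : ℝ)).indicator (g : ℝ → ℂ) :=
  (memLp_extend g).coeFn_toLp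

/-- The extension by zero `P₊^* : L²(ℝ₊) → L²(ℝ)`. -/
def extendPos : L2Pos →ₗᵢ[ℂ] L2R where
  toFun g := (memLp_extend g).toLp _
  map_add' f g := by
    refine Lp.ext ?_
    have h := (ae_restrict_iff' (measurableSet_Ioi (a := (0 : ℝ)))).1 (Lp.coeFn_add f g)
    filter_upwards [extend_coeFn (f + g), extend_coeFn f, extend_coeFn g, h,
      Lp.coeFn_add ((memLp_extend f).toLp _) ((memLp_extend g).toLp _)] with x h1 h2 h3 h4 h5
    rw [h1, h5, Pi.add_apply, h2, h3]
    by_cases hx : x ∈ Set.Ioi (0 : ℝ)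
    · simp only [Set.indicator_of_mem hx, h4 hx, Pi.add_apply]
    · simp only [Set.indicator_of_notMem hx, add_zero]
  map_smul' c g := by
    refine Lp.ext ?_
    have h := (ae_restrict_iff' (measurableSet_Ioi (a := (0 : ℝ)))).1 (Lp.coeFn_smul c g)
    filter_upwards [extend_coeFn (c • g), extend_coeFn g, h,
      Lp.coeFn_smul c ((memLp_extend g).toLp _)] with x h1 h2 h3 h4
    rw [RingHom.id_apply, h1, h4, Pi.smul_apply, h2]
    by_cases hx : x ∈ Set.Ioi (0 : ℝ)
    · simp only [Set.indicator_of_mem hx, h3 hx, Pi.smul_apply]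
    · simp only [Set.indicator_of_notMem hx, smul_zero]
  norm_map' g := by
    change ‖(memLp_extend g).toLp _‖ = ‖g‖
    rw [Lp.norm_toLp, eLpNorm_indicator_eq_eLpNorm_restrict measurableSet_Ioi, Lp.norm_def]

lemma quasi_dilate {c : ℝ} (hc : 0 < c) :
    Measure.QuasiMeasurePreserving (fun x : ℝ => c * x) volume volume :=
  ⟨measurable_const_mul c, by
    rw [Real.map_volume_mul_left hc.ne']; exact Measure.smul_absolutelyContinuous⟩

lemma eLpNorm_dilate {c : ℝ} (hc : 0 < c) {f : ℝ → ℂ} (hf : AEStronglyMeasurable f volume) :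
    eLpNorm (fun x : ℝ => ((√c : ℝ) : ℂ) * f (c * x)) 2 volume = eLpNorm f 2 volume := by
  have h1 : eLpNorm (fun x : ℝ => f (c * x)) 2 volume
      = ENNReal.ofReal (c⁻¹) ^ (1 / 2 : ℝ) * eLpNorm f 2 volume := by
    have hm : Measure.map (fun x : ℝ => c * x) volume = ENNReal.ofReal (c⁻¹) • volume := by
      rw [Real.map_volume_mul_left hc.ne', abs_of_pos (inv_pos.2 hc)]
    have h := eLpNorm_map_measure (p := 2) (f := fun x : ℝ => c * x) (g := f)
      (μ := (volume : Measure ℝ)) (by rw [hm]; exact hf.smul_measure _)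
      (measurable_const_mul c).aemeasurable
    rw [hm, eLpNorm_smul_measure_of_ne_top (by simp)] at h
    simpa [Function.comp_def] using h.symm
  have h2 : (fun x : ℝ => ((√c : ℝ) : ℂ) * f (c * x))
      = ((√c : ℝ) : ℂ) • fun x : ℝ => f (c * x) := rfl
  rw [h2, eLpNorm_const_smul, h1, ← mul_assoc]
  have h3 : ‖((√c : ℝ) : ℂ)‖ₑ * ENNReal.ofReal (c⁻¹) ^ (1 / 2 : ℝ) = 1 := by
    rw [← ofReal_norm, Complex.norm_real, Real.norm_of_nonneg (Real.sqrt_nonneg c),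
      ENNReal.ofReal_rpow_of_pos (inv_pos.2 hc), ← ENNReal.ofReal_mul (Real.sqrt_nonneg c),
      ← Real.sqrt_eq_rpow, Real.sqrt_inv, mul_inv_cancel₀ (Real.sqrt_pos.2 hc).ne',
      ENNReal.ofReal_one]
  rw [h3, one_mul]

lemma memLp_dilate {c : ℝ} (hc : 0 < c) (f : L2R) :
    MemLp (fun x : ℝ => ((√c : ℝ) : ℂ) * f (c * x)) 2 volume := by
  refine ⟨?_, ?_⟩
  · exact ((Lp.aestronglyMeasurable f).comp_quasiMeasurePreserving (quasi_dilate hc)).const_mul _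
  · rw [eLpNorm_dilate hc (Lp.aestronglyMeasurable f)]
    exact (Lp.memLp f).2

/-- The unitary dilation `(D f)(x) = √c f(c x)`, as a linear isometry. -/
def dilateAux {c : ℝ} (hc : 0 < c) : L2R →ₗᵢ[ℂ] L2R where
  toFun f := (memLp_dilate hc f).toLp _
  map_add' f g := by
    refine Lp.ext ?_
    filter_upwards [(memLp_dilate hc (f + g)).coeFn_toLp, (memLp_dilate hc f).coeFn_toLp,
      (memLp_dilate hc g).coeFn_toLp, (quasi_dilate hc).ae (Lp.coeFn_add f g),
      Lp.coeFn_add ((memLp_dilate hc f).toLp _) ((memLp_dilate hc g).toLp _)] with x h1 h2 h3 h4 h5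
    rw [h1, h5, Pi.add_apply, h2, h3, h4, Pi.add_apply, mul_add]
  map_smul' a f := by
    refine Lp.ext ?_
    filter_upwards [(memLp_dilate hc (a • f)).coeFn_toLp, (memLp_dilate hc f).coeFn_toLp,
      (quasi_dilate hc).ae (Lp.coeFn_smul a f),
      Lp.coeFn_smul a ((memLp_dilate hc f).toLp _)] with x h1 h2 h3 h4
    rw [RingHom.id_apply, h1, h4, Pi.smul_apply, h2, h3, Pi.smul_apply, smul_eq_mul, smul_eq_mul]
    ring
  norm_map' f := by
    change ‖(memLp_dilate hc f).toLp _‖ = ‖f‖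
    rw [Lp.norm_toLp, eLpNorm_dilate hc (Lp.aestronglyMeasurable f), Lp.norm_def]

lemma dilateAux_coeFn {c : ℝ} (hc : 0 < c) (f : L2R) :
    (dilateAux hc f : ℝ → ℂ) =ᵐ[volume] fun x => ((√c : ℝ) : ℂ) * f (c * x) :=
  (memLp_dilate hc f).coeFn_toLp

lemma dilateAux_comp {c d : ℝ} (hc : 0 < c) (hd : 0 < d) (hcd : d * c = 1) (f : L2R) :
    dilateAux hc (dilateAux hd f) = f := by
  refine Lp.ext ?_
  filter_upwards [dilateAux_coeFn hc (dilateAux hd f),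
    (quasi_dilate hc).ae (dilateAux_coeFn hd f)] with x h1 h2
  rw [h1, h2, ← mul_assoc, ← mul_assoc, hcd, one_mul, ← Complex.ofReal_mul,
    ← Real.sqrt_mul hc.le, mul_comm c d, hcd, Real.sqrt_one, Complex.ofReal_one, one_mul]

/-- The unitary dilation `(D f)(x) = √c f(c x)` of `L²(ℝ)`. -/
def dilate {c : ℝ} (hc : 0 < c) : L2R ≃ₗᵢ[ℂ] L2R where
  toLinearEquiv := LinearEquiv.ofLinearMap (dilateAux hc).toLinearMap
    (dilateAux (inv_pos.2 hc)).toLinearMap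
    (LinearMap.ext fun f => dilateAux_comp hc (inv_pos.2 hc) (inv_mul_cancel₀ hc.ne') f)
    (LinearMap.ext fun f => dilateAux_comp (inv_pos.2 hc) hc (mul_inv_cancel₀ hc.ne') f)
  norm_map' f := (dilateAux hc).norm_map f

/-- The Fourier transformation `(ℱ f)(x) = (2π)^{-1/2} ∫ e^{-ixy} f(y) dy` on `L²(ℝ)`. It equals
`(2π)^{-1/2} (𝓕 f)(x / (2π))`, with Mathlib's `(𝓕 f)(ξ) = ∫ e^{-2πiξy} f(y) dy`. -/
def fourierL2 : L2R ≃ₗᵢ[ℂ] L2R :=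
  (Lp.fourierTransformₗᵢ ℝ ℂ).trans (dilate (c := (2 * Real.pi)⁻¹) (inv_pos.2 Real.two_pi_pos))

/-! ### Multiplication operators, the Hardy space, `W_κ` and `M₊(κ)` -/

/-- The multiplication operator `M(κ)` in `L²(ℝ)` with domain `{f | κ f ∈ L²(ℝ)}`. -/
def mulOp (κ : ℝ → ℂ) : L2R →ₗ.[ℂ] L2R where
  domain :=
    { carrier := {f | MemLp (fun x => κ x * f x) 2 volume}
      zero_mem' := by
        refine (MemLp.zero' (ε := ℂ)).ae_eq ?_
        filter_upwards [Lp.coeFn_zero ℂ 2 (volume : Measure ℝ)] with x hx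
        rw [hx, Pi.zero_apply, mul_zero]
      add_mem' := fun {f g} hf hg => by
        refine (MemLp.add hf hg).ae_eq ?_
        filter_upwards [Lp.coeFn_add f g] with x hx
        rw [hx, Pi.add_apply, Pi.add_apply, mul_add]
      smul_mem' := fun a f hf => by
        refine (MemLp.const_smul hf a).ae_eq ?_
        filter_upwards [Lp.coeFn_smul a f] with x hx
        rw [hx, Pi.smul_apply, Pi.smul_apply, smul_eq_mul, smul_eq_mul, mul_left_comm] }
  toFun :=
    { toFun := fun f => MemLp.toLp _ f.2
      map_add' := fun f g => by
        rw [← MemLp.toLp_add]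
        refine MemLp.toLp_congr _ _ ?_
        filter_upwards [Lp.coeFn_add (f : L2R) (g : L2R)] with x hx
        rw [Submodule.coe_add, hx, Pi.add_apply, Pi.add_apply, mul_add]
      map_smul' := fun a f => by
        rw [RingHom.id_apply, ← MemLp.toLp_const_smul]
        refine MemLp.toLp_congr _ _ ?_
        filter_upwards [Lp.coeFn_smul a (f : L2R)] with x hx
        rw [Submodule.coe_smul, hx, Pi.smul_apply, Pi.smul_apply, smul_eq_mul, smul_eq_mul,
          mul_left_comm] }

/-- `ℱ⁻¹ P₊^* : L²(ℝ₊) → L²(ℝ)`. -/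
def invFourierPos : L2Pos →ₗᵢ[ℂ] L2R :=
  fourierL2.symm.toLinearIsometry.comp extendPos

/-- The Hardy space `H₊ = ran (ℱ⁻¹ P₊^*)`. -/
def hardyPlus : Submodule ℂ L2R :=
  LinearMap.range invFourierPos.toLinearMap

instance : CompleteSpace hardyPlus :=
  (invFourierPos.isometry.isUniformInducing.isComplete_range).completeSpace_coe

/-- The orthogonal projection `P_{H₊} : L²(ℝ) → H₊`. -/
def hardyProj : L2R →L[ℂ] hardyPlus :=
  hardyPlus.orthogonalProjectionOnto

/-- `M₊(κ) = P_{H₊} M(κ) P_{H₊}^*`, an operator in `H₊`. -/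
def mPlus (κ : ℝ → ℂ) : hardyPlus →ₗ.[ℂ] hardyPlus :=
  sandwich hardyProj.toLinearMap (mulOp κ) hardyPlus.subtype

/-- The Wiener-Hopf operator `W_κ = P₊ ℱ M(κ) ℱ⁻¹ P₊^*` in `L²(ℝ₊)`. -/
def wienerHopf (κ : ℝ → ℂ) : L2Pos →ₗ.[ℂ] L2Pos :=
  sandwich (restrictPos.toLinearMap ∘ₗ fourierL2.toLinearEquiv.toLinearMap) (mulOp κ)
    invFourierPos.toLinearMap

/-! ### Polynomials and rational functions on the real line -/

open Classical in
/-- The monic polynomial whose zeros, with multiplicities, are the zeros of `P` lying in `s`. -/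
def zerosPart (s : Set ℂ) (P : ℂ[X]) : ℂ[X] :=
  ((P.roots.filter (· ∈ s)).map fun a => X - C a).prod

/-- `P_<`: the zeros of `P` in the open lower half-plane. -/
def partLT (P : ℂ[X]) : ℂ[X] := zerosPart {z | z.im < 0} P

/-- `P_≤`: the zeros of `P` in the closed lower half-plane. -/
def partLE (P : ℂ[X]) : ℂ[X] := zerosPart {z | z.im ≤ 0} P

/-- `P_>`: the zeros of `P` in the open upper half-plane. -/
def partGT (P : ℂ[X]) : ℂ[X] := zerosPart {z | 0 < z.im} P

/-- `P_≥`: the zeros of `P` in the closed upper half-plane. -/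
def partGE (P : ℂ[X]) : ℂ[X] := zerosPart {z | 0 ≤ z.im} P

/-- The real zeros of `P`. -/
def partReal (P : ℂ[X]) : ℂ[X] := zerosPart {z | z.im = 0} P

/-- The polynomial with the complex conjugate coefficients. -/
def conjPoly (P : ℂ[X]) : ℂ[X] := P.map (starRingEnd ℂ)

/-- The exponent `max {deg q, deg P - deg Q + deg q}`, where the zeros of `q` are the real zeros
of `Q`. (Truncated subtraction does no harm, as the maximum is never below `deg q`.) -/
def poleExp (P Q : ℂ[X]) : ℕ :=
  max (partReal Q).natDegree (P.natDegree + (partReal Q).natDegree - Q.natDegree)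

/-- The restriction of `P / Q` to the real line (the finitely many real zeros of `Q` form a null
set, on which the value is irrelevant). -/
def ratFun (P Q : ℂ[X]) (x : ℝ) : ℂ := P.eval (x : ℂ) / Q.eval (x : ℂ)

/-- The range `κ(ℝ)` of `κ = P / Q` on the real line without the poles. -/
def ratRange (P Q : ℂ[X]) : Set ℂ := ratFun P Q '' {x : ℝ | Q.eval (x : ℂ) ≠ 0}

/-- A subset of `H₊` as a set of functions modulo almost everywhere equality. -/
def asFunctions (S : Set hardyPlus) : Set (ℝ →ₘ[volume] ℂ) :=
  (fun h : hardyPlus => ((h : L2R) : ℝ →ₘ[volume] ℂ)) '' S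

/-- The set of functions `r H₊`. -/
def mulHardy (r : ℝ → ℂ) : Set (ℝ →ₘ[volume] ℂ) :=
  {f | ∃ k : hardyPlus, f =ᵐ[volume] fun x => r x * (k : L2R) x}

/-- The set of functions `r p` with `p` a polynomial of degree less than the integer `n`, where
only the null polynomial has a negative degree. -/
def mulPoly (r : ℝ → ℂ) (n : ℤ) : Set (ℝ →ₘ[volume] ℂ) :=
  {f | ∃ p : ℂ[X], (p = 0 ∨ (p.natDegree : ℤ) < n) ∧
    f =ᵐ[volume] fun x => r x * p.eval (x : ℂ)}

end WienerHopf

end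

/-!
The proof works with Cauchy integrals instead of analytic continuation. By Plancherel's theorem and
the Fourier transforms of the Cauchy kernels `1 / (x - a)`, a function `u` in `L²(ℝ)` belongs to the
Hardy space `H₊` if and only if `∫ u(x) / (x - a) dx = 0` for all `a` in the open lower half-plane,
and to its orthogonal complement if and only if this holds for all `a` in the open upper half-plane
(`mem_hardyPlus_iff`, `mem_hardyPlus_orthogonal_iff`). Complex conjugation exchanges the two spaces.

Three facts about these spaces carry everything else.

* `H₊` is stable under multiplication by rational functions which are bounded in the closed upper
  half-plane (`InHardyPlus.mul_ratFun`), by the resolvent identity and partial fractions. By an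
  approximation of the denominator this improves to a Smirnov type theorem: if `h` belongs to `H₊`
  and `A` has no zeros in the open upper half-plane, then `B h / A` belongs to `H₊` as soon as it is
  square integrable (`InHardyPlus.of_mul_eq`). Real zeros of `A` are thus admitted, which yields the
  domain (`memLp_ratFun_mul_iff`).
* A function which belongs to the Hardy spaces of both half-planes up to polynomial growth is a
  polynomial (`exists_polynomial_of_growth`).
* The combination of both solves the homogeneous Riemann-Hilbert problem, `h` in `H₊` and
  `(P / Q) h` in the orthogonal complement of `H₊`, in terms of polynomials
  (`inHardyMinus_ratFun_mul_iff`).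

As `M₊(κ) h = g` means that `κ h - g` is orthogonal to `H₊`, the kernel is the solution space of
this problem for `κ`. The deficiency space is the solution space for the complex conjugate of the
bounded multiplier `κ q / (x + i) ^ ς` which occurs in the description of the range.

For `h` in the domain, the remainder `κ h - M₊(κ) h` belongs to a fixed space of finite dimension,
since it has only the poles of `κ` in the closed upper half-plane (`toLp_mem_remainderSpace`). So
`M₊(κ)` inherits from the multiplication operator a closed graph, and a closed range if `1 / κ` is
bounded; then the range has finite codimension, and `M₊(κ)` is a Fredholm operator. Conversely, let
the range be closed, hence of finite codimension, and let `κ` have a zero on the real line or at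
infinity, which is the zero of `s / (x + i)` with `s = x - a` or `s = 1`. Then the subspace
`(s / (x + i)) H₊` would be of finite codimension in `H₊`. It is dense and would be closed, hence
would contain `1 / (x + i)`; but `1 / s` is not in `H₊`.

The assertions on `W_κ` follow by transport along the isomorphism `ℱ⁻¹ P₊^*`
(`mem_graph_wienerHopf_iff`).
-/

/-! ### The Fourier transformation on `L² ∩ L¹` -/

namespace WienerHopf

/-- The Fourier transformation of `L²(ℝ)` in Mathlib's normalization. -/
noncomputable abbrev fourierTwo : L2R ≃ₗᵢ[ℂ] L2R := Lp.fourierTransformₗᵢ ℝ ℂ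

open scoped FourierTransform in
/-- On `L¹ ∩ L²` the inverse Fourier transformation is given by the integral: both sides agree as
tempered distributions. -/
lemma fourierTwo_symm_toLp {f G : ℝ → ℂ} (hf : MemLp f 2 volume) (hf1 : Integrable f)
    (hG : MemLp G 2 volume)
    (h : ∀ x : ℝ, ∫ ξ : ℝ, Complex.exp (2 * Real.pi * Complex.I * x * ξ) * f ξ = G x) :
    fourierTwo.symm (hf.toLp f) = hG.toLp G := by
  have hinj := LinearMap.ker_eq_bot.1
    (Lp.ker_toTemperedDistributionCLM_eq_bot (E := ℝ) (F := ℂ) (μ := volume) (p := 2))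
  apply hinj
  have h0 := Lp.fourierInv_toTemperedDistribution_eq (E := ℝ) (F := ℂ) (hf.toLp f)
  change (Lp.toTemperedDistribution (𝓕⁻ (hf.toLp f)) : TemperedDistribution ℝ ℂ)
    = Lp.toTemperedDistribution (hG.toLp G)
  rw [← h0]
  ext φ
  rw [TemperedDistribution.fourierInv_apply, Lp.toTemperedDistribution_apply,
    Lp.toTemperedDistribution_apply]
  have hGF : ∀ x, G x = 𝓕⁻ f x := fun x => by
    rw [← h x, Real.fourierInv_eq']
    congr 1; ext ξ
    simp only [smul_eq_mul, RCLike.inner_apply, conj_trivial]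
    congr 2; push_cast; ring
  have e1 : ∫ x : ℝ, (𝓕⁻ φ) x • (hf.toLp f : ℝ → ℂ) x = ∫ x : ℝ, (𝓕⁻ (φ : ℝ → ℂ)) x • f x := by
    refine integral_congr_ae ?_
    filter_upwards [hf.coeFn_toLp] with x hx
    rw [hx, SchwartzMap.fourierInv_coe]
  have e2 : ∫ x : ℝ, φ x • (hG.toLp G : ℝ → ℂ) x = ∫ x : ℝ, φ x • 𝓕⁻ f x := by
    refine integral_congr_ae ?_
    filter_upwards [hG.coeFn_toLp] with x hx
    rw [hx, hGF]
  rw [e1, e2]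
  have hc : Continuous fun p : ℝ × ℝ => (-innerₗ ℝ) p.1 p.2 := by
    simp only [LinearMap.neg_apply, innerₗ_apply_apply]; fun_prop
  have := VectorFourier.integral_fourierIntegral_smul_eq_flip (L := -innerₗ ℝ)
      Real.continuous_fourierChar hc φ.integrable hf1 (μ := volume) (ν := volume)
  have hflip : (-innerₗ ℝ).flip = -innerₗ ℝ := by
    ext; simp
  rw [hflip] at this
  exact this

/-- A function which is damped by an exponential on `S` vanishes on `S` if all its exponential
moments along a vertical line vanish. -/
lemma ae_eq_zero_of_exp_moments {S : Set ℝ} (hS : MeasurableSet S) {b : ℝ} {g : ℝ → ℂ}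
    (hg : MemLp g 2 volume)
    (hb : MemLp (S.indicator fun ξ : ℝ => Complex.exp (b * ξ)) 2 volume)
    (hb' : ∃ C : ℝ, ∀ ξ ∈ S, ‖Complex.exp (b * ξ)‖ ≤ C)
    (h : ∀ x : ℝ, ∫ ξ in S, Complex.exp ((2 * Real.pi * Complex.I * x + b) * ξ) * g ξ = 0) :
    ∀ᵐ ξ, ξ ∈ S → g ξ = 0 := by
  set f : ℝ → ℂ := fun ξ => S.indicator (fun ξ : ℝ => Complex.exp (b * ξ)) ξ * g ξ with hfd
  have hf1 : Integrable f := hb.integrable_mul hg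
  have hf : MemLp f 2 volume := by
    obtain ⟨C, hC⟩ := hb'
    refine hg.of_le_mul (c := max C 0) (hb.1.mul hg.1) (ae_of_all _ fun ξ => ?_)
    rw [hfd]; simp only [norm_mul]
    refine mul_le_mul_of_nonneg_right ?_ (norm_nonneg _)
    by_cases hξ : ξ ∈ S
    · rw [Set.indicator_of_mem hξ]; exact (hC ξ hξ).trans (le_max_left _ _)
    · rw [Set.indicator_of_notMem hξ]; simp
  have hz : MemLp (fun _ : ℝ => (0 : ℂ)) 2 volume := MemLp.zero
  have key := fourierTwo_symm_toLp hf hf1 hz (fun x => by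
    rw [← h x, ← integral_indicator hS]
    congr 1; ext ξ
    by_cases hξ : ξ ∈ S
    · simp only [hfd, Set.indicator_of_mem hξ, add_mul, Complex.exp_add]; ring
    · simp only [hfd, Set.indicator_of_notMem hξ]; ring)
  have h0 : hf.toLp f = 0 := by
    apply fourierTwo.symm.injective
    rw [key, map_zero]
    exact MemLp.toLp_zero hz
  have h1 : f =ᵐ[volume] 0 := by
    have := hf.coeFn_toLp
    rw [h0] at this
    exact this.symm.trans (Lp.coeFn_zero ℂ 2 volume)
  filter_upwards [h1] with ξ hξ hS'
  simp only [hfd, Set.indicator_of_mem hS', Pi.zero_apply] at hξ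
  exact (mul_eq_zero.1 hξ).resolve_left (Complex.exp_ne_zero _)

lemma norm_exp_mul_real (c : ℂ) (ξ : ℝ) : ‖Complex.exp (c * ξ)‖ = Real.exp (c.re * ξ) := by
  rw [Complex.norm_exp]; simp

lemma memLp_exp_Ioi {c : ℂ} (hc : c.re < 0) (p : ℝ≥0∞) (hp : p = 1 ∨ p = 2) :
    MemLp ((Set.Ioi 0).indicator fun ξ : ℝ => Complex.exp (c * ξ)) p volume := by
  have key : ∀ c : ℂ, c.re < 0 →
      Integrable ((Set.Ioi 0).indicator fun ξ : ℝ => Complex.exp (c * ξ)) := fun c hc =>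
    (integrableOn_exp_mul_complex_Ioi hc 0).integrable_indicator measurableSet_Ioi
  rcases hp with rfl | rfl
  · exact memLp_one_iff_integrable.2 (key c hc)
  · refine (memLp_two_iff_integrable_sq_norm (key c hc).1).2 ?_
    refine (key (2 * c) (by simp; linarith)).norm.congr (ae_of_all _ fun ξ => ?_)
    by_cases hξ : ξ ∈ Set.Ioi (0 : ℝ)
    · simp only [Set.indicator_of_mem hξ, norm_exp_mul_real, ← Real.exp_nat_mul]
      congr 1; simp; ring
    · simp [Set.indicator_of_notMem hξ]

lemma memLp_exp_Iio {c : ℂ} (hc : 0 < c.re) (p : ℝ≥0∞) (hp : p = 1 ∨ p = 2) :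
    MemLp ((Set.Iio 0).indicator fun ξ : ℝ => Complex.exp (c * ξ)) p volume := by
  have h := (memLp_exp_Ioi (c := -c) (by simpa using hc) p hp).comp_measurePreserving
    (Measure.measurePreserving_neg volume)
  refine h.ae_eq (ae_of_all _ fun ξ => ?_)
  simp only [Function.comp, Set.indicator_apply, Set.mem_Ioi, Set.mem_Iio, Left.neg_pos_iff]
  simp

/-! ### The Cauchy kernels -/

/-- A real number differs from every number off the real line. -/
lemma ofReal_sub_ne_zero {a : ℂ} (ha : a.im ≠ 0) (x : ℝ) : (x : ℂ) - a ≠ 0 := by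
  intro h
  apply ha
  have := congrArg Complex.im h
  simpa using this

lemma integral_exp_Ioi_cauchy {a : ℂ} (ha : a.im < 0) (x : ℝ) :
    ∫ ξ : ℝ, Complex.exp (2 * Real.pi * Complex.I * x * ξ) *
      (-(2 * Real.pi * Complex.I) * (Set.Ioi (0 : ℝ)).indicator
        (fun ξ : ℝ => Complex.exp (-(2 * Real.pi * Complex.I * a) * ξ)) ξ) = 1 / (x - a) := by
  have h1 : ∀ ξ : ℝ, Complex.exp (2 * Real.pi * Complex.I * x * ξ) *
      (-(2 * Real.pi * Complex.I) * (Set.Ioi (0 : ℝ)).indicator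
        (fun ξ : ℝ => Complex.exp (-(2 * Real.pi * Complex.I * a) * ξ)) ξ)
      = -(2 * Real.pi * Complex.I) * (Set.Ioi (0 : ℝ)).indicator
        (fun ξ : ℝ => Complex.exp ((2 * Real.pi * Complex.I * (x - a)) * ξ)) ξ := fun ξ => by
    by_cases hξ : ξ ∈ Set.Ioi (0 : ℝ)
    · simp only [Set.indicator_of_mem hξ]
      rw [mul_left_comm, ← Complex.exp_add]; ring_nf
    · simp only [Set.indicator_of_notMem hξ]; ring
  simp_rw [h1]
  have hne := ofReal_sub_ne_zero ha.ne x
  have hpi : (Real.pi : ℂ) ≠ 0 := by exact_mod_cast Real.pi_ne_zero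
  rw [integral_const_mul, integral_indicator measurableSet_Ioi, integral_exp_mul_complex_Ioi]
  · have hI := Complex.I_ne_zero
    simp only [Complex.ofReal_zero, mul_zero, Complex.exp_zero]
    field_simp
  · simp; nlinarith [Real.pi_pos]

lemma integral_exp_Iio_cauchy {a : ℂ} (ha : 0 < a.im) (x : ℝ) :
    ∫ ξ : ℝ, Complex.exp (2 * Real.pi * Complex.I * x * ξ) *
      ((2 * Real.pi * Complex.I) * (Set.Iio (0 : ℝ)).indicator
        (fun ξ : ℝ => Complex.exp (-(2 * Real.pi * Complex.I * a) * ξ)) ξ) = 1 / (x - a) := by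
  have h1 : ∀ ξ : ℝ, Complex.exp (2 * Real.pi * Complex.I * x * ξ) *
      ((2 * Real.pi * Complex.I) * (Set.Iio (0 : ℝ)).indicator
        (fun ξ : ℝ => Complex.exp (-(2 * Real.pi * Complex.I * a) * ξ)) ξ)
      = (2 * Real.pi * Complex.I) * (Set.Iio (0 : ℝ)).indicator
        (fun ξ : ℝ => Complex.exp ((2 * Real.pi * Complex.I * (x - a)) * ξ)) ξ := fun ξ => by
    by_cases hξ : ξ ∈ Set.Iio (0 : ℝ)
    · simp only [Set.indicator_of_mem hξ]
      rw [mul_left_comm, ← Complex.exp_add]; ring_nf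
    · simp only [Set.indicator_of_notMem hξ]; ring
  simp_rw [h1]
  have hne := ofReal_sub_ne_zero ha.ne' x
  have hpi : (Real.pi : ℂ) ≠ 0 := by exact_mod_cast Real.pi_ne_zero
  rw [integral_const_mul, integral_indicator measurableSet_Iio,
    ← integral_Iic_eq_integral_Iio, integral_exp_mul_complex_Iic]
  · have hI := Complex.I_ne_zero
    simp only [Complex.ofReal_zero, mul_zero, Complex.exp_zero]
    field_simp
  · simp; nlinarith [Real.pi_pos]

lemma memLp_cauchy {a : ℂ} (ha : a.im ≠ 0) :
    MemLp (fun x : ℝ => 1 / ((x : ℂ) - a)) 2 volume := by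
  have hc : Continuous fun x : ℝ => 1 / ((x : ℂ) - a) :=
    continuous_const.div (by fun_prop) (ofReal_sub_ne_zero ha)
  refine (memLp_two_iff_integrable_sq_norm hc.aestronglyMeasurable).2 ?_
  have h2 : Integrable fun x : ℝ => (a.im ^ 2)⁻¹ * (1 + (a.im⁻¹ * (x - a.re)) ^ 2)⁻¹ :=
    (((integrable_inv_one_add_sq.comp_mul_left' (inv_ne_zero ha)).comp_sub_right
      a.re)).const_mul _
  refine h2.congr (ae_of_all _ fun x => ?_)
  have : ‖(x : ℂ) - a‖ ^ 2 = (x - a.re) ^ 2 + a.im ^ 2 := by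
    rw [Complex.sq_norm, Complex.normSq_apply]; simp; ring
  simp only [norm_div, norm_one, div_pow, one_pow, this]
  rw [← mul_inv, one_div]
  congr 1
  field_simp
  ring

/-- The Cauchy kernel `x ↦ 1 / (x - a)`, for `a` off the real line, as an element of `L²(ℝ)`. -/
noncomputable def cauchy {a : ℂ} (ha : a.im ≠ 0) : L2R := (memLp_cauchy ha).toLp _

lemma fourierTwo_cauchy_neg {a : ℂ} (ha : a.im < 0) :
    (fourierTwo (cauchy ha.ne) : ℝ → ℂ) =ᵐ[volume] fun ξ =>
      -(2 * Real.pi * Complex.I) * (Set.Ioi (0 : ℝ)).indicator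
        (fun ξ : ℝ => Complex.exp (-(2 * Real.pi * Complex.I * a) * ξ)) ξ := by
  have hre : (-(2 * Real.pi * Complex.I * a)).re < 0 := by simp; nlinarith [Real.pi_pos]
  have hf := (memLp_exp_Ioi hre 2 (Or.inr rfl)).const_mul (-(2 * Real.pi * Complex.I))
  have hf1 := (memLp_one_iff_integrable.1
    ((memLp_exp_Ioi hre 1 (Or.inl rfl)).const_mul (-(2 * Real.pi * Complex.I))))
  have := fourierTwo_symm_toLp hf hf1 (memLp_cauchy ha.ne) (integral_exp_Ioi_cauchy ha)
  rw [cauchy, ← this, LinearIsometryEquiv.apply_symm_apply]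
  exact hf.coeFn_toLp

lemma fourierTwo_cauchy_pos {a : ℂ} (ha : 0 < a.im) :
    (fourierTwo (cauchy ha.ne') : ℝ → ℂ) =ᵐ[volume] fun ξ =>
      (2 * Real.pi * Complex.I) * (Set.Iio (0 : ℝ)).indicator
        (fun ξ : ℝ => Complex.exp (-(2 * Real.pi * Complex.I * a) * ξ)) ξ := by
  have hre : 0 < (-(2 * Real.pi * Complex.I * a)).re := by simp; nlinarith [Real.pi_pos]
  have hf := (memLp_exp_Iio hre 2 (Or.inr rfl)).const_mul (2 * Real.pi * Complex.I)
  have hf1 := (memLp_one_iff_integrable.1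
    ((memLp_exp_Iio hre 1 (Or.inl rfl)).const_mul (2 * Real.pi * Complex.I)))
  have := fourierTwo_symm_toLp hf hf1 (memLp_cauchy ha.ne') (integral_exp_Iio_cauchy ha)
  rw [cauchy, ← this, LinearIsometryEquiv.apply_symm_apply]
  exact hf.coeFn_toLp

/-- Cauchy integrals are inner products with Cauchy kernels. -/
lemma inner_cauchy {a : ℂ} (ha : a.im ≠ 0) (u : L2R) :
    inner ℂ (cauchy (a := starRingEnd ℂ a) (by simpa using ha)) u
      = ∫ x : ℝ, u x / ((x : ℂ) - a) := by
  rw [L2.inner_def]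
  refine integral_congr_ae ?_
  filter_upwards [(memLp_cauchy (a := starRingEnd ℂ a) (by simpa using ha)).coeFn_toLp] with x hx
  simp only [cauchy, hx, RCLike.inner_apply, map_div₀, map_sub, map_one, Complex.conj_conj,
    Complex.conj_ofReal]
  ring

lemma conj_exp_aux (a : ℂ) (ξ : ℝ) :
    (starRingEnd ℂ) (Complex.exp (-(2 * Real.pi * Complex.I * (starRingEnd ℂ) a) * ξ))
      = Complex.exp ((2 * Real.pi * Complex.I * a) * ξ) := by
  rw [← Complex.exp_conj]
  simp only [map_mul, map_neg, Complex.conj_ofReal, Complex.conj_I, Complex.conj_conj, map_ofNat]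
  ring_nf

/-- By unitarity, the Cauchy integral in the lower half-plane is a Laplace transform of the Fourier
transform on the negative half-line. -/
lemma integral_div_sub_neg {a : ℂ} (ha : a.im < 0) (u : L2R) :
    ∫ x : ℝ, u x / ((x : ℂ) - a) = -(2 * Real.pi * Complex.I) *
      ∫ ξ in Set.Iio (0 : ℝ), Complex.exp ((2 * Real.pi * Complex.I * a) * ξ) *
        fourierTwo u ξ := by
  have ha' : 0 < (starRingEnd ℂ a).im := by simpa using ha
  rw [← inner_cauchy ha.ne u, ← fourierTwo.inner_map_map, L2.inner_def,
    ← integral_indicator measurableSet_Iio, ← integral_const_mul]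
  refine integral_congr_ae ?_
  filter_upwards [fourierTwo_cauchy_pos ha'] with ξ hξ
  rw [hξ]
  by_cases h : ξ ∈ Set.Iio (0 : ℝ)
  · simp only [Set.indicator_of_mem h, RCLike.inner_apply, map_mul, conj_exp_aux]
    simp only [Complex.conj_ofReal, Complex.conj_I, map_ofNat]
    ring
  · simp [Set.indicator_of_notMem h]

/-- By unitarity, the Cauchy integral in the upper half-plane is a Laplace transform of the Fourier
transform on the positive half-line. -/
lemma integral_div_sub_pos {a : ℂ} (ha : 0 < a.im) (u : L2R) :
    ∫ x : ℝ, u x / ((x : ℂ) - a) = (2 * Real.pi * Complex.I) *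
      ∫ ξ in Set.Ioi (0 : ℝ), Complex.exp ((2 * Real.pi * Complex.I * a) * ξ) *
        fourierTwo u ξ := by
  have ha' : (starRingEnd ℂ a).im < 0 := by simpa using ha
  rw [← inner_cauchy ha.ne' u, ← fourierTwo.inner_map_map, L2.inner_def,
    ← integral_indicator measurableSet_Ioi, ← integral_const_mul]
  refine integral_congr_ae ?_
  filter_upwards [fourierTwo_cauchy_neg ha'] with ξ hξ
  rw [hξ]
  by_cases h : ξ ∈ Set.Ioi (0 : ℝ)
  · simp only [Set.indicator_of_mem h, RCLike.inner_apply, map_mul, map_neg, conj_exp_aux]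
    simp only [Complex.conj_ofReal, Complex.conj_I, map_ofNat]
    ring
  · simp [Set.indicator_of_notMem h]

/-- The values of the Cauchy integral along a line in the lower half-plane determine the Fourier
transform on the negative half-line. -/
lemma fourierTwo_neg_eq_zero_iff (u : L2R) {s : ℝ} (hs : 0 < s) :
    (∀ᵐ ξ, ξ ∈ Set.Iio (0 : ℝ) → fourierTwo u ξ = 0) ↔
      ∀ a : ℂ, a.im = -s → ∫ x : ℝ, u x / ((x : ℂ) - a) = 0 := by
  constructor
  · intro h a ha
    rw [integral_div_sub_neg (by rw [ha]; linarith), mul_eq_zero]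
    right
    refine integral_eq_zero_of_ae ?_
    filter_upwards [ae_restrict_of_ae h, ae_restrict_mem measurableSet_Iio] with ξ h1 h2
    rw [h1 h2, mul_zero, Pi.zero_apply]
  · intro h
    have hb : 0 < ((2 * Real.pi * s : ℝ) : ℂ).re := by
      rw [Complex.ofReal_re]; positivity
    refine ae_eq_zero_of_exp_moments measurableSet_Iio (b := 2 * Real.pi * s) (Lp.memLp _)
      (memLp_exp_Iio hb 2 (Or.inr rfl)) ⟨1, fun ξ hξ => ?_⟩ fun x => ?_
    · rw [norm_exp_mul_real, Real.exp_le_one_iff]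
      exact mul_nonpos_of_nonneg_of_nonpos hb.le (le_of_lt hξ)
    · have h2 := h ((x : ℂ) - s * Complex.I) (by simp)
      rw [integral_div_sub_neg (by simpa using hs), mul_eq_zero] at h2
      have h3 := h2.resolve_left (by simp [Real.pi_ne_zero])
      rw [← h3]
      congr 1; ext ξ
      congr 3
      push_cast
      linear_combination (2 * Real.pi * s : ℂ) * Complex.I_mul_I

lemma fourierTwo_pos_eq_zero_iff (u : L2R) {s : ℝ} (hs : 0 < s) :
    (∀ᵐ ξ, ξ ∈ Set.Ioi (0 : ℝ) → fourierTwo u ξ = 0) ↔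
      ∀ a : ℂ, a.im = s → ∫ x : ℝ, u x / ((x : ℂ) - a) = 0 := by
  constructor
  · intro h a ha
    rw [integral_div_sub_pos (by rw [ha]; linarith), mul_eq_zero]
    right
    refine integral_eq_zero_of_ae ?_
    filter_upwards [ae_restrict_of_ae h, ae_restrict_mem measurableSet_Ioi] with ξ h1 h2
    rw [h1 h2, mul_zero, Pi.zero_apply]
  · intro h
    have hb : ((-(2 * Real.pi * s) : ℝ) : ℂ).re < 0 := by
      rw [Complex.ofReal_re, neg_lt_zero]; positivity
    refine ae_eq_zero_of_exp_moments measurableSet_Ioi (b := -(2 * Real.pi * s)) (Lp.memLp _)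
      (memLp_exp_Ioi hb 2 (Or.inr rfl)) ⟨1, fun ξ hξ => ?_⟩ fun x => ?_
    · rw [norm_exp_mul_real, Real.exp_le_one_iff]
      exact mul_nonpos_of_nonpos_of_nonneg hb.le (le_of_lt hξ)
    · have h2 := h ((x : ℂ) + s * Complex.I) (by simp)
      rw [integral_div_sub_pos (by simpa using hs), mul_eq_zero] at h2
      have h3 := h2.resolve_left (by simp [Real.pi_ne_zero])
      rw [← h3]
      congr 1; ext ξ
      congr 3
      push_cast
      linear_combination (-2 * Real.pi * s : ℂ) * Complex.I_mul_I

/-! ### The Hardy space and its orthogonal complement -/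

lemma fourierL2_coeFn (f : L2R) : (fourierL2 f : ℝ → ℂ) =ᵐ[volume] fun x =>
    ((√(2 * Real.pi)⁻¹ : ℝ) : ℂ) * fourierTwo f ((2 * Real.pi)⁻¹ * x) :=
  dilateAux_coeFn (inv_pos.2 Real.two_pi_pos) (fourierTwo f)

/-- The dilation in `fourierL2` does not affect vanishing on the negative half-line. -/
lemma fourierL2_eq_zero_iff (f : L2R) : (∀ᵐ x, x ∈ Set.Iio (0 : ℝ) → fourierL2 f x = 0) ↔
    ∀ᵐ x, x ∈ Set.Iio (0 : ℝ) → fourierTwo f x = 0 := by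
  have hc := inv_pos.2 Real.two_pi_pos
  have hs : ((√(2 * Real.pi)⁻¹ : ℝ) : ℂ) ≠ 0 := by
    exact_mod_cast (Real.sqrt_pos.2 hc).ne'
  constructor
  · intro h
    filter_upwards [(quasi_dilate Real.two_pi_pos).ae h,
      (quasi_dilate Real.two_pi_pos).ae (fourierL2_coeFn f)] with x h1 h2 hx
    have h3 := h1 (mul_neg_of_pos_of_neg Real.two_pi_pos hx)
    rw [h2, ← mul_assoc, inv_mul_cancel₀ Real.two_pi_pos.ne', one_mul] at h3
    exact (mul_eq_zero.1 h3).resolve_left hs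
  · intro h
    filter_upwards [(quasi_dilate hc).ae h, fourierL2_coeFn f] with x h1 h2 hx
    rw [h2, h1 (mul_neg_of_pos_of_neg hc hx), mul_zero]

lemma mem_hardyPlus_iff_fourier (f : L2R) : f ∈ hardyPlus ↔
    ∀ᵐ x, x ∈ Set.Iio (0 : ℝ) → fourierTwo f x = 0 := by
  rw [← fourierL2_eq_zero_iff]
  constructor
  · rintro ⟨g, rfl⟩
    have : fourierL2 (invFourierPos.toLinearMap g) = extendPos g :=
      fourierL2.apply_symm_apply _
    rw [this]
    filter_upwards [extend_coeFn g] with x hx hx0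
    refine hx.trans (Set.indicator_of_notMem ?_ _)
    simpa using (le_of_lt hx0)
  · intro h
    refine ⟨restrictPos (fourierL2 f), ?_⟩
    change fourierL2.symm (extendPos (restrictPos (fourierL2 f))) = f
    rw [LinearIsometryEquiv.symm_apply_eq]
    refine Lp.ext ?_
    have h1 := (ae_restrict_iff' (measurableSet_Ioi (a := (0 : ℝ)))).1
      (LpToLpRestrictCLM_coeFn ℂ (Set.Ioi 0) (fourierL2 f))
    have h0 : ∀ᵐ x : ℝ, x ≠ 0 := by simp [ae_iff]
    filter_upwards [extend_coeFn (restrictPos (fourierL2 f)), h1, h, h0] with x h2 h3 h4 h5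
    refine h2.trans ?_
    by_cases hx : x ∈ Set.Ioi (0 : ℝ)
    · rw [Set.indicator_of_mem hx]; exact h3 hx
    · rw [Set.indicator_of_notMem hx, h4 (lt_of_le_of_ne (not_lt.1 hx) h5)]

lemma mem_hardyPlus_orthogonal_iff_fourier (f : L2R) : f ∈ hardyPlusᗮ ↔
    ∀ᵐ x, x ∈ Set.Ioi (0 : ℝ) → fourierTwo f x = 0 := by
  have h0 : ∀ᵐ x : ℝ, x ≠ 0 := by simp [ae_iff]
  constructor
  · intro hf
    have hg : MemLp ((Set.Ioi (0 : ℝ)).indicator (fourierTwo f : ℝ → ℂ)) 2 volume :=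
      (Lp.memLp _).indicator measurableSet_Ioi
    have hmem : fourierTwo.symm (hg.toLp _) ∈ hardyPlus := by
      rw [mem_hardyPlus_iff_fourier, LinearIsometryEquiv.apply_symm_apply]
      filter_upwards [hg.coeFn_toLp] with x hx hx0
      rw [hx]
      exact Set.indicator_of_notMem (by simpa using (le_of_lt hx0)) _
    have h1 := hf _ hmem
    rw [← fourierTwo.inner_map_map, LinearIsometryEquiv.apply_symm_apply] at h1
    have h2 : inner ℂ (hg.toLp _) (hg.toLp _) = (0 : ℂ) := by
      rw [← h1, L2.inner_def, L2.inner_def]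
      refine integral_congr_ae ?_
      filter_upwards [hg.coeFn_toLp] with x hx
      rw [hx]
      by_cases hx0 : x ∈ Set.Ioi (0 : ℝ)
      · rw [Set.indicator_of_mem hx0]
      · simp [Set.indicator_of_notMem hx0]
    have h3 := inner_self_eq_zero.1 h2
    have h4 := hg.coeFn_toLp
    rw [h3] at h4
    filter_upwards [h4, Lp.coeFn_zero ℂ 2 (volume : Measure ℝ)] with x h5 h6 hx
    rw [h6, Set.indicator_of_mem hx] at h5
    exact h5.symm
  · intro hf h hh
    rw [mem_hardyPlus_iff_fourier] at hh
    rw [← fourierTwo.inner_map_map, L2.inner_def]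
    refine integral_eq_zero_of_ae ?_
    filter_upwards [hf, hh, h0] with x h1 h2 h3
    rcases lt_or_gt_of_ne h3 with h4 | h4
    · rw [h2 h4]; simp
    · rw [h1 h4]; simp

/-- The (boundary values of) functions of the Hardy space of the upper half-plane: the square
integrable functions whose Cauchy integral vanishes in the lower half-plane. -/
def InHardyPlus (u : ℝ → ℂ) : Prop :=
  MemLp u 2 volume ∧ ∀ a : ℂ, a.im < 0 → ∫ x : ℝ, u x / ((x : ℂ) - a) = 0

/-- The functions of the Hardy space of the lower half-plane. -/
def InHardyMinus (u : ℝ → ℂ) : Prop :=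
  MemLp u 2 volume ∧ ∀ a : ℂ, 0 < a.im → ∫ x : ℝ, u x / ((x : ℂ) - a) = 0

lemma InHardyPlus.congr {u v : ℝ → ℂ} (hu : InHardyPlus u) (h : u =ᵐ[volume] v) :
    InHardyPlus v := by
  refine ⟨hu.1.ae_eq h, fun a ha => ?_⟩
  rw [← hu.2 a ha]
  refine integral_congr_ae ?_
  filter_upwards [h] with x hx
  rw [hx]

lemma InHardyMinus.congr {u v : ℝ → ℂ} (hu : InHardyMinus u) (h : u =ᵐ[volume] v) :
    InHardyMinus v := by
  refine ⟨hu.1.ae_eq h, fun a ha => ?_⟩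
  rw [← hu.2 a ha]
  refine integral_congr_ae ?_
  filter_upwards [h] with x hx
  rw [hx]

/-- The orthogonality relations along a single line suffice. -/
lemma mem_hardyPlus_of_line (f : L2R) {s : ℝ} (hs : 0 < s)
    (h : ∀ a : ℂ, a.im = -s → ∫ x : ℝ, f x / ((x : ℂ) - a) = 0) : f ∈ hardyPlus :=
  (mem_hardyPlus_iff_fourier f).2 ((fourierTwo_neg_eq_zero_iff f hs).2 h)

/-- A Paley-Wiener theorem: the spectral definition of the Hardy space agrees with the one by Cauchy
integrals. -/
lemma mem_hardyPlus_iff (f : L2R) : f ∈ hardyPlus ↔ InHardyPlus f := by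
  refine ⟨fun h => ⟨Lp.memLp f, fun a ha => ?_⟩, fun h => ?_⟩
  · exact (fourierTwo_neg_eq_zero_iff f (neg_pos.2 ha)).1 ((mem_hardyPlus_iff_fourier f).1 h) a
      (by simp)
  · exact mem_hardyPlus_of_line f one_pos fun a ha => h.2 a (by rw [ha]; norm_num)

lemma mem_hardyPlus_orthogonal_iff (f : L2R) : f ∈ hardyPlusᗮ ↔ InHardyMinus f := by
  rw [mem_hardyPlus_orthogonal_iff_fourier]
  refine ⟨fun h => ⟨Lp.memLp f, fun a ha => ?_⟩, fun h => ?_⟩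
  · exact (fourierTwo_pos_eq_zero_iff f ha).1 h a rfl
  · exact (fourierTwo_pos_eq_zero_iff f one_pos).2 fun a ha => h.2 a (by rw [ha]; norm_num)

/-! ### Multiplication by rational functions -/

lemma eval_ofReal_ne_zero {d : ℂ[X]} (hd : ∀ z, d.eval z = 0 → z.im ≠ 0) (x : ℝ) :
    d.eval (x : ℂ) ≠ 0 :=
  fun h => hd _ h (Complex.ofReal_im x)

/-- A class of functions which is stable under linear combinations and under multiplication by
`1 / (x - a)`, for `a` in some set off the real line, is stable under multiplication by `p / d`
if the zeros of `d` lie in this set and `deg p ≤ deg d`. -/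
lemma mul_ratFun_mem {V : (ℝ → ℂ) → Prop} {S : Set ℂ} (hS : ∀ a ∈ S, a.im ≠ 0)
    (hadd : ∀ u v, V u → V v → V (fun x => u x + v x))
    (hsmul : ∀ (c : ℂ) u, V u → V (fun x => c * u x))
    (hdiv : ∀ a ∈ S, ∀ u, V u → V (fun x => u x / ((x : ℂ) - a)))
    {p d : ℂ[X]} (hd0 : d ≠ 0) (hd : ∀ z, d.eval z = 0 → z ∈ S) (hpd : p.natDegree ≤ d.natDegree)
    {u : ℝ → ℂ} (hu : V u) : V (fun x => u x * ratFun p d x) := by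
  induction h : d.natDegree generalizing d p u with
  | zero =>
    rw [h, Nat.le_zero] at hpd
    obtain ⟨c, rfl⟩ := natDegree_eq_zero.1 h
    obtain ⟨b, rfl⟩ := natDegree_eq_zero.1 hpd
    convert hsmul (b / c) u hu using 2 with x
    simp [ratFun, mul_comm]
  | succ n ih =>
    obtain ⟨a, ha⟩ := IsAlgClosed.exists_root d (by
      intro h0; rw [degree_eq_natDegree hd0, h] at h0; norm_cast at h0)
    obtain ⟨d', rfl⟩ := dvd_iff_isRoot.2 ha
    have hd'0 : d' ≠ 0 := right_ne_zero_of_mul hd0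
    have hn : d'.natDegree = n := by
      rw [natDegree_mul (X_sub_C_ne_zero a) hd'0, natDegree_X_sub_C] at h; omega
    have haS : a ∈ S := hd a ha
    have hd' : ∀ z, d'.eval z = 0 → z ∈ S := fun z hz => hd z (by simp [hz])
    have hp := modByMonic_add_div p (q := X - C a)
    rw [modByMonic_X_sub_C_eq_C_eval] at hp
    have hp' : (p /ₘ (X - C a)).natDegree ≤ d'.natDegree := by
      rw [natDegree_divByMonic _ (monic_X_sub_C a), natDegree_X_sub_C]; omega
    have h1 := ih hd'0 hd' hp' hu hn
    have h2 := ih hd'0 hd' (p := C (p.eval a)) (by simp) (hdiv a haS u hu) hn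
    convert hadd _ _ h1 h2 using 2 with x
    have hxa := ofReal_sub_ne_zero (hS a haS) x
    have hx := eval_ofReal_ne_zero (fun z hz => hS z (hd' z hz)) x
    have hpx := congrArg (eval (x : ℂ)) hp
    simp only [eval_add, eval_mul, eval_sub, eval_X, eval_C] at hpx
    simp only [ratFun, eval_mul, eval_sub, eval_X, eval_C]
    rw [← hpx]
    field_simp
    ring

lemma memLp_div_sub {a : ℂ} (ha : a.im ≠ 0) {u : ℝ → ℂ} (hu : MemLp u 2 volume) :
    MemLp (fun x => u x / ((x : ℂ) - a)) 2 volume := by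
  have hc : Continuous fun x : ℝ => ((x : ℂ) - a)⁻¹ :=
    Continuous.inv₀ (by fun_prop) (ofReal_sub_ne_zero ha)
  refine hu.of_le_mul (c := |a.im|⁻¹) ?_ (ae_of_all _ fun x => ?_)
  · simp only [div_eq_mul_inv]
    exact hu.1.mul hc.aestronglyMeasurable
  · rw [norm_div, div_eq_inv_mul]
    gcongr
    have := Complex.abs_im_le_norm ((x : ℂ) - a)
    simpa using this

lemma integrable_div_sub {a : ℂ} (ha : a.im ≠ 0) {u : ℝ → ℂ} (hu : MemLp u 2 volume) :
    Integrable (fun x => u x / ((x : ℂ) - a)) := by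
  refine (hu.integrable_mul (memLp_cauchy ha)).congr (ae_of_all _ fun x => ?_)
  simp [div_eq_mul_inv]

lemma memLp_mul_ratFun {p d : ℂ[X]} (hd0 : d ≠ 0) (hd : ∀ z, d.eval z = 0 → z.im ≠ 0)
    (hpd : p.natDegree ≤ d.natDegree) {u : ℝ → ℂ} (hu : MemLp u 2 volume) :
    MemLp (fun x => u x * ratFun p d x) 2 volume :=
  mul_ratFun_mem (V := fun u => MemLp u 2 volume) (S := {z | z.im ≠ 0}) (fun _ h => h)
    (fun _ _ h1 h2 => h1.add h2) (fun c _ h => h.const_mul c) (fun _ ha _ h => memLp_div_sub ha h)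
    hd0 hd hpd hu

lemma bounded_ratFun {p d : ℂ[X]} (hd0 : d ≠ 0) (hd : ∀ z, d.eval z = 0 → z.im ≠ 0)
    (hpd : p.natDegree ≤ d.natDegree) : ∃ K : ℝ, ∀ x, ‖ratFun p d x‖ ≤ K := by
  have := mul_ratFun_mem (V := fun u => ∃ K : ℝ, ∀ x, ‖u x‖ ≤ K) (S := {z | z.im ≠ 0})
    (fun _ h => h)
    (fun u v ⟨K, h1⟩ ⟨K', h2⟩ => ⟨K + K', fun x => (norm_add_le _ _).trans
      (add_le_add (h1 x) (h2 x))⟩)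
    (fun c u ⟨K, h⟩ => ⟨‖c‖ * K, fun x => by rw [norm_mul]; gcongr; exact h x⟩)
    (fun a ha u ⟨K, h⟩ => ⟨K / |a.im|, fun x => by
      have h2 := Complex.abs_im_le_norm ((x : ℂ) - a)
      simp only [Complex.sub_im, Complex.ofReal_im, zero_sub, abs_neg] at h2
      have h3 : 0 < |a.im| := abs_pos.2 ha
      rw [norm_div]
      exact div_le_div₀ ((norm_nonneg _).trans (h x)) (h x) h3 h2⟩)
    hd0 hd hpd (u := fun _ => 1) ⟨1, fun x => by simp⟩
  simpa using this

/-! ### Conjugation -/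

lemma conjPoly_eval (P : ℂ[X]) (z : ℂ) :
    (conjPoly P).eval z = starRingEnd ℂ (P.eval (starRingEnd ℂ z)) := by
  have h := hom_eval₂ P (RingHom.id ℂ) (starRingEnd ℂ) (starRingEnd ℂ z)
  rw [RingHom.comp_id, Complex.conj_conj, eval₂_id] at h
  rw [conjPoly, eval_map, h]

lemma conjPoly_eval_ofReal (P : ℂ[X]) (x : ℝ) :
    (conjPoly P).eval (x : ℂ) = starRingEnd ℂ (P.eval (x : ℂ)) := by
  rw [conjPoly_eval, Complex.conj_ofReal]

lemma conjPoly_ne_zero {P : ℂ[X]} (hP : P ≠ 0) : conjPoly P ≠ 0 :=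
  (Polynomial.map_ne_zero_iff (starRingEnd ℂ).injective).2 hP

lemma natDegree_conjPoly (P : ℂ[X]) : (conjPoly P).natDegree = P.natDegree :=
  natDegree_map_eq_of_injective (starRingEnd ℂ).injective P

lemma memLp_conj {u : ℝ → ℂ} (hu : MemLp u 2 volume) :
    MemLp (fun x => starRingEnd ℂ (u x)) 2 volume :=
  hu.of_le (Complex.continuous_conj.comp_aestronglyMeasurable hu.1)
    (ae_of_all _ fun _ => (RCLike.norm_conj _).le)

lemma integral_conj_div_sub (u : ℝ → ℂ) (a : ℂ) :
    ∫ x : ℝ, starRingEnd ℂ (u x) / ((x : ℂ) - a)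
      = starRingEnd ℂ (∫ x : ℝ, u x / ((x : ℂ) - starRingEnd ℂ a)) := by
  rw [← integral_conj]
  congr 1; ext x
  simp

lemma InHardyPlus.conj {u : ℝ → ℂ} (hu : InHardyPlus u) :
    InHardyMinus (fun x => starRingEnd ℂ (u x)) :=
  ⟨memLp_conj hu.1, fun a ha => by
    rw [integral_conj_div_sub, hu.2 _ (by simpa using ha), map_zero]⟩

lemma InHardyMinus.conj {u : ℝ → ℂ} (hu : InHardyMinus u) :
    InHardyPlus (fun x => starRingEnd ℂ (u x)) :=
  ⟨memLp_conj hu.1, fun a ha => by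
    rw [integral_conj_div_sub, hu.2 _ (by simpa using ha), map_zero]⟩

lemma inHardyMinus_iff_conj {u : ℝ → ℂ} :
    InHardyMinus u ↔ InHardyPlus (fun x => starRingEnd ℂ (u x)) :=
  ⟨fun h => h.conj, fun h => by simpa using h.conj⟩

/-! ### Stability properties of the Hardy spaces -/

lemma InHardyPlus.add {u v : ℝ → ℂ} (hu : InHardyPlus u) (hv : InHardyPlus v) :
    InHardyPlus (fun x => u x + v x) :=
  ⟨hu.1.add hv.1, fun a ha => by
    simp_rw [add_div]
    rw [integral_add (integrable_div_sub ha.ne hu.1) (integrable_div_sub ha.ne hv.1), hu.2 a ha,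
      hv.2 a ha, add_zero]⟩

lemma InHardyPlus.const_mul {u : ℝ → ℂ} (c : ℂ) (hu : InHardyPlus u) :
    InHardyPlus (fun x => c * u x) :=
  ⟨hu.1.const_mul c, fun a ha => by
    simp_rw [mul_div_assoc]
    rw [integral_const_mul, hu.2 a ha, mul_zero]⟩

lemma InHardyPlus.sub {u v : ℝ → ℂ} (hu : InHardyPlus u) (hv : InHardyPlus v) :
    InHardyPlus (fun x => u x - v x) := by
  simpa [sub_eq_add_neg] using hu.add (hv.const_mul (-1))

lemma InHardyMinus.add {u v : ℝ → ℂ} (hu : InHardyMinus u) (hv : InHardyMinus v) :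
    InHardyMinus (fun x => u x + v x) := by
  rw [inHardyMinus_iff_conj] at *
  simpa using hu.add hv

lemma InHardyMinus.const_mul {u : ℝ → ℂ} (c : ℂ) (hu : InHardyMinus u) :
    InHardyMinus (fun x => c * u x) := by
  rw [inHardyMinus_iff_conj] at *
  simpa using hu.const_mul (starRingEnd ℂ c)

lemma InHardyMinus.sub {u v : ℝ → ℂ} (hu : InHardyMinus u) (hv : InHardyMinus v) :
    InHardyMinus (fun x => u x - v x) := by
  simpa [sub_eq_add_neg] using hu.add (hv.const_mul (-1))

lemma inHardyPlus_toLp {u : ℝ → ℂ} (hu : MemLp u 2 volume) :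
    hu.toLp u ∈ hardyPlus ↔ InHardyPlus u := by
  rw [mem_hardyPlus_iff]
  exact ⟨fun h => h.congr hu.coeFn_toLp, fun h => h.congr hu.coeFn_toLp.symm⟩

lemma inHardyMinus_toLp {u : ℝ → ℂ} (hu : MemLp u 2 volume) :
    hu.toLp u ∈ hardyPlusᗮ ↔ InHardyMinus u := by
  rw [mem_hardyPlus_orthogonal_iff]
  exact ⟨fun h => h.congr hu.coeFn_toLp, fun h => h.congr hu.coeFn_toLp.symm⟩

lemma inHardyPlus_of_line {u : ℝ → ℂ} (hu : MemLp u 2 volume) {s : ℝ} (hs : 0 < s)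
    (h : ∀ a : ℂ, a.im = -s → ∫ x : ℝ, u x / ((x : ℂ) - a) = 0) : InHardyPlus u := by
  rw [← inHardyPlus_toLp hu]
  refine mem_hardyPlus_of_line _ hs fun a ha => ?_
  rw [← h a ha]
  refine integral_congr_ae ?_
  filter_upwards [hu.coeFn_toLp] with x hx
  rw [hx]

/-- The resolvent identity for Cauchy integrals. -/
lemma integral_div_sub_div_sub {a b : ℂ} (ha : a.im ≠ 0) (hb : b.im ≠ 0) (hab : a ≠ b)
    {u : ℝ → ℂ} (hu : MemLp u 2 volume) :
    ∫ x : ℝ, u x / ((x : ℂ) - b) / ((x : ℂ) - a) = (b - a)⁻¹ *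
      ((∫ x : ℝ, u x / ((x : ℂ) - b)) - ∫ x : ℝ, u x / ((x : ℂ) - a)) := by
  rw [← integral_sub (integrable_div_sub hb hu) (integrable_div_sub ha hu), ← integral_const_mul]
  congr 1; ext x
  have h1 := ofReal_sub_ne_zero ha x
  have h2 := ofReal_sub_ne_zero hb x
  have h3 : b - a ≠ 0 := sub_ne_zero.2 hab.symm
  field_simp
  ring

lemma InHardyPlus.div_sub {b : ℂ} (hb : b.im < 0) {u : ℝ → ℂ} (hu : InHardyPlus u) :
    InHardyPlus (fun x => u x / ((x : ℂ) - b)) := by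
  refine inHardyPlus_of_line (memLp_div_sub hb.ne hu.1) (s := 1 - b.im) (by linarith)
    fun a ha => ?_
  have ha' : a.im < 0 := by linarith
  rw [integral_div_sub_div_sub ha'.ne hb.ne (by rintro rfl; linarith) hu.1, hu.2 a ha', hu.2 b hb]
  simp

/-- Division by `x - i` is possible within the Hardy space of the upper half-plane if the Cauchy
integral, that is, the function itself, vanishes at `i`. -/
lemma InHardyPlus.div_sub_I {u : ℝ → ℂ} (hu : InHardyPlus u)
    (h : ∫ x : ℝ, u x / ((x : ℂ) - Complex.I) = 0) :
    InHardyPlus (fun x => u x / ((x : ℂ) - Complex.I)) := by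
  refine ⟨memLp_div_sub (by simp) hu.1, fun a ha => ?_⟩
  rw [integral_div_sub_div_sub ha.ne (by simp) (by rintro rfl; simp at ha; linarith) hu.1, h,
    hu.2 a ha]
  simp

lemma inHardyPlus_cauchy {b : ℂ} (hb : b.im < 0) : InHardyPlus (fun x => 1 / ((x : ℂ) - b)) := by
  rw [← inHardyPlus_toLp (memLp_cauchy hb.ne), mem_hardyPlus_iff_fourier]
  filter_upwards [fourierTwo_cauchy_neg hb] with ξ hξ h
  rw [show (memLp_cauchy hb.ne).toLp _ = cauchy hb.ne from rfl, hξ, Set.indicator_of_notMem,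
    mul_zero]
  simpa using (le_of_lt h)

lemma InHardyPlus.mul_ratFun {p d : ℂ[X]} (hd0 : d ≠ 0) (hd : ∀ z, d.eval z = 0 → z.im < 0)
    (hpd : p.natDegree ≤ d.natDegree) {u : ℝ → ℂ} (hu : InHardyPlus u) :
    InHardyPlus (fun x => u x * ratFun p d x) :=
  mul_ratFun_mem (V := InHardyPlus) (S := {z | z.im < 0}) (fun _ h => ne_of_lt h)
    (fun _ _ h1 h2 => h1.add h2) (fun c _ h => h.const_mul c) (fun _ ha _ h => h.div_sub ha)
    hd0 hd hpd hu

lemma conj_ratFun (p d : ℂ[X]) (x : ℝ) :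
    starRingEnd ℂ (ratFun p d x) = ratFun (conjPoly p) (conjPoly d) x := by
  simp [ratFun, conjPoly_eval_ofReal]

lemma conjPoly_im_neg {d : ℂ[X]} (hd : ∀ z, d.eval z = 0 → 0 < z.im) (z : ℂ)
    (hz : (conjPoly d).eval z = 0) : z.im < 0 := by
  rw [conjPoly_eval, map_eq_zero] at hz
  simpa using hd _ hz

lemma conjPoly_im_nonpos {d : ℂ[X]} (hd : ∀ z, d.eval z = 0 → 0 ≤ z.im) (z : ℂ)
    (hz : (conjPoly d).eval z = 0) : z.im ≤ 0 := by
  rw [conjPoly_eval, map_eq_zero] at hz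
  simpa using hd _ hz

lemma inHardyPlus_ratFun {p d : ℂ[X]} (hd0 : d ≠ 0) (hd : ∀ z, d.eval z = 0 → z.im < 0)
    (hpd : p.natDegree < d.natDegree) : InHardyPlus (ratFun p d) := by
  obtain ⟨a, ha⟩ := IsAlgClosed.exists_root d (by
    intro h0; rw [degree_eq_natDegree hd0] at h0; norm_cast at h0; omega)
  obtain ⟨d', rfl⟩ := dvd_iff_isRoot.2 ha
  have hd'0 : d' ≠ 0 := right_ne_zero_of_mul hd0
  rw [natDegree_mul (X_sub_C_ne_zero a) hd'0, natDegree_X_sub_C] at hpd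
  refine ((inHardyPlus_cauchy (hd a ha)).mul_ratFun (p := p) hd'0
    (fun z hz => hd z (by simp [hz])) (by omega)).congr (ae_of_all _ fun x => ?_)
  simp only [ratFun, eval_mul, eval_sub, eval_X, eval_C]
  rw [div_mul_div_comm, one_mul]

lemma inHardyMinus_ratFun {p d : ℂ[X]} (hd0 : d ≠ 0) (hd : ∀ z, d.eval z = 0 → 0 < z.im)
    (hpd : p.natDegree < d.natDegree) : InHardyMinus (ratFun p d) := by
  rw [inHardyMinus_iff_conj]
  simp_rw [conj_ratFun]
  exact inHardyPlus_ratFun (conjPoly_ne_zero hd0) (conjPoly_im_neg hd)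
    (by simpa only [natDegree_conjPoly] using hpd)

/-- A dominated limit of functions of the Hardy space belongs to the Hardy space. -/
lemma inHardyPlus_of_tendsto {u : ℕ → ℝ → ℂ} {f : ℝ → ℂ} (hu : ∀ n, InHardyPlus (u n))
    (hf : MemLp f 2 volume) (hle : ∀ n, ∀ᵐ x, ‖u n x‖ ≤ ‖f x‖)
    (hlim : ∀ᵐ x, Filter.Tendsto (fun n => u n x) Filter.atTop (nhds (f x))) : InHardyPlus f := by
  refine ⟨hf, fun a ha => ?_⟩
  have h := tendsto_integral_of_dominated_convergence (μ := volume)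
    (F := fun n x => u n x / ((x : ℂ) - a)) (f := fun x => f x / ((x : ℂ) - a))
    (fun x => ‖f x / ((x : ℂ) - a)‖) (fun n => (integrable_div_sub ha.ne (hu n).1).1)
    (integrable_div_sub ha.ne hf).norm
    (fun n => by
      filter_upwards [hle n] with x hx
      rw [norm_div, norm_div]; gcongr)
    (by filter_upwards [hlim] with x hx using hx.div_const _)
  simp_rw [fun n => (hu n).2 a ha] at h
  exact (tendsto_nhds_unique h tendsto_const_nhds)

/-! ### Division by polynomials with zeros in a closed half-plane -/

lemma ae_eval_ne_zero {A : ℂ[X]} (hA : A ≠ 0) : ∀ᵐ x : ℝ, A.eval (x : ℂ) ≠ 0 := by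
  have hfin : {x : ℝ | A.eval (x : ℂ) = 0}.Finite :=
    ((A.roots.toFinset.finite_toSet).preimage Complex.ofReal_injective.injOn).subset
      fun x hx => by simpa [hA] using hx
  rw [ae_iff]
  simpa using hfin.measure_zero volume

/-- Moving up from the real line increases the distance to every zero in the closed lower
half-plane. -/
lemma norm_eval_le_norm_eval_add {A : ℂ[X]} (hA : ∀ z, A.eval z = 0 → z.im ≤ 0) (x : ℝ) {ε : ℝ}
    (hε : 0 ≤ ε) : ‖A.eval (x : ℂ)‖ ≤ ‖A.eval ((x : ℂ) + ε * Complex.I)‖ := by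
  induction h : A.natDegree generalizing A with
  | zero => obtain ⟨c, rfl⟩ := natDegree_eq_zero.1 h; simp
  | succ n ih =>
    have hA0 : A ≠ 0 := by rintro rfl; simp at h
    obtain ⟨a, ha⟩ := IsAlgClosed.exists_root A (by
      intro h0; rw [degree_eq_natDegree hA0, h] at h0; norm_cast at h0)
    obtain ⟨A', rfl⟩ := dvd_iff_isRoot.2 ha
    have hn : A'.natDegree = n := by
      rw [natDegree_mul (X_sub_C_ne_zero a) (right_ne_zero_of_mul hA0), natDegree_X_sub_C] at h
      omega
    have h1 := ih (A := A') (fun z hz => hA z (by simp [hz])) hn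
    have h2 := hA a ha
    simp only [eval_mul, eval_sub, eval_X, eval_C, norm_mul]
    refine mul_le_mul ?_ h1 (norm_nonneg _) (norm_nonneg _)
    rw [← sq_le_sq₀ (norm_nonneg _) (norm_nonneg _), Complex.sq_norm, Complex.sq_norm,
      Complex.normSq_apply, Complex.normSq_apply]
    simp
    nlinarith

/-- A polynomial all of whose zeros lie in the closed lower half-plane is a limit of polynomials
with zeros in the open lower half-plane, which dominate it on the real line and whose degree
exceeds its degree by `N`. -/
lemma exists_approx {A : ℂ[X]} (hA0 : A ≠ 0) (hA : ∀ z, A.eval z = 0 → z.im ≤ 0) (N : ℕ) :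
    ∃ D : ℕ → ℂ[X], (∀ n, D n ≠ 0) ∧ (∀ n z, (D n).eval z = 0 → z.im < 0) ∧
      (∀ n, (D n).natDegree = A.natDegree + N) ∧
      (∀ n (x : ℝ), ‖A.eval (x : ℂ)‖ ≤ ‖(D n).eval (x : ℂ)‖) ∧
      ∀ x : ℝ, Filter.Tendsto (fun n => (D n).eval (x : ℂ)) Filter.atTop
        (nhds (A.eval (x : ℂ))) := by
  have hε : ∀ n : ℕ, (0 : ℝ) < 1 / ((n : ℝ) + 1) := fun n => by positivity
  set ε : ℕ → ℝ := fun n => 1 / ((n : ℝ) + 1) with hεd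
  have hI : ∀ n, -((ε n : ℂ) * Complex.I) ≠ 0 := fun n => by
    simpa only [ne_eq, neg_eq_zero, mul_eq_zero, Complex.I_ne_zero, or_false,
      Complex.ofReal_eq_zero] using (hε n).ne'
  -- the shift moves the zeros into the open half-plane, the factor `(1 - i ε x) ^ N` raises the
  -- degree; it has its zero at `-i / ε`
  set D : ℕ → ℂ[X] := fun n => A.comp (X + C ((ε n : ℂ) * Complex.I)) *
    (C (-((ε n : ℂ) * Complex.I)) * X + C 1) ^ N with hD
  have hDe : ∀ n z, (D n).eval z =
      A.eval (z + (ε n : ℂ) * Complex.I) * (-((ε n : ℂ) * Complex.I) * z + 1) ^ N := fun n z => by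
    simp [hD]
  have h1 : ∀ n, A.comp (X + C ((ε n : ℂ) * Complex.I)) ≠ 0 := fun n =>
    fun h => hA0 ((comp_X_add_C_eq_zero_iff).1 h)
  have h2 : ∀ n, (C (-((ε n : ℂ) * Complex.I)) * X + C 1 : ℂ[X]) ≠ 0 := fun n h => by
    have := natDegree_linear (b := (1 : ℂ)) (hI n)
    rw [h] at this; simp at this
  refine ⟨D, fun n => mul_ne_zero (h1 n) (pow_ne_zero _ (h2 n)), fun n z hz => ?_, fun n => ?_,
    fun n x => ?_, fun x => ?_⟩
  · rw [hDe, mul_eq_zero] at hz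
    rcases hz with hz | hz
    · have := hA _ hz
      simp at this
      linarith [hε n]
    · have h3 := eq_zero_of_pow_eq_zero hz
      have h4 := congrArg Complex.re h3
      simp at h4
      by_contra h5
      have := mul_nonneg (hε n).le (not_lt.1 h5)
      linarith
  · rw [hD]
    simp only
    rw [natDegree_mul (h1 n) (pow_ne_zero _ (h2 n)), natDegree_comp, natDegree_X_add_C,
      natDegree_pow, natDegree_linear (hI n)]
    simp
  · rw [hDe, norm_mul, norm_pow]
    refine (norm_eval_le_norm_eval_add hA x (hε n).le).trans
      (le_mul_of_one_le_right (norm_nonneg _) (one_le_pow₀ ?_))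
    have := Complex.abs_re_le_norm (-((ε n : ℂ) * Complex.I) * x + 1)
    simpa using this
  · have h3 : Filter.Tendsto (fun n => (ε n : ℂ)) Filter.atTop (nhds ((0 : ℝ) : ℂ)) :=
      (Complex.continuous_ofReal.tendsto 0).comp tendsto_one_div_add_atTop_nhds_zero_nat
    have h4 : Continuous fun e : ℂ =>
        A.eval ((x : ℂ) + e * Complex.I) * (-(e * Complex.I) * x + 1) ^ N := by
      fun_prop
    have h5 := (h4.tendsto ((0 : ℝ) : ℂ)).comp h3
    simp only [Function.comp_def, Complex.ofReal_zero, zero_mul, neg_zero, add_zero, zero_add,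
      one_pow, mul_one] at h5
    simpa only [hDe] using h5

/-- A Smirnov type theorem: a square integrable quotient `B h / A`, with `h` in the Hardy space of
the upper half-plane and `A` without zeros in the open upper half-plane, belongs to this Hardy
space. -/
lemma InHardyPlus.of_mul_eq {h f : ℝ → ℂ} (hh : InHardyPlus h) (hf : MemLp f 2 volume)
    {A B : ℂ[X]} (hA0 : A ≠ 0) (hA : ∀ z, A.eval z = 0 → z.im ≤ 0)
    (hAB : ∀ᵐ x : ℝ, A.eval (x : ℂ) * f x = B.eval (x : ℂ) * h x) : InHardyPlus f := by
  obtain ⟨D, hD0, hD, hDd, hDle, hDlim⟩ := exists_approx hA0 hA B.natDegree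
  refine inHardyPlus_of_tendsto (u := fun n x => h x * ratFun B (D n) x)
    (fun n => hh.mul_ratFun (hD0 n) (hD n) (by rw [hDd]; omega)) hf (fun n => ?_) ?_
  · filter_upwards [hAB] with x hx
    have hx0 := eval_ofReal_ne_zero (fun z hz => (hD n z hz).ne) x
    rw [ratFun, mul_div_assoc', mul_comm, ← hx, norm_div, norm_mul]
    rw [div_le_iff₀ (norm_pos_iff.2 hx0), mul_comm]
    exact mul_le_mul_of_nonneg_left (hDle n x) (norm_nonneg _)
  · filter_upwards [hAB, ae_eval_ne_zero hA0] with x hx hx0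
    have h1 : f x = h x * (B.eval (x : ℂ) / A.eval (x : ℂ)) := by
      field_simp; linear_combination hx
    rw [h1]
    exact tendsto_const_nhds.mul (tendsto_const_nhds.div (hDlim x) hx0)

lemma InHardyMinus.of_mul_eq {h f : ℝ → ℂ} (hh : InHardyMinus h) (hf : MemLp f 2 volume)
    {A B : ℂ[X]} (hA0 : A ≠ 0) (hA : ∀ z, A.eval z = 0 → 0 ≤ z.im)
    (hAB : ∀ᵐ x : ℝ, A.eval (x : ℂ) * f x = B.eval (x : ℂ) * h x) : InHardyMinus f := by
  rw [inHardyMinus_iff_conj] at *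
  refine hh.of_mul_eq (memLp_conj hf) (A := conjPoly A) (B := conjPoly B) (conjPoly_ne_zero hA0)
    (conjPoly_im_nonpos hA) ?_
  filter_upwards [hAB] with x hx
  rw [conjPoly_eval_ofReal, conjPoly_eval_ofReal, ← map_mul, hx, map_mul]

/-! ### Liouville type theorems -/

lemma X_add_C_I_pow_im_neg (N : ℕ) (z : ℂ)
    (hz : (((X + C Complex.I) ^ N : ℂ[X])).eval z = 0) : z.im < 0 := by
  have h : z + Complex.I = 0 := by
    have h := hz
    rw [eval_pow] at h
    simpa using eq_zero_of_pow_eq_zero h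
  rw [eq_neg_of_add_eq_zero_left h]
  simp

lemma X_sub_C_I_pow_im_pos (N : ℕ) (z : ℂ)
    (hz : (((X - C Complex.I) ^ N : ℂ[X])).eval z = 0) : 0 < z.im := by
  have h : z - Complex.I = 0 := by
    have h := hz
    rw [eval_pow] at h
    simpa using eq_zero_of_pow_eq_zero h
  rw [sub_eq_zero.1 h]
  simp

lemma X_add_C_pow_ne_zero (a : ℂ) (N : ℕ) : ((X + C a) ^ N : ℂ[X]) ≠ 0 :=
  pow_ne_zero _ (X_add_C_ne_zero a)

lemma natDegree_X_add_C_pow (a : ℂ) (N : ℕ) : ((X + C a) ^ N : ℂ[X]).natDegree = N := by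
  rw [natDegree_pow, natDegree_X_add_C, mul_one]

lemma X_sub_C_pow_ne_zero (a : ℂ) (N : ℕ) : ((X - C a) ^ N : ℂ[X]) ≠ 0 :=
  pow_ne_zero _ (X_sub_C_ne_zero a)

lemma natDegree_X_sub_C_pow (a : ℂ) (N : ℕ) : ((X - C a) ^ N : ℂ[X]).natDegree = N := by
  rw [natDegree_pow, natDegree_X_sub_C, mul_one]

lemma ofReal_add_I_ne_zero (x : ℝ) : (x : ℂ) + Complex.I ≠ 0 := by
  have := ofReal_sub_ne_zero (a := -Complex.I) (by simp) x
  simpa using this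

lemma ofReal_sub_I_ne_zero (x : ℝ) : (x : ℂ) - Complex.I ≠ 0 :=
  ofReal_sub_ne_zero (by simp) x

lemma integral_inv_add_I_mul_sub_I :
    ∫ x : ℝ, 1 / ((x : ℂ) + Complex.I) / ((x : ℂ) - Complex.I) = Real.pi := by
  rw [← integral_univ_inv_one_add_sq, ← integral_complex_ofReal]
  congr 1; ext x
  rw [div_div, one_div]
  push_cast
  congr 1
  linear_combination (-1 : ℂ) * Complex.I_mul_I

/-- The Hardy spaces of the two half-planes intersect trivially. -/
lemma ae_eq_zero_of_inHardyPlus_of_inHardyMinus {u : ℝ → ℂ} (h1 : InHardyPlus u)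
    (h2 : InHardyMinus u) : u =ᵐ[volume] 0 := by
  have h : h1.1.toLp u ∈ hardyPlus ⊓ hardyPlusᗮ :=
    ⟨(inHardyPlus_toLp h1.1).2 h1, (inHardyMinus_toLp h1.1).2 h2⟩
  rw [Submodule.inf_orthogonal_eq_bot, Submodule.mem_bot] at h
  have h3 := h1.1.coeFn_toLp
  rw [h] at h3
  exact h3.symm.trans (Lp.coeFn_zero ℂ 2 volume)

/-- Liouville's theorem: a function which, up to polynomial growth, belongs to the Hardy spaces of
both half-planes is a polynomial. In the induction step the value at `i` is removed, after which
a factor `x - i` can be split off. -/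
lemma exists_polynomial_of_growth (N : ℕ) {u : ℝ → ℂ}
    (hp : InHardyPlus (fun x => u x / ((x : ℂ) + Complex.I) ^ N))
    (hm : InHardyMinus (fun x => u x / ((x : ℂ) - Complex.I) ^ N)) :
    ∃ r : ℂ[X], r.degree < N ∧ u =ᵐ[volume] fun x => r.eval (x : ℂ) := by
  induction N generalizing u with
  | zero =>
    refine ⟨0, by simp, ?_⟩
    simp only [pow_zero, div_one] at hp hm
    refine (ae_eq_zero_of_inHardyPlus_of_inHardyMinus hp hm).trans (ae_of_all _ fun x => ?_)
    simp
  | succ N ih =>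
    -- up to a factor, the Cauchy integral at `i` is the value there, and `1 / (x + i)` has Cauchy
    -- integral `π`
    set c : ℂ := (∫ x : ℝ, u x / ((x : ℂ) + Complex.I) ^ (N + 1) / ((x : ℂ) - Complex.I)) /
      Real.pi with hc
    have hk : InHardyPlus (fun x => 1 / ((x : ℂ) + Complex.I)) := by
      simpa using inHardyPlus_cauchy (b := -Complex.I) (by simp)
    have h1 : InHardyPlus (fun x => u x / ((x : ℂ) + Complex.I) ^ (N + 1)
        - c * (1 / ((x : ℂ) + Complex.I))) := hp.sub (hk.const_mul c)
    have h2 := h1.div_sub_I (by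
      simp_rw [sub_div]
      rw [integral_sub (integrable_div_sub (by simp) hp.1)
        (integrable_div_sub (by simp) (hk.const_mul c).1)]
      simp_rw [mul_div_assoc c]
      rw [integral_const_mul, integral_inv_add_I_mul_sub_I, hc, div_mul_cancel₀, sub_self]
      exact_mod_cast Real.pi_ne_zero)
    obtain ⟨r, hr, hur⟩ := ih
      (u := fun x => (u x - c * ((x : ℂ) + Complex.I) ^ N) / ((x : ℂ) - Complex.I))
      ((h1.add (h2.const_mul (2 * Complex.I))).congr (ae_of_all _ fun x => by
        have := ofReal_add_I_ne_zero x
        have := ofReal_sub_I_ne_zero x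
        simp only
        field_simp
        ring))
      ((hm.sub ((inHardyMinus_ratFun (p := (X + C Complex.I) ^ N)
        (X_sub_C_pow_ne_zero Complex.I (N + 1)) (X_sub_C_I_pow_im_pos _)
        (by rw [natDegree_X_add_C_pow, natDegree_X_sub_C_pow]; omega)).const_mul c)).congr
        (ae_of_all _ fun x => by
          have := ofReal_sub_I_ne_zero x
          simp only [ratFun, eval_pow, eval_add, eval_sub, eval_X, eval_C]
          field_simp
          ring))
    refine ⟨(X - C Complex.I) * r + C c * (X + C Complex.I) ^ N, ?_, ?_⟩
    · refine (degree_add_le _ _).trans_lt (max_lt ?_ ?_)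
      · rw [degree_mul, degree_X_sub_C, add_comm]
        rcases eq_or_ne r 0 with rfl | hr0
        · simp
        · rw [degree_eq_natDegree hr0] at hr ⊢
          exact_mod_cast Nat.succ_lt_succ (by exact_mod_cast hr)
      · refine (degree_mul_le _ _).trans_lt ?_
        rw [degree_pow, degree_X_add_C, nsmul_one]
        refine (add_le_add_left degree_C_le _).trans_lt ?_
        rw [zero_add]
        exact_mod_cast Nat.lt_succ_self N
    · filter_upwards [hur] with x hx
      have := ofReal_sub_I_ne_zero x
      rw [div_eq_iff this] at hx
      simp only [eval_add, eval_mul, eval_sub, eval_X, eval_C, eval_pow]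
      linear_combination hx

/-- If `A₁ u = B₁ h` and `A₂ u = B₂ f` with `h` and `f` in the Hardy spaces of the upper and of the
lower half-plane and polynomials `A₁`, `A₂` without zeros in the respective half-plane, then `u` is
a polynomial as soon as its growth is polynomial in the `L²` sense. -/
lemma exists_polynomial_of_mul_eq {u h f : ℝ → ℂ} {A₁ B₁ A₂ B₂ : ℂ[X]} (N : ℕ)
    (hu : MemLp (fun x => u x / ((x : ℂ) + Complex.I) ^ N) 2 volume)
    (hh : InHardyPlus h) (hf : InHardyMinus f)
    (hA₁0 : A₁ ≠ 0) (hA₁ : ∀ z, A₁.eval z = 0 → z.im ≤ 0)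
    (hA₂0 : A₂ ≠ 0) (hA₂ : ∀ z, A₂.eval z = 0 → 0 ≤ z.im)
    (h1 : ∀ᵐ x : ℝ, A₁.eval (x : ℂ) * u x = B₁.eval (x : ℂ) * h x)
    (h2 : ∀ᵐ x : ℝ, A₂.eval (x : ℂ) * u x = B₂.eval (x : ℂ) * f x) :
    ∃ r : ℂ[X], r.degree < N ∧ u =ᵐ[volume] fun x => r.eval (x : ℂ) := by
  refine exists_polynomial_of_growth N (hh.of_mul_eq hu (A := A₁ * (X + C Complex.I) ^ N) (B := B₁)
    (mul_ne_zero hA₁0 (X_add_C_pow_ne_zero _ _)) (fun z hz => ?_) ?_)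
    (hf.of_mul_eq ?_ (A := A₂ * (X - C Complex.I) ^ N) (B := B₂)
    (mul_ne_zero hA₂0 (X_sub_C_pow_ne_zero _ _)) (fun z hz => ?_) ?_)
  · rw [eval_mul, mul_eq_zero] at hz
    exact hz.elim (hA₁ z) fun h => (X_add_C_I_pow_im_neg N z h).le
  · filter_upwards [h1] with x hx
    rw [← hx]
    have := ofReal_add_I_ne_zero x
    simp only [eval_mul, eval_pow, eval_add, eval_X, eval_C]
    field_simp
  · refine (memLp_mul_ratFun (p := (X + C Complex.I) ^ N) (X_sub_C_pow_ne_zero Complex.I N)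
      (fun z hz => (X_sub_C_I_pow_im_pos N z hz).ne')
      (by rw [natDegree_X_add_C_pow, natDegree_X_sub_C_pow]) hu).ae_eq (ae_of_all _ fun x => ?_)
    have := ofReal_add_I_ne_zero x
    have := ofReal_sub_I_ne_zero x
    simp only [ratFun, eval_pow, eval_add, eval_sub, eval_X, eval_C]
    field_simp
  · rw [eval_mul, mul_eq_zero] at hz
    exact hz.elim (hA₂ z) fun h => (X_sub_C_I_pow_im_pos N z h).le
  · filter_upwards [h2] with x hx
    rw [← hx]
    have := ofReal_sub_I_ne_zero x
    simp only [eval_mul, eval_pow, eval_sub, eval_X, eval_C]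
    field_simp

/-- A rational function without real poles which is square integrable vanishes at infinity. -/
lemma natDegree_lt_of_memLp {p d : ℂ[X]} (hp : p ≠ 0) (hd : ∀ z, d.eval z = 0 → z.im ≠ 0)
    (h : MemLp (ratFun p d) 2 volume) : p.natDegree < d.natDegree := by
  by_contra! hle
  set m := p.natDegree with hm
  have h1 : MemLp (ratFun p ((X + C Complex.I) ^ m)) 2 volume := by
    refine (memLp_mul_ratFun (p := d) (X_add_C_pow_ne_zero Complex.I m)
      (fun z hz => (X_add_C_I_pow_im_neg m z hz).ne)
      (by rwa [natDegree_X_add_C_pow]) h).ae_eq (ae_of_all _ fun x => ?_)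
    have h2 := eval_ofReal_ne_zero hd x
    simp only [ratFun]
    field_simp
  -- a polynomial of lower degree, so that `p / (x + i) ^ m` is square integrable only if its value
  -- at infinity is zero
  set l := p - C p.leadingCoeff * (X + C Complex.I) ^ m with hl
  have h2 : MemLp (ratFun l ((X + C Complex.I) ^ m)) 2 volume := by
    rcases eq_or_ne l 0 with h0 | h0
    · rw [h0]
      refine (MemLp.zero' (ε := ℂ)).ae_eq (ae_of_all _ fun x => ?_)
      simp [ratFun]
    · refine (inHardyPlus_ratFun (X_add_C_pow_ne_zero Complex.I m) (X_add_C_I_pow_im_neg m) ?_).1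
      rw [natDegree_X_add_C_pow]
      have hdeg : l.degree < p.degree := by
        refine degree_sub_lt_left ?_ hp ?_
        · rw [degree_mul, degree_C (leadingCoeff_ne_zero.2 hp), degree_pow, degree_X_add_C,
            zero_add, nsmul_one, degree_eq_natDegree hp]
        · rw [leadingCoeff_mul, leadingCoeff_C, leadingCoeff_pow, leadingCoeff_X_add_C, one_pow,
            mul_one]
      rw [degree_eq_natDegree h0, degree_eq_natDegree hp] at hdeg
      exact_mod_cast hdeg
  have h3 : MemLp (fun _ : ℝ => p.leadingCoeff) 2 volume := by
    refine (h1.sub h2).ae_eq (ae_of_all _ fun x => ?_)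
    have hx := eval_ofReal_ne_zero (fun z hz => (X_add_C_I_pow_im_neg m z hz).ne) x
    simp only [Pi.sub_apply, ratFun, hl, eval_sub, eval_mul, eval_C]
    field_simp
    ring
  rw [memLp_const_iff (by simp) (by simp)] at h3
  simp [hp] at h3

/-- A function is controlled by its multiples with two polynomials without common real zeros. -/
lemma memLp_mul_of_no_common_zero {A B : ℂ[X]} (hA0 : A ≠ 0)
    (hAB : ∀ x : ℝ, A.eval (x : ℂ) = 0 → B.eval (x : ℂ) ≠ 0) {w : ℝ → ℂ}
    (hA : MemLp (fun x : ℝ => A.eval (x : ℂ) * w x) 2 volume)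
    (hB : MemLp (fun x : ℝ => B.eval (x : ℂ) * w x) 2 volume) :
    MemLp (fun x : ℝ => ((x : ℂ) + Complex.I) ^ (max A.natDegree B.natDegree) * w x) 2 volume := by
  set m := max A.natDegree B.natDegree with hm
  set R : ℂ[X] := A * conjPoly A + B * conjPoly B with hR
  -- on the real line `R` is `|A|² + |B|²`
  have hRx : ∀ x : ℝ, R.eval (x : ℂ) = (Complex.normSq (A.eval (x : ℂ)) +
      Complex.normSq (B.eval (x : ℂ)) : ℝ) := fun x => by
    simp only [hR, eval_add, eval_mul, conjPoly_eval_ofReal, Complex.mul_conj]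
    push_cast; rfl
  have hRne : ∀ z, R.eval z = 0 → z.im ≠ 0 := fun z hz hz0 => by
    obtain ⟨x, rfl⟩ : ∃ x : ℝ, (x : ℂ) = z := ⟨z.re, by apply Complex.ext <;> simp [hz0]⟩
    rw [hRx, Complex.ofReal_eq_zero] at hz
    have h1 := Complex.normSq_nonneg (A.eval (x : ℂ))
    have h2 := Complex.normSq_nonneg (B.eval (x : ℂ))
    have h3 : A.eval (x : ℂ) = 0 := Complex.normSq_eq_zero.1 (by linarith)
    have h4 : B.eval (x : ℂ) = 0 := Complex.normSq_eq_zero.1 (by linarith)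
    exact hAB x h3 h4
  have hRdeg : 2 * m ≤ R.natDegree := by
    refine le_natDegree_of_ne_zero ?_
    have hc : ∀ (P : ℂ[X]), P.natDegree ≤ m →
        (P * conjPoly P).coeff (2 * m) = (Complex.normSq (P.coeff m) : ℝ) := fun P hP => by
      rw [two_mul, coeff_mul_add_eq_of_natDegree_le hP (by rwa [natDegree_conjPoly]), conjPoly,
        coeff_map, Complex.mul_conj]
    rw [hR, coeff_add, hc A (le_max_left _ _), hc B (le_max_right _ _), ← Complex.ofReal_add,
      Complex.ofReal_ne_zero]
    have h1 := Complex.normSq_nonneg (A.coeff m)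
    have h2 := Complex.normSq_nonneg (B.coeff m)
    rcases max_choice A.natDegree B.natDegree with h | h
    · have : 0 < Complex.normSq (A.coeff m) := by
        rw [Complex.normSq_pos, hm, h]
        exact leadingCoeff_ne_zero.2 hA0
      linarith
    · rcases eq_or_ne B 0 with rfl | hB0
      · have : 0 < Complex.normSq (A.coeff m) := by
          rw [Complex.normSq_pos, hm, natDegree_zero, Nat.max_zero]
          exact leadingCoeff_ne_zero.2 hA0
        linarith
      · have : 0 < Complex.normSq (B.coeff m) := by
          rw [Complex.normSq_pos, hm, h]
          exact leadingCoeff_ne_zero.2 hB0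
        linarith
  have hR0 : R ≠ 0 := by
    rintro h0
    have := hRne 0 (by rw [h0]; simp)
    simp at this
  have hdeg : ∀ P : ℂ[X], P.natDegree ≤ m →
      ((X + C Complex.I) ^ m * conjPoly P).natDegree ≤ R.natDegree := fun P hP => by
    refine natDegree_mul_le.trans ?_
    rw [natDegree_X_add_C_pow, natDegree_conjPoly]; omega
  refine ((memLp_mul_ratFun hR0 hRne (hdeg A (le_max_left _ _)) hA).add
    (memLp_mul_ratFun hR0 hRne (hdeg B (le_max_right _ _)) hB)).ae_eq (ae_of_all _ fun x => ?_)
  have hx := eval_ofReal_ne_zero hRne x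
  simp only [Pi.add_apply, ratFun, eval_mul, eval_pow, eval_add, eval_X, eval_C]
  field_simp
  simp only [hR, eval_add, eval_mul]

/-- The solutions in the Hardy space of the upper half-plane of the homogeneous Riemann-Hilbert
problem with rational coefficient: the zeros and poles are sorted such that `(a₁ / b₁) h` has no
singularities in the open upper half-plane and equals a function without singularities in the open
lower half-plane, whence both are polynomials. -/
lemma inHardyMinus_ratFun_mul_iff {a₁ a₂ b₁ b₂ : ℂ[X]} (ha₁0 : a₁ ≠ 0) (ha₂0 : a₂ ≠ 0)
    (hb₁0 : b₁ ≠ 0) (hb₂0 : b₂ ≠ 0)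
    (ha₁ : ∀ z, a₁.eval z = 0 → z.im < 0) (ha₂ : ∀ z, a₂.eval z = 0 → 0 ≤ z.im)
    (hb₁ : ∀ z, b₁.eval z = 0 → z.im ≤ 0) (hb₂ : ∀ z, b₂.eval z = 0 → 0 < z.im)
    (hab : ∀ x : ℝ, b₁.eval (x : ℂ) = 0 → a₂.eval (x : ℂ) ≠ 0) (h : ℝ → ℂ) :
    (InHardyPlus h ∧ InHardyMinus (fun x => ratFun (a₁ * a₂) (b₁ * b₂) x * h x)) ↔
      ∃ r : ℂ[X], (r = 0 ∨ (r.natDegree + b₁.natDegree < a₁.natDegree ∧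
        r.natDegree + a₂.natDegree < b₂.natDegree)) ∧
        h =ᵐ[volume] fun x => ratFun b₁ a₁ x * r.eval (x : ℂ) := by
  have ha₁x := eval_ofReal_ne_zero fun z hz => (ha₁ z hz).ne
  have hb₂x := eval_ofReal_ne_zero fun z hz => (hb₂ z hz).ne'
  constructor
  · rintro ⟨hh, hf⟩
    -- with `w = h / Q` the functions `Q w` and `P w` are square integrable, where `P = a₁ a₂` and
    -- `Q = b₁ b₂`; hence `u = a₁ b₂ w`, which has no poles off the real line, grows polynomially
    set w : ℝ → ℂ := fun x => h x / (b₁ * b₂).eval (x : ℂ) with hw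
    have hbw : ∀ᵐ x : ℝ, (b₁ * b₂).eval (x : ℂ) * w x = h x := by
      filter_upwards [ae_eval_ne_zero (mul_ne_zero hb₁0 hb₂0)] with x hx
      rw [hw]; exact mul_div_cancel₀ _ hx
    have haw : ∀ x : ℝ, (a₁ * a₂).eval (x : ℂ) * w x = ratFun (a₁ * a₂) (b₁ * b₂) x * h x :=
      fun x => by simp only [hw, ratFun]; ring
    have hW := memLp_mul_of_no_common_zero (A := b₁ * b₂) (B := a₁ * a₂) (mul_ne_zero hb₁0 hb₂0)
      (fun x hx => by
        rw [eval_mul, mul_eq_zero] at hx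
        rw [eval_mul]
        exact mul_ne_zero (ha₁x x) (hab x (hx.resolve_right (hb₂x x))))
      (w := w) (hh.1.ae_eq (by filter_upwards [hbw] with x hx using hx.symm))
      (hf.1.ae_eq (ae_of_all _ fun x => (haw x).symm))
    set m := max (b₁ * b₂).natDegree (a₁ * a₂).natDegree
    set N := a₁.natDegree + b₂.natDegree with hN
    set u : ℝ → ℂ := fun x => a₁.eval (x : ℂ) * b₂.eval (x : ℂ) * w x with hu
    have huN : MemLp (fun x => u x / ((x : ℂ) + Complex.I) ^ N) 2 volume := by
      refine (memLp_mul_ratFun (p := a₁ * b₂) (X_add_C_pow_ne_zero Complex.I (N + m))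
        (fun z hz => (X_add_C_I_pow_im_neg _ z hz).ne)
        (by rw [natDegree_X_add_C_pow]; exact natDegree_mul_le.trans (by omega)) hW).ae_eq
        (ae_of_all _ fun x => ?_)
      have := ofReal_add_I_ne_zero x
      simp only [hu, ratFun, eval_mul, eval_pow, eval_add, eval_X, eval_C]
      field_simp
      ring
    have hbu : ∀ᵐ x : ℝ, b₁.eval (x : ℂ) * u x = a₁.eval (x : ℂ) * h x := by
      filter_upwards [hbw] with x hx
      rw [← hx, hu]; simp only [eval_mul]; ring
    have hau : ∀ x : ℝ, a₂.eval (x : ℂ) * u x =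
        b₂.eval (x : ℂ) * (ratFun (a₁ * a₂) (b₁ * b₂) x * h x) := fun x => by
      rw [← haw, hu]; simp only [eval_mul]; ring
    obtain ⟨r, -, hr⟩ := exists_polynomial_of_mul_eq N huN hh hf hb₁0 hb₁ ha₂0 ha₂ hbu
      (ae_of_all _ hau)
    have hhr : h =ᵐ[volume] fun x => ratFun b₁ a₁ x * r.eval (x : ℂ) := by
      filter_upwards [hr, hbu] with x hx hx2
      have := ha₁x x
      rw [ratFun, ← hx]
      field_simp
      linear_combination -hx2
    refine ⟨r, ?_, hhr⟩
    rcases eq_or_ne r 0 with hr0 | hr0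
    · exact Or.inl hr0
    · right
      have h1 := natDegree_lt_of_memLp (mul_ne_zero hr0 hb₁0) (fun z hz => (ha₁ z hz).ne)
        (hh.1.ae_eq (by
          filter_upwards [hhr] with x hx
          rw [hx]; simp only [ratFun, eval_mul]; ring))
      have h2 := natDegree_lt_of_memLp (mul_ne_zero hr0 ha₂0) (fun z hz => (hb₂ z hz).ne')
        (hf.1.ae_eq (by
          filter_upwards [hr] with x hx
          have h3 := hau x
          have := hb₂x x
          rw [hx] at h3
          change _ = (r * a₂).eval (x : ℂ) / b₂.eval (x : ℂ)
          rw [eval_mul, eq_div_iff this]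
          linear_combination -h3))
      rw [natDegree_mul hr0 hb₁0] at h1
      rw [natDegree_mul hr0 ha₂0] at h2
      exact ⟨h1, h2⟩
  · rintro ⟨r, hr, hhr⟩
    rcases eq_or_ne r 0 with hr0 | hr0
    · have h0 : h =ᵐ[volume] 0 := by
        filter_upwards [hhr] with x hx
        rw [hx, hr0]; simp
      have hp0 : InHardyPlus (fun _ => 0) := ⟨MemLp.zero', fun a _ => by simp⟩
      have hm0 : InHardyMinus (fun _ => 0) := ⟨MemLp.zero', fun a _ => by simp⟩
      refine ⟨hp0.congr h0.symm, hm0.congr ?_⟩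
      filter_upwards [h0] with x hx
      rw [hx]; simp
    · obtain ⟨h1, h2⟩ := hr.resolve_left hr0
      refine ⟨(inHardyPlus_ratFun (p := r * b₁) ha₁0 ha₁ (natDegree_mul_le.trans_lt h1)).congr ?_,
        (inHardyMinus_ratFun (p := r * a₂) hb₂0 hb₂ (natDegree_mul_le.trans_lt h2)).congr ?_⟩
      · filter_upwards [hhr] with x hx
        rw [hx]; simp only [ratFun, eval_mul]; ring
      · filter_upwards [hhr, ae_eval_ne_zero hb₁0] with x hx hx2
        have := ha₁x x
        have := hb₂x x
        rw [hx]; simp only [ratFun, eval_mul]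
        field_simp

/-! ### Sorting the zeros of a polynomial -/

lemma zerosPart_monic (s : Set ℂ) (P : ℂ[X]) : (zerosPart s P).Monic :=
  monic_multiset_prod_of_monic _ _ fun a _ => monic_X_sub_C a

lemma zerosPart_ne_zero (s : Set ℂ) (P : ℂ[X]) : zerosPart s P ≠ 0 :=
  (zerosPart_monic s P).ne_zero

lemma zerosPart_zero {s : Set ℂ} {P : ℂ[X]} {z : ℂ} (h : (zerosPart s P).eval z = 0) :
    z ∈ s ∧ P.eval z = 0 := by
  classical
  rw [zerosPart, eval_multiset_prod, Multiset.map_map, Multiset.prod_eq_zero_iff,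
    Multiset.mem_map] at h
  obtain ⟨a, ha, haz⟩ := h
  rw [Multiset.mem_filter] at ha
  simp only [Function.comp, eval_sub, eval_X, eval_C, sub_eq_zero] at haz
  rw [haz]
  exact ⟨ha.2, (mem_roots'.1 ha.1).2⟩

lemma zerosPart_union {s t : Set ℂ} (h : Disjoint s t) (P : ℂ[X]) :
    zerosPart (s ∪ t) P = zerosPart s P * zerosPart t P := by
  classical
  rw [zerosPart, zerosPart, zerosPart, ← Multiset.prod_add, ← Multiset.map_add,
    Multiset.filter_add_filter]
  have h0 : P.roots.filter (fun a => a ∈ s ∧ a ∈ t) = 0 :=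
    Multiset.filter_eq_nil.2 fun a _ ha => Set.disjoint_left.1 h ha.1 ha.2
  rw [h0, add_zero]
  congr 2
  ext a
  simp only [Multiset.count_filter, Set.mem_union]

lemma partLT_ne_zero (P : ℂ[X]) : partLT P ≠ 0 := zerosPart_ne_zero _ _

lemma partLE_ne_zero (P : ℂ[X]) : partLE P ≠ 0 := zerosPart_ne_zero _ _

lemma partGT_ne_zero (P : ℂ[X]) : partGT P ≠ 0 := zerosPart_ne_zero _ _

lemma partGE_ne_zero (P : ℂ[X]) : partGE P ≠ 0 := zerosPart_ne_zero _ _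

lemma partReal_ne_zero (P : ℂ[X]) : partReal P ≠ 0 := zerosPart_ne_zero _ _

lemma zerosPart_univ (P : ℂ[X]) : C P.leadingCoeff * zerosPart Set.univ P = P := by
  classical
  conv_rhs => rw [(IsAlgClosed.splits P).eq_prod_roots]
  simp [zerosPart]

lemma partLT_mul_partGE (P : ℂ[X]) : C P.leadingCoeff * (partLT P * partGE P) = P := by
  rw [partLT, partGE, ← zerosPart_union]
  · convert zerosPart_univ P using 3
    ext z; simpa using lt_or_ge z.im 0
  · exact Set.disjoint_left.2 fun z (hz : z.im < 0) (hz' : 0 ≤ z.im) => not_lt.2 hz' hz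

lemma partLE_mul_partGT (P : ℂ[X]) : C P.leadingCoeff * (partLE P * partGT P) = P := by
  rw [partLE, partGT, ← zerosPart_union]
  · convert zerosPart_univ P using 3
    ext z; simpa using le_or_gt z.im 0
  · exact Set.disjoint_left.2 fun z (hz : z.im ≤ 0) (hz' : 0 < z.im) => not_lt.2 hz hz'

lemma partLE_eq (P : ℂ[X]) : partLE P = partLT P * partReal P := by
  rw [partLE, partLT, partReal, ← zerosPart_union]
  · congr 1
    ext z; simpa using le_iff_lt_or_eq
  · exact Set.disjoint_left.2 fun z hz hz' => hz.ne hz'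

/-- `Q = c Q_> Q_< q`. -/
lemma nonreal_mul_partReal (Q : ℂ[X]) :
    C Q.leadingCoeff * partGT Q * partLT Q * partReal Q = Q := by
  conv_rhs => rw [← partLE_mul_partGT Q, partLE_eq]
  ring

lemma conjPoly_zerosPart (s : Set ℂ) (P : ℂ[X]) :
    conjPoly (zerosPart s P) = zerosPart (starRingEnd ℂ ⁻¹' s) (conjPoly P) := by
  classical
  rw [zerosPart, zerosPart, conjPoly, conjPoly, (IsAlgClosed.splits P).roots_map,
    Multiset.filter_map, Multiset.map_map, Polynomial.map_multiset_prod, Multiset.map_map]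
  congr 1
  simp

lemma conjPoly_partGT (P : ℂ[X]) : conjPoly (partGT P) = partLT (conjPoly P) := by
  rw [partGT, conjPoly_zerosPart, partLT]
  congr 1
  ext z; simp

lemma conjPoly_partLT (P : ℂ[X]) : conjPoly (partLT P) = partGT (conjPoly P) := by
  rw [partLT, conjPoly_zerosPart, partGT]
  congr 1
  ext z; simp

lemma natDegree_nonreal {Q : ℂ[X]} (hQ : Q ≠ 0) :
    (partGT Q).natDegree + (partLT Q).natDegree + (partReal Q).natDegree = Q.natDegree := by
  conv_rhs => rw [← partLE_mul_partGT Q, partLE_eq]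
  rw [natDegree_C_mul (leadingCoeff_ne_zero.2 hQ),
    natDegree_mul (mul_ne_zero (partLT_ne_zero _) (partReal_ne_zero _)) (partGT_ne_zero _),
    natDegree_mul (partLT_ne_zero _) (partReal_ne_zero _)]
  ring

lemma natDegree_partLT_add_partGE {P : ℂ[X]} (hP : P ≠ 0) :
    (partLT P).natDegree + (partGE P).natDegree = P.natDegree := by
  conv_rhs => rw [← partLT_mul_partGE P]
  rw [natDegree_C_mul (leadingCoeff_ne_zero.2 hP),
    natDegree_mul (partLT_ne_zero _) (partGE_ne_zero _)]

lemma poleExp_add {P Q : ℂ[X]} (hQ : Q ≠ 0) :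
    poleExp P Q + Q.natDegree = max P.natDegree Q.natDegree + (partReal Q).natDegree := by
  have := natDegree_nonreal hQ
  rw [poleExp]
  omega

/-- The denominator `c Q_> Q_< (x + i) ^ ς` of the multiplier `κ q / (x + i) ^ ς`. -/
noncomputable def reducedDenom (P Q : ℂ[X]) : ℂ[X] :=
  C Q.leadingCoeff * partGT Q * partLT Q * (X + C Complex.I) ^ poleExp P Q

lemma nonreal_ne_zero {Q : ℂ[X]} (hQ : Q ≠ 0) : C Q.leadingCoeff * partGT Q * partLT Q ≠ 0 :=
  mul_ne_zero (mul_ne_zero (C_ne_zero.2 (leadingCoeff_ne_zero.2 hQ)) (partGT_ne_zero _))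
    (partLT_ne_zero _)

lemma nonreal_im_ne_zero {Q : ℂ[X]} (hQ : Q ≠ 0) (z : ℂ)
    (hz : (C Q.leadingCoeff * partGT Q * partLT Q).eval z = 0) : z.im ≠ 0 := by
  rw [eval_mul, eval_mul, eval_C, mul_eq_zero, mul_eq_zero] at hz
  rcases hz with (hz | hz) | hz
  · exact absurd hz (leadingCoeff_ne_zero.2 hQ)
  · exact (zerosPart_zero hz).1.ne'
  · exact (zerosPart_zero hz).1.ne

lemma reducedDenom_ne_zero (P : ℂ[X]) {Q : ℂ[X]} (hQ : Q ≠ 0) : reducedDenom P Q ≠ 0 :=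
  mul_ne_zero (nonreal_ne_zero hQ) (X_add_C_pow_ne_zero _ _)

lemma reducedDenom_im_ne_zero (P : ℂ[X]) {Q : ℂ[X]} (hQ : Q ≠ 0) (z : ℂ)
    (hz : (reducedDenom P Q).eval z = 0) : z.im ≠ 0 := by
  rw [reducedDenom, eval_mul, mul_eq_zero] at hz
  exact hz.elim (nonreal_im_ne_zero hQ z) fun h => (X_add_C_I_pow_im_neg _ z h).ne

lemma natDegree_nonreal_part {Q : ℂ[X]} (hQ : Q ≠ 0) :
    (C Q.leadingCoeff * partGT Q * partLT Q).natDegree + (partReal Q).natDegree = Q.natDegree := by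
  rw [← natDegree_nonreal hQ, mul_assoc, natDegree_C_mul (leadingCoeff_ne_zero.2 hQ),
    natDegree_mul (partGT_ne_zero _) (partLT_ne_zero _)]

lemma natDegree_reducedDenom (P : ℂ[X]) {Q : ℂ[X]} (hQ : Q ≠ 0) :
    (reducedDenom P Q).natDegree = max P.natDegree Q.natDegree := by
  have h1 := natDegree_nonreal_part hQ
  have h2 := poleExp_add (P := P) hQ
  rw [reducedDenom, natDegree_mul (nonreal_ne_zero hQ) (X_add_C_pow_ne_zero _ _),
    natDegree_X_add_C_pow]
  omega

lemma eval_nonreal_mul_partReal (Q : ℂ[X]) (x : ℂ) :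
    (C Q.leadingCoeff * partGT Q * partLT Q).eval x * (partReal Q).eval x = Q.eval x := by
  rw [← eval_mul, nonreal_mul_partReal]

lemma isCoprime_eval_ne_zero {P Q : ℂ[X]} (h : IsCoprime P Q) {z : ℂ} (hP : P.eval z = 0) :
    Q.eval z ≠ 0 := by
  intro hQ
  obtain ⟨a, b, hab⟩ := h
  have := congrArg (eval z) hab
  simp [hP, hQ] at this

lemma ratFun_mul_domain {P Q : ℂ[X]} (hQ : Q ≠ 0) {h k : ℝ → ℂ}
    (hhk : h =ᵐ[volume] fun x =>
      ratFun (partReal Q) ((X + C Complex.I) ^ poleExp P Q) x * k x) :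
    (fun x => ratFun P Q x * h x) =ᵐ[volume] fun x => ratFun P (reducedDenom P Q) x * k x := by
  filter_upwards [hhk, ae_eval_ne_zero (partReal_ne_zero Q)] with x hx hx2
  rw [hx, ratFun, ratFun, ratFun, reducedDenom, eval_mul, ← eval_nonreal_mul_partReal Q x]
  have h1 := ofReal_add_I_ne_zero x
  have h3 := eval_ofReal_ne_zero (nonreal_im_ne_zero hQ) x
  simp only [eval_pow, eval_add, eval_X, eval_C]
  field_simp

/-- The functions of the Hardy space in the domain of the multiplication operator with symbol
`P / Q`. -/
lemma memLp_ratFun_mul_iff {P Q : ℂ[X]} (hQ : Q ≠ 0) (hPQ : IsCoprime P Q) (h : ℝ → ℂ) :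
    (InHardyPlus h ∧ MemLp (fun x => ratFun P Q x * h x) 2 volume) ↔
      ∃ k, InHardyPlus k ∧
        h =ᵐ[volume] fun x => ratFun (partReal Q) ((X + C Complex.I) ^ poleExp P Q) x * k x := by
  have hς := poleExp_add (P := P) hQ
  have hdeg := natDegree_nonreal_part hQ
  have hq := ae_eval_ne_zero (partReal_ne_zero Q)
  constructor
  · rintro ⟨hh, hκ⟩
    set w : ℝ → ℂ := fun x => h x / Q.eval (x : ℂ) with hw
    have hW := memLp_mul_of_no_common_zero (A := Q) (B := P) hQ
      (fun x hx => isCoprime_eval_ne_zero hPQ.symm hx) (w := w)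
      (hh.1.ae_eq (by
        filter_upwards [ae_eval_ne_zero hQ] with x hx
        rw [hw]; exact (mul_div_cancel₀ _ hx).symm))
      (hκ.ae_eq (ae_of_all _ fun x => by simp only [hw, ratFun]; ring))
    set k : ℝ → ℂ := fun x => ((x : ℂ) + Complex.I) ^ poleExp P Q * h x /
      (partReal Q).eval (x : ℂ) with hk
    set m := max Q.natDegree P.natDegree with hm
    have hkL : MemLp k 2 volume := by
      refine (memLp_mul_ratFun
        (p := C Q.leadingCoeff * partGT Q * partLT Q * (X + C Complex.I) ^ poleExp P Q)
        (X_add_C_pow_ne_zero Complex.I m)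
        (fun z hz => (X_add_C_I_pow_im_neg _ z hz).ne)
        (by
          rw [natDegree_X_add_C_pow]
          refine natDegree_mul_le.trans ?_
          rw [natDegree_X_add_C_pow]
          omega) hW).ae_eq ?_
      filter_upwards [hq, ae_eval_ne_zero hQ] with x hx hx'
      have h1 := ofReal_add_I_ne_zero x
      have h2 := eval_nonreal_mul_partReal Q x
      have h3 := eval_ofReal_ne_zero (nonreal_im_ne_zero hQ) x
      have h4 := eval_mul (x := (x : ℂ)) (p := C Q.leadingCoeff * partGT Q * partLT Q)
        (q := (X + C Complex.I) ^ poleExp P Q)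
      simp only [hk, hw, ratFun]
      rw [← h2, h4]
      simp only [eval_pow, eval_add, eval_X, eval_C]
      field_simp
    refine ⟨k, hh.of_mul_eq hkL (A := partReal Q) (B := (X + C Complex.I) ^ poleExp P Q)
      (partReal_ne_zero Q) (fun z hz => (zerosPart_zero hz).1.le) ?_, ?_⟩
    · filter_upwards [hq] with x hx
      simp only [hk, eval_pow, eval_add, eval_X, eval_C]
      exact mul_div_cancel₀ _ hx
    · filter_upwards [hq] with x hx
      have h1 := ofReal_add_I_ne_zero x
      simp only [hk, ratFun, eval_pow, eval_add, eval_X, eval_C]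
      field_simp
  · rintro ⟨k, hk, hhk⟩
    refine ⟨(hk.mul_ratFun (p := partReal Q) (X_add_C_pow_ne_zero Complex.I (poleExp P Q))
      (X_add_C_I_pow_im_neg _) (by rw [natDegree_X_add_C_pow]; omega)).congr ?_,
      (memLp_mul_ratFun (p := P) (reducedDenom_ne_zero P hQ) (reducedDenom_im_ne_zero P hQ)
        (by rw [natDegree_reducedDenom P hQ]; omega) hk.1).ae_eq ?_⟩
    · filter_upwards [hhk] with x hx
      rw [hx, mul_comm]
    · filter_upwards [ratFun_mul_domain hQ hhk] with x hx
      rw [hx, mul_comm]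

/-! ### The graph of `M₊(κ)` -/

lemma hardyProj_eq_iff (f : L2R) (g : hardyPlus) :
    hardyProj f = g ↔ f - (g : L2R) ∈ hardyPlusᗮ := by
  have h : hardyProj (g : L2R) = g :=
    Submodule.orthogonalProjectionOnto_mem_subspace_eq_self (K := hardyPlus) g
  rw [← Submodule.orthogonalProjectionOnto_eq_zero_iff (K := hardyPlus)]
  change _ ↔ hardyProj (f - g) = 0
  rw [map_sub, h, sub_eq_zero]

lemma mem_domain_mPlus (κ : ℝ → ℂ) (h : hardyPlus) :
    h ∈ (mPlus κ).domain ↔ MemLp (fun x => κ x * (h : L2R) x) 2 volume :=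
  Iff.rfl

/-- `M₊(κ) h = g` means that `κ h - g` belongs to the Hardy space of the lower half-plane. -/
lemma mem_graph_mPlus_iff (κ : ℝ → ℂ) (h g : hardyPlus) :
    (h, g) ∈ (mPlus κ).graph ↔ InHardyMinus (fun x => κ x * (h : L2R) x - (g : L2R) x) := by
  have key : ∀ hm : MemLp (fun x => κ x * (h : L2R) x) 2 volume,
      hardyProj (hm.toLp _) = g ↔ InHardyMinus (fun x => κ x * (h : L2R) x - (g : L2R) x) := by
    intro hm
    have he : (hm.toLp _ - (g : L2R) : L2R) =ᵐ[volume]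
        fun x => κ x * (h : L2R) x - (g : L2R) x := by
      filter_upwards [Lp.coeFn_sub (hm.toLp _) (g : L2R), hm.coeFn_toLp] with x h1 h2
      rw [h1, Pi.sub_apply, h2]
    rw [hardyProj_eq_iff, mem_hardyPlus_orthogonal_iff]
    exact ⟨fun H => H.congr he, fun H => H.congr he.symm⟩
  rw [LinearPMap.mem_graph_iff]
  constructor
  · rintro ⟨y, hy, hyg⟩
    simp only at hy hyg
    subst hy
    exact (key ((mem_domain_mPlus κ y).1 y.2)).1 hyg
  · intro H
    have hm : MemLp (fun x => κ x * (h : L2R) x) 2 volume := by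
      refine (H.1.add (Lp.memLp (g : L2R))).ae_eq (ae_of_all _ fun x => ?_)
      simp
    exact ⟨⟨h, hm⟩, rfl, (key hm).2 H⟩

lemma mem_kernel_iff {E F : Type*} [NormedAddCommGroup E] [NormedSpace ℂ E]
    [NormedAddCommGroup F] [NormedSpace ℂ F] (A : E →ₗ.[ℂ] F) (x : E) :
    x ∈ kernel A ↔ (x, (0 : F)) ∈ A.graph := by
  rw [LinearPMap.mem_graph_iff, kernel, Submodule.mem_map]
  constructor
  · rintro ⟨y, hy, rfl⟩
    exact ⟨y, rfl, hy⟩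
  · rintro ⟨y, hy, hy0⟩
    exact ⟨y, hy0, hy⟩

lemma mem_range_iff {E F : Type*} [NormedAddCommGroup E] [NormedSpace ℂ E]
    [NormedAddCommGroup F] [NormedSpace ℂ F] (A : E →ₗ.[ℂ] F) (y : F) :
    y ∈ range A ↔ ∃ x, (x, y) ∈ A.graph := by
  simp only [LinearPMap.mem_graph_iff]
  constructor
  · rintro ⟨x, rfl⟩
    exact ⟨x, x, rfl, rfl⟩
  · rintro ⟨_, x, -, hx⟩
    exact ⟨x, hx⟩

lemma inHardyPlus_coe (h : hardyPlus) : InHardyPlus ((h : L2R) : ℝ → ℂ) :=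
  (mem_hardyPlus_iff _).1 h.2

/-- A function of the Hardy space as an element of the Hilbert space `H₊`. -/
lemma InHardyPlus.exists_eq {u : ℝ → ℂ} (hu : InHardyPlus u) :
    ∃ h : hardyPlus, ((h : L2R) : ℝ → ℂ) =ᵐ[volume] u :=
  ⟨⟨hu.1.toLp u, (inHardyPlus_toLp hu.1).2 hu⟩, hu.1.coeFn_toLp⟩

lemma asFunctions_eq {S : Set hardyPlus} {T : Set (ℝ →ₘ[volume] ℂ)}
    (h1 : ∀ h : hardyPlus, h ∈ S ↔ ((h : L2R) : ℝ →ₘ[volume] ℂ) ∈ T)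
    (h2 : ∀ f ∈ T, InHardyPlus f) : asFunctions S = T := by
  ext f
  constructor
  · rintro ⟨h, hh, rfl⟩
    exact (h1 h).1 hh
  · intro hf
    obtain ⟨h, hh⟩ := (h2 f hf).exists_eq
    have : ((h : L2R) : ℝ →ₘ[volume] ℂ) = f := AEEqFun.ext hh
    exact ⟨h, (h1 h).2 (by rwa [this]), this⟩

/-! ### Multiplication by a rational function as a bounded operator -/

/-- Multiplication by a bounded rational function `p / d` without real poles. -/
noncomputable def mulRat (p d : ℂ[X]) (hd0 : d ≠ 0) (hd : ∀ z, d.eval z = 0 → z.im ≠ 0)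
    (hpd : p.natDegree ≤ d.natDegree) : L2R →L[ℂ] L2R :=
  LinearMap.mkContinuous
    { toFun := fun f => (memLp_mul_ratFun hd0 hd hpd (Lp.memLp f)).toLp _
      map_add' := fun f g => by
        rw [← MemLp.toLp_add]
        refine MemLp.toLp_congr _ _ ?_
        filter_upwards [Lp.coeFn_add f g] with x hx
        rw [hx, Pi.add_apply, Pi.add_apply, add_mul]
      map_smul' := fun a f => by
        rw [RingHom.id_apply, ← MemLp.toLp_const_smul]
        refine MemLp.toLp_congr _ _ ?_
        filter_upwards [Lp.coeFn_smul a f] with x hx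
        rw [hx, Pi.smul_apply, Pi.smul_apply, smul_eq_mul, smul_eq_mul, mul_assoc] }
    (bounded_ratFun hd0 hd hpd).choose fun f => by
      refine Lp.norm_le_mul_norm_of_ae_le_mul ?_
      filter_upwards [(memLp_mul_ratFun hd0 hd hpd (Lp.memLp f)).coeFn_toLp] with x hx
      change ‖((memLp_mul_ratFun hd0 hd hpd (Lp.memLp f)).toLp _ : ℝ → ℂ) x‖ ≤ _
      rw [hx, norm_mul, mul_comm]
      exact mul_le_mul_of_nonneg_right ((bounded_ratFun hd0 hd hpd).choose_spec x) (norm_nonneg _)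

lemma mulRat_coeFn {p d : ℂ[X]} (hd0 : d ≠ 0) (hd : ∀ z, d.eval z = 0 → z.im ≠ 0)
    (hpd : p.natDegree ≤ d.natDegree) (f : L2R) :
    (mulRat p d hd0 hd hpd f : ℝ → ℂ) =ᵐ[volume] fun x => f x * ratFun p d x :=
  (memLp_mul_ratFun hd0 hd hpd (Lp.memLp f)).coeFn_toLp

/-! ### Finite dimensional spaces of rational functions -/

lemma measurable_ratFun (p d : ℂ[X]) : Measurable (ratFun p d) :=
  (p.continuous.measurable.comp Complex.measurable_ofReal).div
    (d.continuous.measurable.comp Complex.measurable_ofReal)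

/-- A subspace of `L²(ℝ)` is finite dimensional if it consists of multiples of a fixed function
with polynomials of bounded degree. -/
lemma finiteDimensional_of_polynomial (S : Submodule ℂ L2R) {r : ℝ → ℂ} (hr : Measurable r) (n : ℕ)
    (h : ∀ f ∈ S, ∃ p : ℂ[X], p.degree < n ∧ f =ᵐ[volume] fun x => r x * p.eval (x : ℂ)) :
    FiniteDimensional ℂ S := by
  have hm : ∀ p : ℂ[X], AEStronglyMeasurable (fun x : ℝ => r x * p.eval (x : ℂ)) volume :=
    fun p => (hr.mul (p.continuous.measurable.comp Complex.measurable_ofReal)).aestronglyMeasurable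
  let L : degreeLT ℂ n →ₗ[ℂ] (ℝ →ₘ[volume] ℂ) :=
    { toFun := fun p => AEEqFun.mk _ (hm p)
      map_add' := fun p q => by
        rw [AEEqFun.mk_add_mk]
        congr 1
        ext x
        simp [mul_add]
      map_smul' := fun a p => by
        rw [RingHom.id_apply, AEEqFun.smul_mk]
        congr 1
        ext x
        simp [mul_left_comm] }
  let ι : S →ₗ[ℂ] (ℝ →ₘ[volume] ℂ) :=
    { toFun := fun f => ((f : L2R) : ℝ →ₘ[volume] ℂ)
      map_add' := fun f g => rfl
      map_smul' := fun a f => rfl }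
  have hι : ∀ f, ι f ∈ LinearMap.range L := fun f => by
    obtain ⟨p, hp, hfp⟩ := h f f.2
    refine ⟨⟨p, mem_degreeLT.2 hp⟩, AEEqFun.ext ?_⟩
    exact (AEEqFun.coeFn_mk _ (hm p)).trans hfp.symm
  have hfin : Module.Finite ℂ (LinearMap.range L) := inferInstance
  refine Module.Finite.of_injective (ι.codRestrict (LinearMap.range L) hι) fun f g hfg => ?_
  have h2 : ι f = ι g := congrArg (fun z : LinearMap.range L => (z : ℝ →ₘ[volume] ℂ)) hfg
  exact Subtype.ext (Subtype.ext h2)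

lemma finiteDimensional_of_mulPoly (S : Submodule ℂ hardyPlus) {r : ℝ → ℂ} (hr : Measurable r)
    (n : ℤ) (h : asFunctions S ⊆ mulPoly r n) : FiniteDimensional ℂ S := by
  have hfin : FiniteDimensional ℂ (S.map hardyPlus.subtype) := by
    refine finiteDimensional_of_polynomial _ hr n.toNat ?_
    rintro f ⟨g, hg, rfl⟩
    obtain ⟨p, hp, hfp⟩ := h ⟨g, hg, rfl⟩
    refine ⟨p, ?_, hfp⟩
    rcases eq_or_ne p 0 with rfl | hp0
    · simp
    · have := hp.resolve_left hp0
      rw [degree_eq_natDegree hp0]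
      have : p.natDegree < n.toNat := by omega
      exact_mod_cast this
  exact (Submodule.equivMapOfInjective hardyPlus.subtype hardyPlus.injective_subtype
    S).symm.finiteDimensional

/-! ### The remainder `κ h - M₊(κ) h` -/

/-- The space of the functions in the Hardy space of the lower half-plane which become polynomials
of degree less than `N` upon multiplication by `d`. For `d ≠ 0` its dimension is finite. -/
def remainderSpace (d : ℂ[X]) (N : ℕ) : Submodule ℂ L2R where
  carrier := {f | f ∈ hardyPlusᗮ ∧ ∃ r : ℂ[X], r.degree < N ∧
    ∀ᵐ x : ℝ, d.eval (x : ℂ) * f x = r.eval (x : ℂ)}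
  zero_mem' := ⟨zero_mem _, 0, by simp, by
    filter_upwards [Lp.coeFn_zero ℂ 2 (volume : Measure ℝ)] with x hx
    rw [hx, Pi.zero_apply, mul_zero, eval_zero]⟩
  add_mem' := by
    rintro f g ⟨hf, r, hr, hfr⟩ ⟨hg, s, hs, hgs⟩
    refine ⟨add_mem hf hg, r + s, (degree_add_le _ _).trans_lt (max_lt hr hs), ?_⟩
    filter_upwards [hfr, hgs, Lp.coeFn_add f g] with x h1 h2 h3
    rw [h3, Pi.add_apply, mul_add, h1, h2, eval_add]
  smul_mem' := by
    rintro c f ⟨hf, r, hr, hfr⟩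
    refine ⟨Submodule.smul_mem _ c hf, c • r, (degree_smul_le c r).trans_lt hr, ?_⟩
    filter_upwards [hfr, Lp.coeFn_smul c f] with x h1 h2
    rw [h2, Pi.smul_apply, smul_eq_mul, mul_left_comm, h1, eval_smul, smul_eq_mul]

lemma finiteDimensional_remainderSpace {d : ℂ[X]} (hd : d ≠ 0) (N : ℕ) :
    FiniteDimensional ℂ (remainderSpace d N) := by
  refine finiteDimensional_of_polynomial _ (measurable_ratFun 1 d) N ?_
  rintro f ⟨-, r, hr, hfr⟩
  refine ⟨r, hr, ?_⟩
  filter_upwards [hfr, ae_eval_ne_zero hd] with x h1 h2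
  rw [← h1, ratFun, eval_one]
  field_simp

/-- The difference of `κ h` and its projection `M₊(κ) h` has only the poles of `κ` in the closed
upper half-plane and belongs to a fixed space of finite dimension. -/
lemma toLp_mem_remainderSpace {P Q : ℂ[X]} (hQ : Q ≠ 0) {h g : ℝ → ℂ} (hh : InHardyPlus h)
    (hg : InHardyPlus g) (hf : InHardyMinus fun x => ratFun P Q x * h x - g x) :
    hf.1.toLp _ ∈ remainderSpace (partGE Q) (max P.natDegree Q.natDegree) := by
  set N := max P.natDegree Q.natDegree with hN
  have hc : Q.leadingCoeff ≠ 0 := leadingCoeff_ne_zero.2 hQ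
  refine ⟨(inHardyMinus_toLp hf.1).2 hf, ?_⟩
  have hH : InHardyPlus (fun x => Q.leadingCoeff⁻¹ *
      (h x * ratFun P ((X + C Complex.I) ^ N) x - g x * ratFun Q ((X + C Complex.I) ^ N) x)) :=
    ((hh.mul_ratFun (X_add_C_pow_ne_zero Complex.I N) (X_add_C_I_pow_im_neg N)
      (by rw [natDegree_X_add_C_pow]; omega)).sub
      (hg.mul_ratFun (X_add_C_pow_ne_zero Complex.I N) (X_add_C_I_pow_im_neg N)
      (by rw [natDegree_X_add_C_pow]; omega))).const_mul _
  have hu : MemLp (fun x : ℝ => ((partGE Q).eval (x : ℂ) * (ratFun P Q x * h x - g x)) /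
      ((x : ℂ) + Complex.I) ^ N) 2 volume := by
    refine (memLp_mul_ratFun (p := partGE Q) (X_add_C_pow_ne_zero Complex.I N)
      (fun z hz => (X_add_C_I_pow_im_neg N z hz).ne) ?_ hf.1).ae_eq (ae_of_all _ fun x => ?_)
    · have := natDegree_partLT_add_partGE hQ
      rw [natDegree_X_add_C_pow]; omega
    · simp only [ratFun, eval_pow, eval_add, eval_X, eval_C]
      ring
  obtain ⟨r, hr, hur⟩ := exists_polynomial_of_mul_eq
    (A₁ := partLT Q) (B₁ := (X + C Complex.I) ^ N) (A₂ := 1) (B₂ := partGE Q) N hu hH hf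
    (partLT_ne_zero Q) (fun z hz => (zerosPart_zero hz).1.le) one_ne_zero (by simp) (by
      filter_upwards [ae_eval_ne_zero hQ] with x hx
      have h1 := ofReal_add_I_ne_zero x
      have h2 := congrArg (eval (x : ℂ)) (partLT_mul_partGE Q)
      simp only [eval_mul, eval_C] at h2
      simp only [ratFun, eval_pow, eval_add, eval_X, eval_C]
      field_simp
      linear_combination (P.eval (x : ℂ) * h x - Q.eval (x : ℂ) * g x) * h2)
    (ae_of_all _ fun x => by simp)
  refine ⟨r, hr, ?_⟩
  filter_upwards [hur, hf.1.coeFn_toLp] with x h1 h2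
  rw [h2, ← h1]

/-! ### Domain and range of `M₊(κ)` -/

lemma mem_mulHardy_iff (r : ℝ → ℂ) (f : ℝ →ₘ[volume] ℂ) :
    f ∈ mulHardy r ↔ ∃ k, InHardyPlus k ∧ f =ᵐ[volume] fun x => r x * k x := by
  constructor
  · rintro ⟨k, hk⟩
    exact ⟨_, inHardyPlus_coe k, hk⟩
  · rintro ⟨k, hk, hfk⟩
    obtain ⟨k', hk'⟩ := hk.exists_eq
    refine ⟨k', ?_⟩
    filter_upwards [hfk, hk'] with x h1 h2
    rw [h1, h2]

lemma asFunctions_domain {P Q : ℂ[X]} (hQ : Q ≠ 0) (hPQ : IsCoprime P Q) :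
    asFunctions (mPlus (ratFun P Q)).domain =
      mulHardy (ratFun (partReal Q) ((X + C Complex.I) ^ poleExp P Q)) := by
  refine asFunctions_eq (fun h => ?_) (fun f hf => ?_)
  · rw [mem_mulHardy_iff, ← memLp_ratFun_mul_iff hQ hPQ]
    exact ⟨fun H => ⟨inHardyPlus_coe h, H⟩, fun H => H.2⟩
  · rw [mem_mulHardy_iff, ← memLp_ratFun_mul_iff hQ hPQ] at hf
    exact hf.1

lemma memLp_ratFun_reducedDenom_mul {P Q : ℂ[X]} (hQ : Q ≠ 0) {k : ℝ → ℂ}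
    (hk : MemLp k 2 volume) : MemLp (fun x => ratFun P (reducedDenom P Q) x * k x) 2 volume := by
  refine (memLp_mul_ratFun (p := P) (reducedDenom_ne_zero P hQ) (reducedDenom_im_ne_zero P hQ)
    (by rw [natDegree_reducedDenom P hQ]; omega) hk).ae_eq (ae_of_all _ fun x => mul_comm _ _)

/-- The exponent `ς` makes the multiplier of the range bounded. -/
lemma mulHardy_reducedDenom_subset {P Q : ℂ[X]} (hQ : Q ≠ 0) :
    mulHardy (ratFun P (reducedDenom P Q)) ⊆ {f | f ∈ Lp ℂ 2 (volume : Measure ℝ)} := by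
  intro f hf
  obtain ⟨k, hk, hfk⟩ := (mem_mulHardy_iff _ _).1 hf
  exact Lp.mem_Lp_iff_memLp.2 ((memLp_ratFun_reducedDenom_mul hQ hk.1).ae_eq hfk.symm)

lemma mem_range_mPlus_iff {P Q : ℂ[X]} (hQ : Q ≠ 0) (hPQ : IsCoprime P Q) (g : hardyPlus) :
    g ∈ range (mPlus (ratFun P Q)) ↔ ∃ k, InHardyPlus k ∧
      InHardyMinus (fun x => ratFun P (reducedDenom P Q) x * k x - (g : L2R) x) := by
  rw [mem_range_iff]
  constructor
  · rintro ⟨h, hh⟩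
    rw [mem_graph_mPlus_iff] at hh
    have hm : MemLp (fun x => ratFun P Q x * (h : L2R) x) 2 volume := by
      refine (hh.1.add (Lp.memLp (g : L2R))).ae_eq (ae_of_all _ fun x => ?_)
      simp
    obtain ⟨k, hk, hhk⟩ := (memLp_ratFun_mul_iff hQ hPQ _).1 ⟨inHardyPlus_coe h, hm⟩
    refine ⟨k, hk, hh.congr ?_⟩
    filter_upwards [ratFun_mul_domain hQ hhk] with x hx
    rw [hx]
  · rintro ⟨k, hk, hkg⟩
    obtain ⟨h, hh⟩ := ((memLp_ratFun_mul_iff hQ hPQ _).2 ⟨k, hk, ae_eq_refl _⟩).1.exists_eq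
    refine ⟨h, (mem_graph_mPlus_iff _ _ _).2 (hkg.congr ?_)⟩
    filter_upwards [ratFun_mul_domain hQ hh] with x hx
    rw [hx]

lemma range_mPlus {P Q : ℂ[X]} (hQ : Q ≠ 0) (hPQ : IsCoprime P Q) :
    (range (mPlus (ratFun P Q)) : Set hardyPlus) =
      hardyProj '' {f : L2R | (f : ℝ →ₘ[volume] ℂ) ∈ mulHardy (ratFun P (reducedDenom P Q))} := by
  ext g
  rw [SetLike.mem_coe, mem_range_mPlus_iff hQ hPQ]
  constructor
  · rintro ⟨k, hk, hkg⟩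
    have hm := memLp_ratFun_reducedDenom_mul (P := P) hQ hk.1
    refine ⟨hm.toLp _, (mem_mulHardy_iff _ _).2 ⟨k, hk, hm.coeFn_toLp⟩, ?_⟩
    rw [hardyProj_eq_iff, mem_hardyPlus_orthogonal_iff]
    refine hkg.congr ?_
    filter_upwards [hm.coeFn_toLp, Lp.coeFn_sub (hm.toLp _) (g : L2R)] with x h1 h2
    rw [h2, Pi.sub_apply, h1]
  · rintro ⟨f, hf, hfg⟩
    obtain ⟨k, hk, hfk⟩ := (mem_mulHardy_iff _ _).1 hf
    rw [hardyProj_eq_iff, mem_hardyPlus_orthogonal_iff] at hfg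
    refine ⟨k, hk, hfg.congr ?_⟩
    filter_upwards [hfk, Lp.coeFn_sub f (g : L2R)] with x h1 h2
    rw [h2, Pi.sub_apply, ← h1]

/-! ### Kernel and deficiency space -/

lemma mul_C_mul_ne_zero {P p : ℂ[X]} (hP : P ≠ 0) (hp : p ≠ 0) : C P.leadingCoeff * p ≠ 0 :=
  mul_ne_zero (C_ne_zero.2 (leadingCoeff_ne_zero.2 hP)) hp

lemma eval_C_leadingCoeff_mul {P p : ℂ[X]} (hP : P ≠ 0) {z : ℂ}
    (h : (C P.leadingCoeff * p).eval z = 0) : p.eval z = 0 := by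
  rw [eval_mul, eval_C] at h
  exact (mul_eq_zero.1 h).resolve_left (leadingCoeff_ne_zero.2 hP)

/-- `h` belongs to the kernel if and only if `κ h` belongs to the Hardy space of the lower
half-plane, which is a homogeneous Riemann-Hilbert problem. -/
lemma asFunctions_kernel {P Q : ℂ[X]} (hP : P ≠ 0) (hQ : Q ≠ 0) (hPQ : IsCoprime P Q) :
    asFunctions (kernel (mPlus (ratFun P Q))) = mulPoly (ratFun (partLE Q) (partLT P))
      (min (((partLT P).natDegree : ℤ) - (partLE Q).natDegree)
        (((partGT Q).natDegree : ℤ) - (partGE P).natDegree)) := by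
  have hP1 : partLT P * (C P.leadingCoeff * partGE P) = P := by
    conv_rhs => rw [← partLT_mul_partGE P]
    ring
  have hQ1 : partLE Q * (C Q.leadingCoeff * partGT Q) = Q := by
    conv_rhs => rw [← partLE_mul_partGT Q]
    ring
  have key := inHardyMinus_ratFun_mul_iff (a₁ := partLT P) (a₂ := C P.leadingCoeff * partGE P)
    (b₁ := partLE Q) (b₂ := C Q.leadingCoeff * partGT Q) (partLT_ne_zero P)
    (mul_C_mul_ne_zero hP (partGE_ne_zero P)) (partLE_ne_zero Q)
    (mul_C_mul_ne_zero hQ (partGT_ne_zero Q)) (fun z hz => (zerosPart_zero hz).1)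
    (fun z hz => (zerosPart_zero (eval_C_leadingCoeff_mul hP hz)).1)
    (fun z hz => (zerosPart_zero hz).1)
    (fun z hz => (zerosPart_zero (eval_C_leadingCoeff_mul hQ hz)).1)
    (fun x hx hx' => isCoprime_eval_ne_zero hPQ
      (zerosPart_zero (eval_C_leadingCoeff_mul hP hx')).2 (zerosPart_zero hx).2)
  rw [hP1, hQ1, natDegree_C_mul (leadingCoeff_ne_zero.2 hP),
    natDegree_C_mul (leadingCoeff_ne_zero.2 hQ)] at key
  have hiff : ∀ f : ℝ →ₘ[volume] ℂ, f ∈ mulPoly (ratFun (partLE Q) (partLT P))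
      (min (((partLT P).natDegree : ℤ) - (partLE Q).natDegree)
        (((partGT Q).natDegree : ℤ) - (partGE P).natDegree)) ↔
      InHardyPlus f ∧ InHardyMinus (fun x => ratFun P Q x * f x) := fun f => by
    rw [key]
    refine exists_congr fun r => and_congr_left' (or_congr_right ?_)
    rw [lt_min_iff]
    omega
  refine asFunctions_eq (fun h => ?_) (fun f hf => ((hiff f).1 hf).1)
  rw [hiff, SetLike.mem_coe, mem_kernel_iff, mem_graph_mPlus_iff]
  have h0 : (fun x => ratFun P Q x * (h : L2R) x - ((0 : hardyPlus) : L2R) x) =ᵐ[volume]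
      fun x => ratFun P Q x * (h : L2R) x := by
    filter_upwards [Lp.coeFn_zero ℂ 2 (volume : Measure ℝ)] with x hx
    rw [ZeroMemClass.coe_zero, hx, Pi.zero_apply, sub_zero]
  exact ⟨fun H => ⟨inHardyPlus_coe h, H.congr h0⟩, fun H => H.2.congr h0.symm⟩

lemma inner_hardyProj (f : L2R) (h : hardyPlus) : inner ℂ (hardyProj f) h = inner ℂ f (h : L2R) :=
  Submodule.inner_orthogonalProjectionOnto_eq_of_mem_right (K := hardyPlus) h f

/-- The adjoint of the multiplication by a bounded rational function is the multiplication by its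
complex conjugate. -/
lemma inner_mul_eq_inner_conj_mul {p d : ℂ[X]} {u v : L2R} {k h : L2R}
    (hu : u =ᵐ[volume] fun x => ratFun p d x * k x)
    (hv : v =ᵐ[volume] fun x => ratFun (conjPoly p) (conjPoly d) x * h x) :
    inner ℂ u h = inner ℂ k v := by
  rw [L2.inner_def, L2.inner_def]
  refine integral_congr_ae ?_
  filter_upwards [hu, hv] with x h1 h2
  simp only [RCLike.inner_apply, h1, h2, map_mul, conj_ratFun]
  ring

/-- By the description of the range, its orthogonal complement consists of the functions which the
complex conjugate of the bounded multiplier of the range maps to the Hardy space of the lower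
half-plane. -/
lemma mem_range_mPlus_orthogonal_iff {P Q : ℂ[X]} (hQ : Q ≠ 0) (hPQ : IsCoprime P Q)
    (h : hardyPlus) : h ∈ (range (mPlus (ratFun P Q)))ᗮ ↔ InHardyMinus
      (fun x => ratFun (conjPoly P) (conjPoly (reducedDenom P Q)) x * (h : L2R) x) := by
  have hm : MemLp (fun x =>
      ratFun (conjPoly P) (conjPoly (reducedDenom P Q)) x * (h : L2R) x) 2 volume := by
    refine (memLp_conj (memLp_ratFun_reducedDenom_mul (P := P) hQ
      (memLp_conj (Lp.memLp (h : L2R))))).ae_eq (ae_of_all _ fun x => ?_)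
    simp [conj_ratFun]
  have hset : ∀ g, g ∈ range (mPlus (ratFun P Q)) ↔ g ∈ hardyProj '' {f : L2R |
      (f : ℝ →ₘ[volume] ℂ) ∈ mulHardy (ratFun P (reducedDenom P Q))} := fun g => by
    rw [← range_mPlus hQ hPQ]; rfl
  rw [← inHardyMinus_toLp hm]
  constructor
  · intro H k hk
    have hk' := memLp_ratFun_reducedDenom_mul (P := P) hQ (Lp.memLp k)
    have h1 := H (hardyProj (hk'.toLp _)) ((hset _).2 ⟨_, ⟨⟨k, hk⟩, hk'.coeFn_toLp⟩, rfl⟩)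
    rw [inner_hardyProj, inner_mul_eq_inner_conj_mul hk'.coeFn_toLp hm.coeFn_toLp] at h1
    exact h1
  · intro H g hg
    obtain ⟨f, ⟨k, hfk⟩, rfl⟩ := (hset g).1 hg
    rw [inner_hardyProj, inner_mul_eq_inner_conj_mul hfk hm.coeFn_toLp]
    exact H k k.2

lemma conjPoly_mul (p d : ℂ[X]) : conjPoly (p * d) = conjPoly p * conjPoly d :=
  Polynomial.map_mul _

lemma leadingCoeff_conjPoly (p : ℂ[X]) :
    (conjPoly p).leadingCoeff = starRingEnd ℂ p.leadingCoeff := by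
  rw [conjPoly, leadingCoeff_map_of_injective (starRingEnd ℂ).injective]

lemma conjPoly_reducedDenom (P Q : ℂ[X]) : conjPoly (reducedDenom P Q) =
    partLT (conjPoly Q) * (C (conjPoly Q).leadingCoeff *
      (partGT (conjPoly Q) * (X - C Complex.I) ^ poleExp P Q)) := by
  have h1 : conjPoly (X + C Complex.I) = X - C Complex.I := by
    simp [conjPoly, sub_eq_add_neg]
  have h2 : conjPoly (C Q.leadingCoeff) = C (conjPoly Q).leadingCoeff := by
    rw [leadingCoeff_conjPoly, conjPoly, map_C]
  rw [reducedDenom, conjPoly_mul, conjPoly_mul, conjPoly_mul, conjPoly_partGT, conjPoly_partLT, h2]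
  rw [show conjPoly ((X + C Complex.I) ^ poleExp P Q) = (X - C Complex.I) ^ poleExp P Q by
    rw [← h1]; exact Polynomial.map_pow _ _]
  ring

/-- The deficiency space solves a homogeneous Riemann-Hilbert problem with the conjugate
coefficient. -/
lemma asFunctions_range_orthogonal {P Q : ℂ[X]} (hP : P ≠ 0) (hQ : Q ≠ 0) (hPQ : IsCoprime P Q) :
    asFunctions ((range (mPlus (ratFun P Q)))ᗮ : Submodule ℂ hardyPlus) =
      mulPoly (ratFun (partLT (conjPoly Q)) (partLT (conjPoly P)))
        (((partGT P).natDegree : ℤ) - (partGT Q).natDegree) := by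
  have hP' := conjPoly_ne_zero hP
  have hQ' := conjPoly_ne_zero hQ
  have hP1 : partLT (conjPoly P) * (C (conjPoly P).leadingCoeff * partGE (conjPoly P))
      = conjPoly P := by
    conv_rhs => rw [← partLT_mul_partGE (conjPoly P)]
    ring
  have key := inHardyMinus_ratFun_mul_iff (a₁ := partLT (conjPoly P))
    (a₂ := C (conjPoly P).leadingCoeff * partGE (conjPoly P))
    (b₁ := partLT (conjPoly Q)) (b₂ := C (conjPoly Q).leadingCoeff *
      (partGT (conjPoly Q) * (X - C Complex.I) ^ poleExp P Q)) (partLT_ne_zero _)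
    (mul_C_mul_ne_zero hP' (partGE_ne_zero _)) (partLT_ne_zero _)
    (mul_C_mul_ne_zero hQ' (mul_ne_zero (partGT_ne_zero _) (X_sub_C_pow_ne_zero _ _)))
    (fun z hz => (zerosPart_zero hz).1)
    (fun z hz => (zerosPart_zero (eval_C_leadingCoeff_mul hP' hz)).1)
    (fun z hz => (zerosPart_zero hz).1.le)
    (fun z hz => by
      have h := eval_C_leadingCoeff_mul hQ' hz
      rw [eval_mul, mul_eq_zero] at h
      exact h.elim (fun h => (zerosPart_zero h).1) (X_sub_C_I_pow_im_pos _ z))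
    (fun x hx => absurd (zerosPart_zero hx).1 (by simp))
  rw [hP1, ← conjPoly_reducedDenom, natDegree_C_mul (leadingCoeff_ne_zero.2 hP'),
    natDegree_C_mul (leadingCoeff_ne_zero.2 hQ'),
    natDegree_mul (partGT_ne_zero _) (X_sub_C_pow_ne_zero _ _), natDegree_X_sub_C_pow,
    ← conjPoly_partGT, ← conjPoly_partGT, ← conjPoly_partLT, natDegree_conjPoly,
    natDegree_conjPoly, natDegree_conjPoly] at key
  have hd1 := natDegree_nonreal hQ
  have hd2 := natDegree_partLT_add_partGE hP'
  rw [natDegree_conjPoly, ← conjPoly_partGT, natDegree_conjPoly] at hd2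
  have hd3 := poleExp_add (P := P) hQ
  have hiff : ∀ f : ℝ →ₘ[volume] ℂ, f ∈ mulPoly
      (ratFun (partLT (conjPoly Q)) (partLT (conjPoly P)))
        (((partGT P).natDegree : ℤ) - (partGT Q).natDegree) ↔ InHardyPlus f ∧
      InHardyMinus (fun x => ratFun (conjPoly P) (conjPoly (reducedDenom P Q)) x * f x) :=
    fun f => by
      rw [key, conjPoly_partGT, conjPoly_partGT]
      -- the bound on the degree that comes from the lower half-plane is implied by the other one,
      -- by the choice of `ς`
      refine exists_congr fun r => and_congr_left' (or_congr_right ?_)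
      omega
  refine asFunctions_eq (fun h => ?_) (fun f hf => ((hiff f).1 hf).1)
  rw [hiff, SetLike.mem_coe, mem_range_mPlus_orthogonal_iff hQ hPQ]
  exact ⟨fun H => ⟨inHardyPlus_coe h, H⟩, fun H => H.2⟩

lemma finiteDimensional_kernel_mPlus {P Q : ℂ[X]} (hP : P ≠ 0) (hQ : Q ≠ 0)
    (hPQ : IsCoprime P Q) : FiniteDimensional ℂ (kernel (mPlus (ratFun P Q))) :=
  finiteDimensional_of_mulPoly _ (measurable_ratFun _ _) _ (asFunctions_kernel hP hQ hPQ).subset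

lemma finiteDimensional_range_orthogonal {P Q : ℂ[X]} (hP : P ≠ 0) (hQ : Q ≠ 0)
    (hPQ : IsCoprime P Q) :
    FiniteDimensional ℂ ((range (mPlus (ratFun P Q)))ᗮ : Submodule ℂ hardyPlus) :=
  finiteDimensional_of_mulPoly _ (measurable_ratFun _ _) _
    (asFunctions_range_orthogonal hP hQ hPQ).subset

/-! ### Density of the domain and closedness -/

/-- The domain is dense: with `q` the factor of `Q` that has the real zeros, and polynomials `D n`
without real zeros which tend to `q` and dominate it, `q k / D n` belongs to the domain for every
`k` in the Hardy space and tends to `k`. -/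
lemma dense_domain_mPlus {P Q : ℂ[X]} (hQ : Q ≠ 0) :
    Dense ((mPlus (ratFun P Q)).domain : Set hardyPlus) := by
  rw [Submodule.dense_iff_topologicalClosure_eq_top, Submodule.topologicalClosure_eq_top_iff,
    eq_bot_iff]
  intro k hk
  obtain ⟨D, hD0, hD, hDd, hDle, hDlim⟩ := exists_approx (partReal_ne_zero Q)
    (fun z hz => (zerosPart_zero hz).1.le) P.natDegree
  have hDx : ∀ n (x : ℝ), (D n).eval (x : ℂ) ≠ 0 := fun n =>
    eval_ofReal_ne_zero fun z hz => (hD n z hz).ne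
  have hn : ∀ n, ∫ x : ℝ, inner ℂ ((k : L2R) x * ratFun (partReal Q) (D n) x) ((k : L2R) x)
      = 0 := by
    intro n
    obtain ⟨h, hh⟩ := ((inHardyPlus_coe k).mul_ratFun (p := partReal Q) (hD0 n) (hD n)
      (by rw [hDd]; omega)).exists_eq
    have hdom : h ∈ (mPlus (ratFun P Q)).domain := by
      rw [mem_domain_mPlus]
      refine (memLp_mul_ratFun (p := P)
        (d := (C Q.leadingCoeff * partGT Q * partLT Q) * D n)
        (mul_ne_zero (nonreal_ne_zero hQ) (hD0 n)) (fun z hz => ?_) ?_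
        (Lp.memLp (k : L2R))).ae_eq ?_
      · rw [eval_mul, mul_eq_zero] at hz
        exact hz.elim (nonreal_im_ne_zero hQ z) fun h => (hD n z h).ne
      · rw [natDegree_mul (nonreal_ne_zero hQ) (hD0 n), hDd]
        omega
      · filter_upwards [hh, ae_eval_ne_zero (partReal_ne_zero Q)] with x hx hx0
        have h1 := hDx n x
        have h2 := eval_nonreal_mul_partReal Q x
        have h3 := eval_ofReal_ne_zero (nonreal_im_ne_zero hQ) x
        rw [hx, ratFun, ratFun, ratFun, eval_mul (q := D n), ← h2]
        field_simp
    have h0 := hk h hdom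
    rw [Submodule.coe_inner, L2.inner_def] at h0
    rw [← h0]
    refine integral_congr_ae ?_
    filter_upwards [hh] with x hx
    rw [hx]
  have hlim := tendsto_integral_of_dominated_convergence (μ := volume)
    (F := fun n x => inner ℂ ((k : L2R) x * ratFun (partReal Q) (D n) x) ((k : L2R) x))
    (f := fun x => inner ℂ ((k : L2R) x) ((k : L2R) x)) (fun x => ‖(k : L2R) x‖ ^ 2)
    (fun n => ((Lp.aestronglyMeasurable _).mul
      (measurable_ratFun _ _).aestronglyMeasurable).inner (Lp.aestronglyMeasurable _))
    ((memLp_two_iff_integrable_sq_norm (Lp.aestronglyMeasurable _)).1 (Lp.memLp _))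
    (fun n => ae_of_all _ fun x => by
      refine (norm_inner_le_norm _ _).trans ?_
      rw [norm_mul, sq]
      refine mul_le_mul_of_nonneg_right (mul_le_of_le_one_right (norm_nonneg _) ?_) (norm_nonneg _)
      rw [ratFun, norm_div, div_le_one (norm_pos_iff.2 (hDx n x))]
      exact hDle n x)
    (by
      filter_upwards [ae_eval_ne_zero (partReal_ne_zero Q)] with x hx
      have h1 : Filter.Tendsto (fun n => (k : L2R) x * ratFun (partReal Q) (D n) x) Filter.atTop
          (nhds ((k : L2R) x * ((partReal Q).eval (x : ℂ) / (partReal Q).eval (x : ℂ)))) :=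
        tendsto_const_nhds.mul (tendsto_const_nhds.div (hDlim x) hx)
      rw [div_self hx, mul_one] at h1
      exact h1.inner tendsto_const_nhds)
  simp_rw [hn] at hlim
  have h0 := tendsto_nhds_unique hlim tendsto_const_nhds
  rw [← L2.inner_def, inner_self_eq_zero] at h0
  exact (Submodule.mem_bot ℂ).2 (Subtype.ext h0)

/-- The graph of the multiplication operator `M(P / Q)` over the Hardy space, in the form
`P h = Q k`, with both sides divided by a power of `x + i` to make the multipliers bounded. -/
noncomputable def mulGraph (P Q : ℂ[X]) : Submodule ℂ (L2R × L2R) :=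
  hardyPlus.prod ⊤ ⊓ LinearMap.ker
    ((mulRat P ((X + C Complex.I) ^ max P.natDegree Q.natDegree) (X_add_C_pow_ne_zero _ _)
        (fun z hz => (X_add_C_I_pow_im_neg _ z hz).ne)
        (by rw [natDegree_X_add_C_pow]; omega) ∘L ContinuousLinearMap.fst ℂ L2R L2R -
      mulRat Q ((X + C Complex.I) ^ max P.natDegree Q.natDegree) (X_add_C_pow_ne_zero _ _)
        (fun z hz => (X_add_C_I_pow_im_neg _ z hz).ne)
        (by rw [natDegree_X_add_C_pow]; omega) ∘L ContinuousLinearMap.snd ℂ L2R L2R :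
          L2R × L2R →L[ℂ] L2R) : L2R × L2R →ₗ[ℂ] L2R)

lemma isClosed_hardyPlus : IsClosed (hardyPlus : Set L2R) :=
  (completeSpace_coe_iff_isComplete.1
    (inferInstanceAs (CompleteSpace hardyPlus))).isClosed

lemma isClosed_mulGraph (P Q : ℂ[X]) : IsClosed (mulGraph P Q : Set (L2R × L2R)) := by
  refine IsClosed.inter ?_ (ContinuousLinearMap.isClosed_ker _)
  rw [Submodule.prod_coe]
  exact isClosed_hardyPlus.prod isClosed_univ

lemma mem_mulGraph_iff {P Q : ℂ[X]} (hQ : Q ≠ 0) (h k : L2R) : (h, k) ∈ mulGraph P Q ↔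
    h ∈ hardyPlus ∧ k =ᵐ[volume] fun x => ratFun P Q x * h x := by
  rw [mulGraph, Submodule.mem_inf, Submodule.mem_prod]
  simp only [Submodule.mem_top, and_true]
  refine and_congr_right' ?_
  rw [LinearMap.mem_ker, ContinuousLinearMap.coe_coe, _root_.sub_apply, sub_eq_zero,
    ContinuousLinearMap.comp_apply, ContinuousLinearMap.comp_apply, Lp.ext_iff]
  set N := max P.natDegree Q.natDegree
  have h0 : ((X + C Complex.I) ^ N : ℂ[X]) ≠ 0 := X_add_C_pow_ne_zero _ _
  have h1 := fun z hz => (X_add_C_I_pow_im_neg N z hz).ne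
  have hP := mulRat_coeFn (p := P) h0 h1 (by rw [natDegree_X_add_C_pow]; omega) h
  have hQ' := mulRat_coeFn (p := Q) h0 h1 (by rw [natDegree_X_add_C_pow]; omega) k
  constructor
  · intro H
    filter_upwards [H, hP, hQ', ae_eval_ne_zero hQ] with x e1 e2 e3 hx
    have hx1 := eval_ofReal_ne_zero h1 x
    have e4 := (e2.symm.trans e1).trans e3
    rw [ratFun, ratFun] at e4
    rw [ratFun]
    field_simp at e4 ⊢
    linear_combination -e4
  · intro H
    filter_upwards [H, hP, hQ', ae_eval_ne_zero hQ] with x e1 e2 e3 hx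
    have hx1 := eval_ofReal_ne_zero h1 x
    refine e2.trans (Eq.trans ?_ e3.symm)
    rw [e1, ratFun, ratFun, ratFun]
    field_simp

/-- The graph of `M₊(κ)` differs from the closed graph of `M(κ)` over the Hardy space by a space of
finite dimension only. -/
lemma mem_graph_mPlus_iff_mem_sup {P Q : ℂ[X]} (hQ : Q ≠ 0) (h g : hardyPlus) :
    (h, g) ∈ (mPlus (ratFun P Q)).graph ↔ ((h : L2R), (g : L2R)) ∈ mulGraph P Q ⊔
      (⊥ : Submodule ℂ L2R).prod (remainderSpace (partGE Q) (max P.natDegree Q.natDegree)) := by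
  rw [mem_graph_mPlus_iff, Submodule.mem_sup]
  constructor
  · intro H
    have hr := toLp_mem_remainderSpace hQ (inHardyPlus_coe h) (inHardyPlus_coe g) H
    refine ⟨((h : L2R), (g : L2R) + H.1.toLp _), (mem_mulGraph_iff hQ _ _).2 ⟨h.2, ?_⟩,
      (0, -H.1.toLp _), ⟨Submodule.zero_mem _, Submodule.neg_mem _ hr⟩, by simp⟩
    filter_upwards [Lp.coeFn_add (g : L2R) (H.1.toLp _), H.1.coeFn_toLp] with x h1 h2
    rw [h1, Pi.add_apply, h2]
    ring
  · rintro ⟨⟨h', k⟩, hk, ⟨z, f⟩, ⟨hz, hf⟩, he⟩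
    obtain ⟨hh', hk⟩ := (mem_mulGraph_iff hQ _ _).1 hk
    obtain rfl : z = 0 := hz
    simp only [Prod.mk_add_mk, Prod.mk.injEq, add_zero] at he
    obtain ⟨rfl, he⟩ := he
    refine (((mem_hardyPlus_orthogonal_iff f).1 hf.1).const_mul (-1)).congr ?_
    rw [← he]
    filter_upwards [Lp.coeFn_add k f, hk] with x h1 h2
    rw [h1, Pi.add_apply, h2]
    ring

lemma isClosed_mPlus {P Q : ℂ[X]} (hQ : Q ≠ 0) : (mPlus (ratFun P Q)).IsClosed := by
  have hfin := finiteDimensional_remainderSpace (partGE_ne_zero Q) (max P.natDegree Q.natDegree)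
  have hfin' : FiniteDimensional ℂ ((⊥ : Submodule ℂ L2R).prod
      (remainderSpace (partGE Q) (max P.natDegree Q.natDegree))) := by
    rw [← Submodule.map_inr]; infer_instance
  have hcl := Submodule.isClosed_sup_finiteDimensional (mulGraph P Q)
    ((⊥ : Submodule ℂ L2R).prod (remainderSpace (partGE Q) (max P.natDegree Q.natDegree)))
    (isClosed_mulGraph P Q)
  have hc : Continuous fun p : hardyPlus × hardyPlus => ((p.1 : L2R), (p.2 : L2R)) := by fun_prop
  have := hcl.preimage hc
  change _root_.IsClosed ((mPlus (ratFun P Q)).graph : Set (hardyPlus × hardyPlus))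
  convert this using 1
  ext ⟨h, g⟩
  exact mem_graph_mPlus_iff_mem_sup hQ h g

/-! ### The Fredholm property -/

/-- If `1 / κ` is bounded, the range of `M₊(κ)` is closed, since `M(κ)` maps onto the closed space
of the functions `k` with `k / κ` in the Hardy space. -/
lemma isClosed_range_mPlus {P Q : ℂ[X]} (hP : P ≠ 0) (hQ : Q ≠ 0)
    (hdeg : Q.natDegree ≤ P.natDegree) (hreal : ∀ x : ℝ, P.eval (x : ℂ) ≠ 0) :
    IsClosed (range (mPlus (ratFun P Q)) : Set hardyPlus) := by
  have hPim : ∀ z, P.eval z = 0 → z.im ≠ 0 := fun z hz hz0 => hreal z.re (by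
    rwa [show ((z.re : ℝ) : ℂ) = z by apply Complex.ext <;> simp [hz0]])
  -- the functions `k` with `k / κ` in the Hardy space
  set K : Submodule ℂ L2R := hardyPlus.comap (mulRat Q P hP hPim hdeg : L2R →ₗ[ℂ] L2R) with hK
  have hKcl : IsClosed (K : Set L2R) :=
    isClosed_hardyPlus.preimage (mulRat Q P hP hPim hdeg).continuous
  have hfin := finiteDimensional_remainderSpace (partGE_ne_zero Q) (max P.natDegree Q.natDegree)
  have hcl := (Submodule.isClosed_sup_finiteDimensional K
    (remainderSpace (partGE Q) (max P.natDegree Q.natDegree)) hKcl).preimage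
      (continuous_subtype_val (p := fun f => f ∈ hardyPlus))
  convert hcl using 1
  ext g
  rw [SetLike.mem_coe, mem_range_iff, Set.mem_preimage, SetLike.mem_coe, Submodule.mem_sup]
  have hQ0 := ae_eval_ne_zero hQ
  constructor
  · rintro ⟨h, H⟩
    rw [mem_graph_mPlus_iff] at H
    have hr := toLp_mem_remainderSpace hQ (inHardyPlus_coe h) (inHardyPlus_coe g) H
    refine ⟨(g : L2R) + H.1.toLp _, ?_, -H.1.toLp _, Submodule.neg_mem _ hr, by simp⟩
    change mulRat Q P hP hPim hdeg _ ∈ hardyPlus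
    rw [mem_hardyPlus_iff]
    refine (inHardyPlus_coe h).congr ?_
    filter_upwards [mulRat_coeFn hP hPim hdeg ((g : L2R) + H.1.toLp _), H.1.coeFn_toLp,
      Lp.coeFn_add (g : L2R) (H.1.toLp _), hQ0] with x h1 h2 h3 h4
    have h5 := hreal x
    rw [h1, h3, Pi.add_apply, h2, ratFun, ratFun]
    field_simp
    ring
  · rintro ⟨k, hk, f, hf, hkf⟩
    refine ⟨⟨_, hk⟩, ?_⟩
    rw [mem_graph_mPlus_iff]
    refine (((mem_hardyPlus_orthogonal_iff f).1 hf.1).const_mul (-1)).congr ?_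
    rw [← hkf]
    filter_upwards [mulRat_coeFn hP hPim hdeg k, Lp.coeFn_add k f, hQ0] with x h1 h2 h3
    have h5 := hreal x
    change _ = ratFun P Q x * (mulRat Q P hP hPim hdeg k : ℝ → ℂ) x - _
    rw [h1, h2, Pi.add_apply, ratFun, ratFun]
    field_simp
    ring

/-- If `1 / κ` is bounded, `M₊(κ)` is a Fredholm operator. -/
lemma isFredholmOp_mPlus {P Q : ℂ[X]} (hP : P ≠ 0) (hQ : Q ≠ 0) (hPQ : IsCoprime P Q)
    (hdeg : Q.natDegree ≤ P.natDegree) (hreal : ∀ x : ℝ, P.eval (x : ℂ) ≠ 0) :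
    IsFredholmOp (mPlus (ratFun P Q)) := by
  have hcl := isClosed_range_mPlus hP hQ hdeg hreal
  refine ⟨dense_domain_mPlus hQ, isClosed_mPlus hQ, hcl, finiteDimensional_kernel_mPlus hP hQ hPQ,
    ?_⟩
  have : CompleteSpace (range (mPlus (ratFun P Q))) := hcl.completeSpace_coe
  have := finiteDimensional_range_orthogonal hP hQ hPQ
  exact (Submodule.quotientEquivOfIsCompl _ _
    (Submodule.isCompl_orthogonal
      (K := range (mPlus (ratFun P Q))))).symm.finiteDimensional

/-- Multiplication by `s / (x + i)` in the Hardy space, for a polynomial `s` of degree at most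
one. -/
noncomputable def mulLinear (s : ℂ[X]) (hs : s.natDegree ≤ 1) : hardyPlus →L[ℂ] hardyPlus :=
  (mulRat s ((X + C Complex.I) ^ 1) (X_add_C_pow_ne_zero _ _)
    (fun z hz => (X_add_C_I_pow_im_neg _ z hz).ne) (by rwa [natDegree_X_add_C_pow]) ∘L
      hardyPlus.subtypeL).codRestrict hardyPlus fun k => by
    rw [mem_hardyPlus_iff]
    have hd : s.natDegree ≤ ((X + C Complex.I) ^ 1 : ℂ[X]).natDegree := by
      rwa [natDegree_X_add_C_pow]
    exact ((inHardyPlus_coe k).mul_ratFun (X_add_C_pow_ne_zero _ _) (X_add_C_I_pow_im_neg 1)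
      hd).congr (mulRat_coeFn (X_add_C_pow_ne_zero _ _)
        (fun z hz => (X_add_C_I_pow_im_neg 1 z hz).ne) hd (k : L2R)).symm

lemma mulLinear_coeFn (s : ℂ[X]) (hs : s.natDegree ≤ 1) (k : hardyPlus) :
    ((mulLinear s hs k : L2R) : ℝ → ℂ) =ᵐ[volume]
      fun x => ratFun s ((X + C Complex.I) ^ 1) x * (k : L2R) x := by
  have h : ((mulLinear s hs k : L2R) : ℝ → ℂ) =ᵐ[volume]
      fun x => (k : L2R) x * ratFun s ((X + C Complex.I) ^ 1) x :=
    mulRat_coeFn (X_add_C_pow_ne_zero _ _) (fun z hz => (X_add_C_I_pow_im_neg 1 z hz).ne)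
      (by rwa [natDegree_X_add_C_pow]) (k : L2R)
  filter_upwards [h] with x hx
  rw [hx, mul_comm]

lemma ratFun_ne_zero_ae {p d : ℂ[X]} (hp : p ≠ 0) (hd : d ≠ 0) : ∀ᵐ x : ℝ, ratFun p d x ≠ 0 := by
  filter_upwards [ae_eval_ne_zero hp, ae_eval_ne_zero hd] with x h1 h2 using div_ne_zero h1 h2

lemma ker_mulLinear {s : ℂ[X]} (hs0 : s ≠ 0) (hs : s.natDegree ≤ 1) :
    LinearMap.ker (mulLinear s hs : hardyPlus →ₗ[ℂ] hardyPlus) = ⊥ := by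
  rw [LinearMap.ker_eq_bot']
  intro k hk
  have h := mulLinear_coeFn s hs k
  rw [ContinuousLinearMap.coe_coe] at hk
  rw [hk, ZeroMemClass.coe_zero] at h
  refine Subtype.ext (Lp.ext ?_)
  filter_upwards [h, Lp.coeFn_zero ℂ 2 (volume : Measure ℝ),
    ratFun_ne_zero_ae hs0 (X_add_C_pow_ne_zero Complex.I 1)] with x h1 h2 h3
  rw [h2, Pi.zero_apply] at h1
  rw [ZeroMemClass.coe_zero, h2]
  exact (mul_eq_zero.1 h1.symm).resolve_left h3

/-- A function in the Hardy space which is orthogonal to the multiples of `s / (x + i)`, where the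
zero of `s` is real, vanishes: `s / (x + i)` is an outer function. -/
lemma range_mulLinear_orthogonal {s : ℂ[X]} (hs0 : s ≠ 0) (hs : s.natDegree ≤ 1)
    (hreal : ∀ z, s.eval z = 0 → z.im = 0) :
    (LinearMap.range (mulLinear s hs : hardyPlus →ₗ[ℂ] hardyPlus))ᗮ = ⊥ := by
  rw [eq_bot_iff]
  intro h hh
  set d : ℂ[X] := (X + C Complex.I) ^ 1 with hd
  have hd0 : d ≠ 0 := X_add_C_pow_ne_zero _ _
  have hdim := X_add_C_I_pow_im_neg 1
  have hsd : s.natDegree ≤ d.natDegree := by rwa [hd, natDegree_X_add_C_pow]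
  have hm : MemLp (fun x => ratFun (conjPoly s) (conjPoly d) x * (h : L2R) x) 2 volume := by
    refine (memLp_conj (memLp_mul_ratFun hd0 (fun z hz => (hdim z hz).ne) hsd
      (memLp_conj (Lp.memLp (h : L2R))))).ae_eq (ae_of_all _ fun x => ?_)
    simp [conj_ratFun, mul_comm]
  have hminus : InHardyMinus (fun x => ratFun (1 * conjPoly s) (1 * conjPoly d) x *
      (h : L2R) x) := by
    rw [one_mul, one_mul, ← inHardyMinus_toLp hm]
    intro k hk
    rw [← inner_mul_eq_inner_conj_mul (mulLinear_coeFn s hs ⟨k, hk⟩) hm.coeFn_toLp]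
    exact hh _ ⟨⟨k, hk⟩, rfl⟩
  obtain ⟨r, hr, hhr⟩ := (inHardyMinus_ratFun_mul_iff one_ne_zero (conjPoly_ne_zero hs0)
    one_ne_zero (conjPoly_ne_zero hd0) (by simp)
    (fun z hz => by
      rw [conjPoly_eval, map_eq_zero] at hz
      have := hreal _ hz
      simp only [Complex.conj_im, neg_eq_zero] at this
      exact this.ge) (by simp)
    (fun z hz => by
      rw [conjPoly_eval, map_eq_zero] at hz
      simpa using hdim _ hz) (by simp) _).1 ⟨inHardyPlus_coe h, hminus⟩
  have hr0 : r = 0 := hr.resolve_right (by simp)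
  refine (Submodule.mem_bot ℂ).2 (Subtype.ext (Lp.ext ?_))
  filter_upwards [hhr, Lp.coeFn_zero ℂ 2 (volume : Measure ℝ)] with x h1 h2
  rw [h1, ZeroMemClass.coe_zero, h2, hr0]
  simp

/-- The multiples of `s / (x + i)`, where the zero of `s` is real or infinite, have infinite
codimension in the Hardy space: otherwise they would form a closed subspace, and a dense one, hence
would include `1 / (x + i)`, and `1 / s` would belong to the Hardy space. -/
lemma not_finiteDimensional_quotient_range_mulLinear {s : ℂ[X]} (hs0 : s ≠ 0)
    (hs : s.natDegree ≤ 1) (hreal : ∀ z, s.eval z = 0 → z.im = 0) (hconj : conjPoly s = s) :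
    ¬ FiniteDimensional ℂ
      (hardyPlus ⧸ LinearMap.range (mulLinear s hs : hardyPlus →ₗ[ℂ] hardyPlus)) := by
  intro hfin
  obtain ⟨G, hG⟩ := Submodule.exists_isCompl
    (LinearMap.range (mulLinear s hs : hardyPlus →ₗ[ℂ] hardyPlus))
  have hGfin : FiniteDimensional ℂ G :=
    (Submodule.quotientEquivOfIsCompl _ _ hG).finiteDimensional
  have hcl := (mulLinear s hs).closed_complemented_range_of_isCompl_of_ker_eq_bot G hG
    G.closed_of_finiteDimensional (ker_mulLinear hs0 hs)
  have : CompleteSpace (LinearMap.range (mulLinear s hs : hardyPlus →ₗ[ℂ] hardyPlus)) :=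
    hcl.completeSpace_coe
  have htop := Submodule.orthogonal_eq_bot_iff.1 (range_mulLinear_orthogonal hs0 hs hreal)
  obtain ⟨h, hh⟩ := (inHardyPlus_cauchy (b := -Complex.I) (by simp)).exists_eq
  obtain ⟨k, hk⟩ : h ∈ LinearMap.range (mulLinear s hs : hardyPlus →ₗ[ℂ] hardyPlus) := by
    rw [htop]; trivial
  rw [ContinuousLinearMap.coe_coe] at hk
  have hsk : ∀ᵐ x : ℝ, s.eval (x : ℂ) * (k : L2R) x = 1 := by
    have h1 := mulLinear_coeFn s hs k
    rw [hk] at h1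
    filter_upwards [h1, hh] with x h2 h3
    rw [h3, ratFun] at h2
    have h4 := ofReal_add_I_ne_zero x
    simp only [sub_neg_eq_add, eval_add, eval_X, eval_C, pow_one] at h2
    field_simp at h2
    exact h2.symm
  -- `k = 1 / s` is real, so that it belongs to the Hardy spaces of both half-planes
  have hk0 := ae_eq_zero_of_inHardyPlus_of_inHardyMinus (inHardyPlus_coe k)
    ((inHardyPlus_coe k).conj.congr (by
      filter_upwards [hsk] with x hx
      have h1 := congrArg (starRingEnd ℂ) hx
      rw [map_mul, map_one, ← conjPoly_eval_ofReal, hconj] at h1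
      have h2 : s.eval (x : ℂ) ≠ 0 := fun h => by rw [h, zero_mul] at hx; exact zero_ne_one hx
      exact mul_left_cancel₀ h2 (h1.trans hx.symm)))
  have hfalse : ∀ᵐ _ : ℝ, False := by
    filter_upwards [hsk, hk0] with x h1 h2
    rw [h2, Pi.zero_apply, mul_zero] at h1
    exact zero_ne_one h1
  exact hfalse.exists.elim fun _ h => h

/-- If `κ` vanishes at a real zero of `s`, or at infinity if `s` is constant, then the range of
`M₊(κ)` is not closed. Otherwise it would have finite codimension; as `κ h - M₊(κ) h` belongs to a
space of finite dimension, this would hold for the multiples of `s / (x + i)` in the Hardy space as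
well. -/
lemma not_isClosed_range_mPlus {P Q s P₁ : ℂ[X]} (hP : P ≠ 0) (hQ : Q ≠ 0) (hPQ : IsCoprime P Q)
    (hs0 : s ≠ 0) (hs : s.natDegree ≤ 1) (hreal : ∀ z, s.eval z = 0 → z.im = 0)
    (hconj : conjPoly s = s) (hPs : P = s * P₁)
    (hdeg : P₁.natDegree + 1 ≤ max P.natDegree Q.natDegree) :
    ¬ IsClosed (range (mPlus (ratFun P Q)) : Set hardyPlus) := by
  intro hcl
  refine not_finiteDimensional_quotient_range_mulLinear hs0 hs hreal hconj ?_
  have : CompleteSpace (range (mPlus (ratFun P Q))) := hcl.completeSpace_coe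
  have hDfin := finiteDimensional_range_orthogonal hP hQ hPQ
  have hFfin := finiteDimensional_remainderSpace (partGE_ne_zero Q) (max P.natDegree Q.natDegree)
  have hd0 := reducedDenom_ne_zero P hQ
  have hdim := reducedDenom_im_ne_zero P hQ
  have hdd := natDegree_reducedDenom P hQ
  -- `Y = κ (dom M₊(κ))`; the map `Ψ` from `H₊` to `L² / Y` has finite rank because the range of
  -- `M₊(κ)` has finite codimension and lies in `Y` up to remainders
  set Y : Submodule ℂ L2R := hardyPlus.map (mulRat P (reducedDenom P Q) hd0 hdim
    (by rw [hdd]; omega) : L2R →ₗ[ℂ] L2R) with hY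
  set E : Submodule ℂ L2R := remainderSpace (partGE Q) (max P.natDegree Q.natDegree) ⊔
    ((range (mPlus (ratFun P Q)))ᗮ).map hardyPlus.subtype with hE
  set Ψ : hardyPlus →ₗ[ℂ] L2R ⧸ Y := Y.mkQ ∘ₗ hardyPlus.subtype with hΨ
  have hrange : LinearMap.range Ψ ≤ E.map Y.mkQ := by
    rintro _ ⟨g, rfl⟩
    obtain ⟨y, hy, z, hz, rfl⟩ :=
      (range (mPlus (ratFun P Q))).exists_add_mem_mem_orthogonal g
    obtain ⟨h, hh⟩ := (mem_range_iff _ _).1 hy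
    rw [mem_graph_mPlus_iff] at hh
    have hr := toLp_mem_remainderSpace hQ (inHardyPlus_coe h) (inHardyPlus_coe y) hh
    have hm : MemLp (fun x => ratFun P Q x * (h : L2R) x) 2 volume := by
      refine (hh.1.add (Lp.memLp (y : L2R))).ae_eq (ae_of_all _ fun x => ?_)
      simp
    obtain ⟨k, hk, hhk⟩ := (memLp_ratFun_mul_iff hQ hPQ _).1 ⟨inHardyPlus_coe h, hm⟩
    obtain ⟨k', hk'⟩ := hk.exists_eq
    refine ⟨-hh.1.toLp _ + (z : L2R), Submodule.add_mem_sup (Submodule.neg_mem _ hr)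
      (Submodule.mem_map_of_mem hz), ?_⟩
    refine ((Submodule.Quotient.eq Y).2 ?_).symm
    refine ⟨k', k'.2, Lp.ext ?_⟩
    change (mulRat P (reducedDenom P Q) hd0 hdim _ (k' : L2R) : ℝ → ℂ) =ᵐ[volume]
      ((y + z : hardyPlus) - (-hh.1.toLp _ + (z : L2R)) : L2R)
    rw [show ((y + z : hardyPlus) - (-hh.1.toLp _ + (z : L2R)) : L2R)
      = (y : L2R) + hh.1.toLp _ by rw [Submodule.coe_add]; abel]
    filter_upwards [mulRat_coeFn hd0 hdim (p := P) (by rw [hdd]; omega) (k' : L2R),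
      Lp.coeFn_add (y : L2R) (hh.1.toLp _), hh.1.coeFn_toLp, ratFun_mul_domain hQ hhk, hk']
      with x h1 h2 h3 h4 h5
    rw [h1, h2, Pi.add_apply, h3, h4, h5]
    ring
  -- functions of the Hardy space in `Y` vanish where `κ` does, hence are multiples of `s / (x + i)`
  have hker : LinearMap.ker Ψ ≤
      LinearMap.range (mulLinear s hs : hardyPlus →ₗ[ℂ] hardyPlus) := by
    intro g hg
    have hgY : (g : L2R) ∈ Y := (Submodule.Quotient.mk_eq_zero Y).1 hg
    obtain ⟨k, hk, hkg⟩ := hgY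
    have hg' : (g : L2R) =ᵐ[volume] fun x => k x * ratFun P (reducedDenom P Q) x := by
      rw [← hkg]
      exact mulRat_coeFn hd0 hdim (by rw [hdd]; omega) k
    have hkL := memLp_mul_ratFun (p := (X + C Complex.I) ^ 1 * P₁) hd0 hdim
      (by rw [hdd]; refine natDegree_mul_le.trans ?_; rw [natDegree_X_add_C_pow]; omega)
      (Lp.memLp k)
    have hmul : ∀ᵐ x : ℝ, s.eval (x : ℂ) *
        (k x * ratFun ((X + C Complex.I) ^ 1 * P₁) (reducedDenom P Q) x) =
          ((X + C Complex.I) ^ 1 : ℂ[X]).eval (x : ℂ) * (g : L2R) x := by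
      filter_upwards [hg'] with x hx
      have hPx := congrArg (eval (x : ℂ)) hPs
      rw [eval_mul] at hPx
      rw [hx, ratFun, ratFun, hPx, eval_mul]
      ring
    obtain ⟨k', hk'⟩ := ((inHardyPlus_coe g).of_mul_eq hkL hs0
      (fun z hz => (hreal z hz).le) hmul).exists_eq
    refine ⟨k', Subtype.ext (Lp.ext ?_)⟩
    rw [ContinuousLinearMap.coe_coe]
    filter_upwards [mulLinear_coeFn s hs k', hk', hmul] with x h1 h2 h3
    have h4 := eval_ofReal_ne_zero (fun z hz => (X_add_C_I_pow_im_neg 1 z hz).ne) x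
    rw [h1, h2, ratFun, div_mul_eq_mul_div, h3, mul_div_cancel_left₀ _ h4]
  have hfin1 : FiniteDimensional ℂ (LinearMap.range Ψ) := Submodule.finiteDimensional_of_le hrange
  have hfin2 : FiniteDimensional ℂ (hardyPlus ⧸ LinearMap.ker Ψ) :=
    Ψ.quotKerEquivRange.symm.finiteDimensional
  exact Module.Finite.of_surjective (Submodule.factor hker) (Submodule.factor_surjective hker)

lemma conjPoly_X_sub_C_ofReal (a : ℝ) : conjPoly (X - C (a : ℂ)) = X - C (a : ℂ) := by
  simp [conjPoly]

/-- If the range of `M₊(κ)` is closed, then `κ` has no zeros on the real line or at infinity. -/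
lemma no_zeros_of_isClosed_range {P Q : ℂ[X]} (hP : P ≠ 0) (hQ : Q ≠ 0) (hPQ : IsCoprime P Q)
    (hcl : IsClosed (range (mPlus (ratFun P Q)) : Set hardyPlus)) :
    Q.natDegree ≤ P.natDegree ∧ ∀ x : ℝ, P.eval (x : ℂ) ≠ 0 := by
  constructor
  · by_contra! hlt
    refine not_isClosed_range_mPlus (s := 1) (P₁ := P) hP hQ hPQ one_ne_zero (by simp) (by simp)
      (by simp [conjPoly]) (one_mul P).symm (by omega) hcl
  · intro a ha
    obtain ⟨P₁, hP₁⟩ := dvd_iff_isRoot.2 ha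
    have hP₁0 : P₁ ≠ 0 := by rintro rfl; exact hP (by rw [hP₁, mul_zero])
    have hd : P.natDegree = 1 + P₁.natDegree := by
      rw [hP₁, natDegree_mul (X_sub_C_ne_zero _) hP₁0, natDegree_X_sub_C]
    refine not_isClosed_range_mPlus (s := X - C (a : ℂ)) (P₁ := P₁) hP hQ hPQ (X_sub_C_ne_zero _)
      (natDegree_X_sub_C_le _) (fun z hz => ?_) (conjPoly_X_sub_C_ofReal a) hP₁ (by omega) hcl
    rw [eval_sub, eval_X, eval_C, sub_eq_zero] at hz
    rw [hz, Complex.ofReal_im]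

/-- `κ` is bounded away from zero if and only if it has no zeros on the real line or at infinity. If
`|κ| ≥ ε`, then `1 / (κ (x + i))` is square integrable, which forces `deg Q ≤ deg P`. -/
lemma zero_notMem_closure_ratRange_iff {P Q : ℂ[X]} (hQ : Q ≠ 0) (hPQ : IsCoprime P Q) :
    (0 : ℂ) ∉ closure (ratRange P Q) ↔
      Q.natDegree ≤ P.natDegree ∧ ∀ x : ℝ, P.eval (x : ℂ) ≠ 0 := by
  rw [Metric.mem_closure_iff]
  push Not
  constructor
  · rintro ⟨ε, hε, h⟩
    have hε' : ∀ x : ℝ, Q.eval (x : ℂ) ≠ 0 → ε ≤ ‖ratFun P Q x‖ := fun x hx => by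
      have := h _ ⟨x, hx, rfl⟩
      rwa [dist_zero_left] at this
    have hPx : ∀ x : ℝ, P.eval (x : ℂ) ≠ 0 := fun x hx => by
      have h1 := hε' x (isCoprime_eval_ne_zero hPQ hx)
      rw [ratFun, hx, zero_div, norm_zero] at h1
      linarith
    refine ⟨?_, hPx⟩
    have hP0 : P ≠ 0 := by rintro rfl; exact hPx 0 (by simp)
    have hlt := natDegree_lt_of_memLp (p := Q) (d := P * (X + C Complex.I) ^ 1) hQ
      (fun z hz hz0 => by
        rw [eval_mul, mul_eq_zero] at hz
        refine hz.elim (fun hz => hPx z.re ?_) fun hz => (X_add_C_I_pow_im_neg 1 z hz).ne hz0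
        rwa [show ((z.re : ℝ) : ℂ) = z by apply Complex.ext <;> simp [hz0]])
      ((memLp_cauchy (a := -Complex.I) (by simp)).of_le_mul (c := ε⁻¹)
        (measurable_ratFun _ _).aestronglyMeasurable (ae_of_all _ fun x => by
          simp only [ratFun, eval_mul, eval_add, eval_X, eval_C, pow_one, sub_neg_eq_add]
          rw [← div_div, div_eq_mul_one_div (_ / _), norm_mul]
          refine mul_le_mul_of_nonneg_right ?_ (norm_nonneg _)
          by_cases hx : Q.eval (x : ℂ) = 0
          · rw [hx, zero_div, norm_zero]; positivity
          · have h1 := hε' x hx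
            rw [ratFun, norm_div] at h1
            rw [norm_div, ← inv_div]
            exact inv_anti₀ hε h1))
    rw [natDegree_mul hP0 (X_add_C_pow_ne_zero _ _), natDegree_X_add_C_pow] at hlt
    omega
  · rintro ⟨hdeg, hPx⟩
    have hP0 : P ≠ 0 := by rintro rfl; exact hPx 0 (by simp)
    obtain ⟨K, hK⟩ := bounded_ratFun hP0 (fun z hz hz0 => hPx z.re (by
      rwa [show ((z.re : ℝ) : ℂ) = z by apply Complex.ext <;> simp [hz0]])) hdeg
    refine ⟨(max K 1)⁻¹, by positivity, ?_⟩
    rintro _ ⟨x, hx, rfl⟩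
    have h1 : ‖(ratFun P Q x)⁻¹‖ ≤ max K 1 := by
      rw [ratFun, inv_div]
      exact (hK x).trans (le_max_left _ _)
    rw [dist_zero_left]
    rw [norm_inv] at h1
    exact inv_le_of_inv_le₀ (norm_pos_iff.2 (div_ne_zero (hPx x) hx)) h1

/-! ### The Wiener-Hopf operator -/

/-- The Hilbert space isomorphism `ℱ⁻¹ P₊^*` of `L²(ℝ₊)` onto `H₊`. -/
noncomputable def hardyIso : L2Pos ≃ₗᵢ[ℂ] hardyPlus :=
  invFourierPos.equivRange

lemma hardyIso_coe (g : L2Pos) : (hardyIso g : L2R) = invFourierPos g := rfl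

/-- In terms of `L²(ℝ₊)`, the projection onto the Hardy space is `P₊ ℱ`. -/
lemma hardyIso_restrictPos_fourierL2 (f : L2R) :
    hardyIso (restrictPos (fourierL2 f)) = hardyProj f := by
  refine ((hardyProj_eq_iff f _).2 ?_).symm
  rintro _ ⟨g, rfl⟩
  rw [← fourierL2.inner_map_map, map_sub]
  have h1 : fourierL2 (invFourierPos.toLinearMap g) = extendPos g := fourierL2.apply_symm_apply _
  have h2 : fourierL2 (hardyIso (restrictPos (fourierL2 f)) : L2R)
      = extendPos (restrictPos (fourierL2 f)) := fourierL2.apply_symm_apply _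
  rw [h1, h2, L2.inner_def]
  refine integral_eq_zero_of_ae ?_
  have h3 := (ae_restrict_iff' (measurableSet_Ioi (a := (0 : ℝ)))).1
    (LpToLpRestrictCLM_coeFn ℂ (Set.Ioi 0) (fourierL2 f))
  filter_upwards [extend_coeFn g, extend_coeFn (restrictPos (fourierL2 f)), h3,
    Lp.coeFn_sub (fourierL2 f) (extendPos (restrictPos (fourierL2 f)))] with x h4 h5 h6 h7
  have h4' : (extendPos g : ℝ → ℂ) x = _ := h4
  have h5' : (extendPos (restrictPos (fourierL2 f)) : ℝ → ℂ) x = _ := h5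
  rw [h7, Pi.sub_apply, h4', h5']
  by_cases hx : x ∈ Set.Ioi (0 : ℝ)
  · have h6' : (restrictPos (fourierL2 f) : ℝ → ℂ) x = _ := h6 hx
    rw [Set.indicator_of_mem hx, Set.indicator_of_mem hx, h6']
    simp
  · rw [Set.indicator_of_notMem hx]
    simp

/-- The isomorphism `hardyIso` carries the Wiener-Hopf operator over to `M₊(κ)`. -/
lemma mem_graph_wienerHopf_iff (κ : ℝ → ℂ) (g k : L2Pos) :
    (g, k) ∈ (wienerHopf κ).graph ↔ (hardyIso g, hardyIso k) ∈ (mPlus κ).graph := by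
  rw [LinearPMap.mem_graph_iff, LinearPMap.mem_graph_iff]
  have key : ∀ y : (wienerHopf κ).domain, hardyIso (wienerHopf κ y) =
      mPlus κ ⟨hardyIso (y : L2Pos), y.2⟩ := fun y => hardyIso_restrictPos_fourierL2 _
  constructor
  · rintro ⟨y, hy, hyk⟩
    simp only at hy hyk
    subst hy
    exact ⟨⟨hardyIso (y : L2Pos), y.2⟩, rfl, by rw [← key, hyk]⟩
  · rintro ⟨y, hy, hyk⟩
    simp only at hy hyk
    have hg : g ∈ (wienerHopf κ).domain := by
      have h := y.2
      rw [hy] at h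
      exact h
    refine ⟨⟨g, hg⟩, rfl, hardyIso.injective ?_⟩
    rw [key, ← hyk]
    congr 1
    exact Subtype.ext hy.symm

lemma dense_domain_wienerHopf {κ : ℝ → ℂ} (h : Dense ((mPlus κ).domain : Set hardyPlus)) :
    Dense ((wienerHopf κ).domain : Set L2Pos) := by
  have h1 : ((wienerHopf κ).domain : Set L2Pos) =
      hardyIso.toHomeomorph ⁻¹' ((mPlus κ).domain : Set hardyPlus) := rfl
  rw [h1]
  exact h.preimage hardyIso.toHomeomorph.isOpenMap

lemma isClosed_wienerHopf {κ : ℝ → ℂ} (h : (mPlus κ).IsClosed) : (wienerHopf κ).IsClosed := by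
  have hc : Continuous fun p : L2Pos × L2Pos => (hardyIso p.1, hardyIso p.2) := by fun_prop
  have := _root_.IsClosed.preimage hc h
  change _root_.IsClosed ((wienerHopf κ).graph : Set (L2Pos × L2Pos))
  convert this using 1
  ext ⟨g, k⟩
  exact mem_graph_wienerHopf_iff κ g k

lemma finiteDimensional_kernel_wienerHopf {κ : ℝ → ℂ}
    (h : FiniteDimensional ℂ (kernel (mPlus κ))) :
    FiniteDimensional ℂ (kernel (wienerHopf κ)) := by
  have hmem : ∀ g : kernel (wienerHopf κ), hardyIso (g : L2Pos) ∈ kernel (mPlus κ) := fun g => by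
    have h1 := (mem_kernel_iff _ _).1 g.2
    rw [mem_graph_wienerHopf_iff, map_zero] at h1
    exact (mem_kernel_iff _ _).2 h1
  refine Module.Finite.of_injective (((hardyIso.toLinearEquiv : L2Pos →ₗ[ℂ] hardyPlus) ∘ₗ
    (kernel (wienerHopf κ)).subtype).codRestrict (kernel (mPlus κ)) hmem) fun f g hfg => ?_
  exact Subtype.ext (hardyIso.injective (congrArg
    (fun z : kernel (mPlus κ) => (z : hardyPlus)) hfg))

lemma finiteDimensional_range_orthogonal_wienerHopf {κ : ℝ → ℂ}
    (h : FiniteDimensional ℂ ((range (mPlus κ))ᗮ : Submodule ℂ hardyPlus)) :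
    FiniteDimensional ℂ ((range (wienerHopf κ))ᗮ : Submodule ℂ L2Pos) := by
  have hmem : ∀ g : (range (wienerHopf κ))ᗮ, hardyIso (g : L2Pos) ∈ (range (mPlus κ))ᗮ := by
    intro g y hy
    obtain ⟨x, hx⟩ := (mem_range_iff _ _).1 hy
    obtain ⟨x', rfl⟩ := hardyIso.surjective x
    obtain ⟨y', rfl⟩ := hardyIso.surjective y
    rw [hardyIso.inner_map_map]
    exact g.2 y' ((mem_range_iff _ _).2 ⟨x', (mem_graph_wienerHopf_iff κ x' y').2 hx⟩)
  refine Module.Finite.of_injective (((hardyIso.toLinearEquiv : L2Pos →ₗ[ℂ] hardyPlus) ∘ₗ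
    ((range (wienerHopf κ))ᗮ).subtype).codRestrict ((range (mPlus κ))ᗮ) hmem) fun f g hfg => ?_
  exact Subtype.ext (hardyIso.injective
    (congrArg (fun z : ((range (mPlus κ))ᗮ : Submodule ℂ hardyPlus) => (z : hardyPlus)) hfg))

end WienerHopf

theorem mainTheorem4 (P Q : ℂ[X]) (hP : P ≠ 0) (hQ : Q ≠ 0) (hPQ : IsCoprime P Q) :
    -- `M₊(κ)` is densely defined and closed
    (Dense ((WienerHopf.mPlus (WienerHopf.ratFun P Q)).domain : Set WienerHopf.hardyPlus) ∧
      (WienerHopf.mPlus (WienerHopf.ratFun P Q)).IsClosed) ∧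
    -- the domain is `q / (x + i) ^ ς H₊`
    WienerHopf.asFunctions (WienerHopf.mPlus (WienerHopf.ratFun P Q)).domain =
      WienerHopf.mulHardy (WienerHopf.ratFun (WienerHopf.partReal Q)
        ((X + C Complex.I) ^ WienerHopf.poleExp P Q)) ∧
    -- the range is `P_{H₊} (P / (Q_> Q_< (x + i) ^ ς) H₊)`
    (WienerHopf.mulHardy (WienerHopf.ratFun P
        (C Q.leadingCoeff * WienerHopf.partGT Q * WienerHopf.partLT Q *
          (X + C Complex.I) ^ WienerHopf.poleExp P Q)) ⊆ {f | f ∈ Lp ℂ 2 (volume : Measure ℝ)} ∧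
      (WienerHopf.range (WienerHopf.mPlus (WienerHopf.ratFun P Q)) : Set WienerHopf.hardyPlus) =
        WienerHopf.hardyProj '' {f : WienerHopf.L2R | (f : ℝ →ₘ[volume] ℂ) ∈
          WienerHopf.mulHardy (WienerHopf.ratFun P
            (C Q.leadingCoeff * WienerHopf.partGT Q * WienerHopf.partLT Q *
              (X + C Complex.I) ^ WienerHopf.poleExp P Q))}) ∧
    -- the kernel
    (WienerHopf.asFunctions (WienerHopf.kernel (WienerHopf.mPlus (WienerHopf.ratFun P Q))) =
        WienerHopf.mulPoly (WienerHopf.ratFun (WienerHopf.partLE Q) (WienerHopf.partLT P))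
          (min (((WienerHopf.partLT P).natDegree : ℤ) - (WienerHopf.partLE Q).natDegree)
            (((WienerHopf.partGT Q).natDegree : ℤ) - (WienerHopf.partGE P).natDegree)) ∧
      FiniteDimensional ℂ (WienerHopf.kernel (WienerHopf.mPlus (WienerHopf.ratFun P Q)))) ∧
    -- the deficiency space
    (WienerHopf.asFunctions ((WienerHopf.range (WienerHopf.mPlus (WienerHopf.ratFun P Q)))ᗮ :
          Submodule ℂ WienerHopf.hardyPlus) =
        WienerHopf.mulPoly (WienerHopf.ratFun
            (WienerHopf.partLT (WienerHopf.conjPoly Q)) (WienerHopf.partLT (WienerHopf.conjPoly P)))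
          (((WienerHopf.partGT P).natDegree : ℤ) - (WienerHopf.partGT Q).natDegree) ∧
      FiniteDimensional ℂ ((WienerHopf.range (WienerHopf.mPlus (WienerHopf.ratFun P Q)))ᗮ :
        Submodule ℂ WienerHopf.hardyPlus)) ∧
    -- the Fredholm property
    [WienerHopf.IsFredholmOp (WienerHopf.mPlus (WienerHopf.ratFun P Q)),
      IsClosed (WienerHopf.range (WienerHopf.mPlus (WienerHopf.ratFun P Q)) :
        Set WienerHopf.hardyPlus),
      Q.natDegree ≤ P.natDegree ∧ ∀ x : ℝ, P.eval (x : ℂ) ≠ 0,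
      (0 : ℂ) ∉ closure (WienerHopf.ratRange P Q)].TFAE ∧
    -- the Wiener-Hopf operator `W_κ`
    (Dense ((WienerHopf.wienerHopf (WienerHopf.ratFun P Q)).domain : Set WienerHopf.L2Pos) ∧
      (WienerHopf.wienerHopf (WienerHopf.ratFun P Q)).IsClosed ∧
      FiniteDimensional ℂ (WienerHopf.kernel (WienerHopf.wienerHopf (WienerHopf.ratFun P Q))) ∧
      FiniteDimensional ℂ ((WienerHopf.range (WienerHopf.wienerHopf (WienerHopf.ratFun P Q)))ᗮ :
        Submodule ℂ WienerHopf.L2Pos)) ∧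
    -- `ℱ⁻¹ P₊^*` is a Hilbert space isomorphism that carries `W_κ` over to `M₊(κ)`
    (∃ U : WienerHopf.L2Pos ≃ₗᵢ[ℂ] WienerHopf.hardyPlus,
      (∀ g, (U g : WienerHopf.L2R) = WienerHopf.invFourierPos g) ∧
      ∀ g k, (g, k) ∈ (WienerHopf.wienerHopf (WienerHopf.ratFun P Q)).graph ↔
        (U g, U k) ∈ (WienerHopf.mPlus (WienerHopf.ratFun P Q)).graph) := by
  refine ⟨⟨WienerHopf.dense_domain_mPlus hQ, WienerHopf.isClosed_mPlus hQ⟩,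
    WienerHopf.asFunctions_domain hQ hPQ,
    ⟨WienerHopf.mulHardy_reducedDenom_subset hQ, WienerHopf.range_mPlus hQ hPQ⟩,
    ⟨WienerHopf.asFunctions_kernel hP hQ hPQ, WienerHopf.finiteDimensional_kernel_mPlus hP hQ hPQ⟩,
    ⟨WienerHopf.asFunctions_range_orthogonal hP hQ hPQ,
      WienerHopf.finiteDimensional_range_orthogonal hP hQ hPQ⟩, ?_,
    ⟨WienerHopf.dense_domain_wienerHopf (WienerHopf.dense_domain_mPlus hQ),
      WienerHopf.isClosed_wienerHopf (WienerHopf.isClosed_mPlus hQ),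
      WienerHopf.finiteDimensional_kernel_wienerHopf
        (WienerHopf.finiteDimensional_kernel_mPlus hP hQ hPQ),
      WienerHopf.finiteDimensional_range_orthogonal_wienerHopf
        (WienerHopf.finiteDimensional_range_orthogonal hP hQ hPQ)⟩,
    ⟨WienerHopf.hardyIso, WienerHopf.hardyIso_coe, WienerHopf.mem_graph_wienerHopf_iff _⟩⟩
  tfae_have 1 → 2 := fun h => h.isClosed_range
  tfae_have 2 → 3 := WienerHopf.no_zeros_of_isClosed_range hP hQ hPQ
  tfae_have 3 → 1 := fun h => WienerHopf.isFredholmOp_mPlus hP hQ hPQ h.1 h.2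
  tfae_have 4 ↔ 3 := WienerHopf.zero_notMem_closure_ratRange_iff hQ hPQ
  tfae_finish
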